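/- Let $\mathbf k$ be an algebraically closed field of characteristic zero and let $\mathfrak a$ be a finite-dimensional algebraic Lie algebra over $\mathbf k$ (that is, isomorphic to the Lie algebra of a linear algebraic group). Let $\mathbf A\subset GL(\mathfrak a)$ be its adjoint group, i.e. the smallest Zariski closed subgroup of $GL(\mathfrak a)$ whose Lie algebra contains $\operatorname{ad}\mathfrak a$; it acts on the symmetric algebra $S(\mathfrak a)$ (the algebra of polynomial functions on $\mathfrak a^*$) and on $\mathfrak a^*$ by the co-adjoint action. Let $Y(\mathfrak a)=S(\mathfrak a)^{\mathbf A}$, and let $Sy(\mathfrak a)$ be the linear span of the semi-invariants of $S(\mathfrak a)$, i.e. of the $f\in S(\mathfrak a)$ such that for every $x\in\mathfrak a$ one has $(\operatorname{ad}x)f=\chi(x)f$ for some scalar $\chi(x)$. Assume that $Sy(\mathfrak a)=Y(\mathfrak a)$. Let $\eta\in\mathfrak a^*$, let $V$ be a linear subspace of $\mathfrak a^*$, and let $R[\eta+V]$ be the algebra of regular functions on $\eta+V$. Suppose that $\eta+V$ is a Weierstrass section for $\mathfrak a$, i.e. (i) restriction of functions induces an algebra isomorphism of $Y(\mathfrak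 a)$ onto $R[\eta+V]$. Then (ii) $\mathbf A\cdot(\eta+V)$ is Zariski dense in $\mathfrak a^*$; moreover $\eta+V$ contains a regular element, i.e. some $\xi$ whose stabilizer $\mathfrak a^\xi=\{x\in\mathfrak a: x\cdot\xi=0\}$ has the smallest dimension among all stabilizers of elements of $\mathfrak a^*$; (iii) every co-adjoint orbit $\mathbf A\cdot\xi$, $\xi\in\mathfrak a^*$, meets $\eta+V$ in at most one point, and $\mathfrak a\cdot s\cap V=\{0\}$ for every $s\in\eta+V$ (transversality). Consequently $\eta+V$ is an affine slice for $\mathfrak a$: $\mathbf A\cdot(\eta+V)$ is Zariski dense in $\mathfrak a^*$, and every orbit contained in $\mathbf A\cdot(\eta+V)$ meets $\eta+V$ in exactly one point, and transversally there. -/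

import Mathlib

namespace CoadjointSlice

open SymmetricAlgebra

noncomputable section

/-! ## Polynomial functions and derivations on a symmetric algebra -/

section SymmetricAlgebra

variable {k M : Type*} [Field k] [AddCommGroup M] [Module k M]

/-- The value of `f ∈ S(M)`, viewed as a polynomial function on the dual space `M*`, at `ξ ∈ M*`:
the algebra homomorphism `f ↦ f(ξ)` which sends `m ∈ M` to `ξ(m)`. -/
def evalAt (ξ : Module.Dual k M) : SymmetricAlgebra k M →ₐ[k] k :=
  SymmetricAlgebra.lift ξ

/-- Auxiliary: the algebra homomorphism `S(M) → S(M)[ε]` sending `m ∈ M` to `m + ε d(m)`. -/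
def dualNumberLift (d : M →ₗ[k] SymmetricAlgebra k M) :
    SymmetricAlgebra k M →ₐ[k] DualNumber (SymmetricAlgebra k M) :=
  SymmetricAlgebra.lift
    ((TrivSqZeroExt.inlAlgHom k (SymmetricAlgebra k M) (SymmetricAlgebra k M)).toLinearMap ∘ₗ
        SymmetricAlgebra.ι k M +
      (TrivSqZeroExt.inrHom (SymmetricAlgebra k M) (SymmetricAlgebra k M)).restrictScalars k ∘ₗ d)

theorem fst_dualNumberLift (d : M →ₗ[k] SymmetricAlgebra k M) (f : SymmetricAlgebra k M) :
    (dualNumberLift d f).fst = f := by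
  have h : (TrivSqZeroExt.fstHom k (SymmetricAlgebra k M) (SymmetricAlgebra k M)).comp
      (dualNumberLift d) = AlgHom.id k _ := by
    apply SymmetricAlgebra.algHom_ext
    ext m
    simp [dualNumberLift]
  exact DFunLike.congr_fun h f

/-- The unique `k`-linear derivation of `S(M)` extending a linear map `d : M → S(M)`. -/
def derivationOfLinear (d : M →ₗ[k] SymmetricAlgebra k M) :
    Derivation k (SymmetricAlgebra k M) (SymmetricAlgebra k M) :=
  Derivation.mk'
    ((TrivSqZeroExt.sndHom (SymmetricAlgebra k M) (SymmetricAlgebra k M)).restrictScalars k ∘ₗ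
      (dualNumberLift d).toLinearMap)
    (by
      intro f g
      simp [fst_dualNumberLift, TrivSqZeroExt.snd_mul, mul_comm])

@[simp]
theorem derivationOfLinear_ι (d : M →ₗ[k] SymmetricAlgebra k M) (m : M) :
    derivationOfLinear d (SymmetricAlgebra.ι k M m) = d m := by
  simp [derivationOfLinear, dualNumberLift]

end SymmetricAlgebra

/-! ## Linear algebraic groups and their Lie algebras -/

section LinearGroups

variable {k W : Type*} [Field k] [AddCommGroup W] [Module k W]

/-- The value at `u ∈ End(W)` of a polynomial function `p ∈ S(End(W)*)` on `End(W)`. -/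
def evalEnd (u : Module.End k W) : SymmetricAlgebra k (Module.Dual k (Module.End k W)) →ₐ[k] k :=
  evalAt (Module.Dual.eval k (Module.End k W) u)

/-- The derivative of polynomial functions on `End(W)` in the constant direction `x ∈ End(W)`:
the derivation of `S(End(W)*)` which sends a linear form `φ` to the constant `φ(x)`. -/
def directionalDerivative (x : Module.End k W) :
    Derivation k (SymmetricAlgebra k (Module.Dual k (Module.End k W)))
      (SymmetricAlgebra k (Module.Dual k (Module.End k W))) :=
  derivationOfLinear (Algebra.linearMap k _ ∘ₗ Module.Dual.eval k (Module.End k W) x)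

/-- A subgroup of `GL(W)` is Zariski closed (that is, a linear algebraic group) if it is the set of
common zeros in `GL(W)` of a set of polynomial functions on `End(W)`. -/
def IsZariskiClosed (H : Subgroup (LinearMap.GeneralLinearGroup k W)) : Prop :=
  ∃ P : Set (SymmetricAlgebra k (Module.Dual k (Module.End k W))),
    ∀ g : LinearMap.GeneralLinearGroup k W,
      g ∈ H ↔ ∀ p ∈ P, evalEnd (g : Module.End k W) p = 0

/-- The Lie algebra of a (Zariski closed) subgroup `H` of `GL(W)`, as a subset of `End(W)`: the
tangent space of `H` at the identity. -/
def lieOfGroup (H : Subgroup (LinearMap.GeneralLinearGroup k W)) : Set (Module.End k W) :=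
  {x | ∀ p : SymmetricAlgebra k (Module.Dual k (Module.End k W)),
    (∀ h ∈ H, evalEnd (h : Module.End k W) p = 0) → evalEnd 1 (directionalDerivative x p) = 0}

end LinearGroups

/-! ## Algebraic Lie algebras, the adjoint group, invariants and semi-invariants -/

section LieAlgebras

attribute [local instance] LieRing.ofAssociativeRing LieAlgebra.ofAssociativeAlgebra

variable (k 𝔞 : Type*) [Field k] [LieRing 𝔞] [LieAlgebra k 𝔞]

/-- A Lie algebra is algebraic if it is isomorphic to the Lie algebra of a linear algebraic
group. -/
def IsAlgebraic : Prop :=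
  ∃ (n : ℕ) (G : Subgroup (LinearMap.GeneralLinearGroup k (Fin n → k)))
    (ρ : 𝔞 →ₗ⁅k⁆ Module.End k (Fin n → k)),
    IsZariskiClosed G ∧ Function.Injective ρ ∧ Set.range ρ = lieOfGroup G

/-- The adjoint group `𝐀` of `𝔞`: the smallest Zariski closed subgroup of `GL(𝔞)` whose Lie algebra
contains `ad 𝔞`. -/
def adjointGroup : Subgroup (LinearMap.GeneralLinearGroup k 𝔞) :=
  sInf {H | IsZariskiClosed H ∧ ∀ x : 𝔞, LieAlgebra.ad k 𝔞 x ∈ lieOfGroup H}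

variable {k 𝔞}

/-- The automorphism of the algebra `S(𝔞)` induced by `a ∈ GL(𝔞)` (written as an algebra
endomorphism). -/
def symAction (a : LinearMap.GeneralLinearGroup k 𝔞) :
    SymmetricAlgebra k 𝔞 →ₐ[k] SymmetricAlgebra k 𝔞 :=
  SymmetricAlgebra.lift (SymmetricAlgebra.ι k 𝔞 ∘ₗ (a : 𝔞 →ₗ[k] 𝔞))

/-- The adjoint action of `x ∈ 𝔞` on `S(𝔞)`: the derivation extending `y ↦ [x, y]`. -/
def symAd (x : 𝔞) : Derivation k (SymmetricAlgebra k 𝔞) (SymmetricAlgebra k 𝔞) :=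
  derivationOfLinear (SymmetricAlgebra.ι k 𝔞 ∘ₗ (LieAlgebra.ad k 𝔞 x : 𝔞 →ₗ[k] 𝔞))

variable (k 𝔞)

/-- `Y(𝔞) = S(𝔞)^𝐀`, the algebra of invariants of the adjoint group in `S(𝔞)`. -/
def invariants : Subalgebra k (SymmetricAlgebra k 𝔞) where
  carrier := {f | ∀ a ∈ adjointGroup k 𝔞, symAction a f = f}
  mul_mem' hf hg a ha := by rw [map_mul, hf a ha, hg a ha]
  add_mem' hf hg a ha := by rw [map_add, hf a ha, hg a ha]
  algebraMap_mem' r a _ := (symAction a).commutes r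

/-- `Sy(𝔞)`, the Poisson semicentre: the linear span of the semi-invariants of `S(𝔞)` under the
action of `𝔞`. -/
def poissonSemicentre : Submodule k (SymmetricAlgebra k 𝔞) :=
  Submodule.span k {f | ∃ χ : 𝔞 → k, ∀ x : 𝔞, symAd x f = χ x • f}

variable {k 𝔞}

/-! ## The co-adjoint action -/

/-- The co-adjoint action of `a ∈ GL(𝔞)` on `𝔞*`: `(a·ξ)(x) = ξ(a⁻¹ x)`. -/
def coadjoint (a : LinearMap.GeneralLinearGroup k 𝔞) (ξ : Module.Dual k 𝔞) : Module.Dual k 𝔞 :=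
  ξ ∘ₗ ((a⁻¹ : LinearMap.GeneralLinearGroup k 𝔞) : 𝔞 →ₗ[k] 𝔞)

/-- The co-adjoint orbit `𝐀·ξ`. -/
def coadjointOrbit (ξ : Module.Dual k 𝔞) : Set (Module.Dual k 𝔞) :=
  {ζ | ∃ a ∈ adjointGroup k 𝔞, ζ = coadjoint a ξ}

/-- The union `𝐀·T` of the co-adjoint orbits through a subset `T` of `𝔞*`. -/
def saturation (T : Set (Module.Dual k 𝔞)) : Set (Module.Dual k 𝔞) :=
  {ζ | ∃ ξ ∈ T, ζ ∈ coadjointOrbit ξ}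

/-- The linear map `x ↦ x·ξ` from `𝔞` to `𝔞*`, for the co-adjoint action
`(x·ξ)(y) = -ξ([x, y])` of `𝔞`. -/
def infinitesimalAction (ξ : Module.Dual k 𝔞) : 𝔞 →ₗ[k] Module.Dual k 𝔞 where
  toFun x := ⁅x, ξ⁆
  map_add' x y := add_lie x y ξ
  map_smul' c x := smul_lie c x ξ

/-- The subspace `𝔞·ξ` of `𝔞*`. -/
def infinitesimalOrbit (ξ : Module.Dual k 𝔞) : Submodule k (Module.Dual k 𝔞) :=
  LinearMap.range (infinitesimalAction ξ)

/-- The stabilizer `𝔞^ξ = {x ∈ 𝔞 | x·ξ = 0}`. -/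
def stabilizer (ξ : Module.Dual k 𝔞) : Submodule k 𝔞 :=
  LinearMap.ker (infinitesimalAction ξ)

/-- `ξ ∈ 𝔞*` is regular if its stabilizer has minimal dimension. -/
def IsRegular (ξ : Module.Dual k 𝔞) : Prop :=
  ∀ ζ : Module.Dual k 𝔞, Module.finrank k (stabilizer ξ) ≤ Module.finrank k (stabilizer ζ)

/-- The Zariski closure of a subset of `𝔞*`: the common zeros of all polynomial functions vanishing
on it. -/
def zariskiClosure (T : Set (Module.Dual k 𝔞)) : Set (Module.Dual k 𝔞) :=
  {ξ | ∀ f : SymmetricAlgebra k 𝔞, (∀ ζ ∈ T, evalAt ζ f = 0) → evalAt ξ f = 0}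

/-! ## Weierstrass sections and affine slices -/

/-- The linear subvariety `η + V` of `𝔞*`. -/
def linearSubvariety (η : Module.Dual k 𝔞) (V : Submodule k (Module.Dual k 𝔞)) :
    Set (Module.Dual k 𝔞) :=
  {ξ | ∃ v ∈ V, ξ = η + v}

/-- Restriction of polynomial functions from `𝔞*` to a subset `T`. -/
def restriction (T : Set (Module.Dual k 𝔞)) : SymmetricAlgebra k 𝔞 →ₐ[k] (T → k) :=
  AlgHom.pi fun ξ => evalAt (ξ : Module.Dual k 𝔞)

/-- The algebra `R[T]` of regular functions on a Zariski closed subset `T` of `𝔞*`: the functions on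
`T` which are restrictions of polynomial functions on `𝔞*`. -/
def regularFunctions (T : Set (Module.Dual k 𝔞)) : Subalgebra k (T → k) :=
  (restriction T).range

/-- The restriction map `φ : Y(𝔞) → R[T]`. -/
def invariantRestriction (T : Set (Module.Dual k 𝔞)) :
    invariants k 𝔞 →ₐ[k] regularFunctions T :=
  (restriction T).rangeRestrict.comp (invariants k 𝔞).val

/-- `η + V` is a Weierstrass section for `𝔞`: restriction of functions is an isomorphism of algebras
of `Y(𝔞)` onto `R[η + V]`. -/
def IsWeierstrassSection (η : Module.Dual k 𝔞) (V : Submodule k (Module.Dual k 𝔞)) : Prop :=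
  Function.Bijective (invariantRestriction (linearSubvariety η V))

/-- The co-adjoint orbit through the point `s` of `η + V` is transversal to `η + V` at `s`: the sum
of `𝔞·s` and of the tangent space `V` of `η + V` at `s` is direct. -/
def IsTransversalAt (V : Submodule k (Module.Dual k 𝔞)) (s : Module.Dual k 𝔞) : Prop :=
  Disjoint (infinitesimalOrbit s) V

/-- `η + V` is an affine slice for `𝔞`: `𝐀·(η + V)` is dense in `𝔞*`, and every orbit in
`𝐀·(η + V)` cuts `η + V` at exactly one point, and transversally there. -/
def IsAffineSlice (η : Module.Dual k 𝔞) (V : Submodule k (Module.Dual k 𝔞)) : Prop :=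
  zariskiClosure (saturation (linearSubvariety η V)) = Set.univ ∧
  ∀ ξ ∈ saturation (linearSubvariety η V), ∃ s,
    coadjointOrbit ξ ∩ linearSubvariety η V = {s} ∧ IsTransversalAt V s

end LieAlgebras

end

end CoadjointSlice

namespace CoadjointSlice

open SymmetricAlgebra

/-! ## Derivations along an algebra homomorphism -/

section Leibniz

variable {k M B : Type*} [Field k] [AddCommGroup M] [Module k M] [CommRing B] [Algebra k B]

/-! Since restriction is onto, every linear coordinate on `η + V` is the restriction of an
invariant. Invariants are constant on orbits and annihilated by `𝔞`, so an orbit meets `η + V` at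
most once, and no nonzero vector of `V` is tangent to an orbit at a point of `η + V`. The
annihilation by `𝔞` rests on `ad 𝔞 ⊆ Lie 𝐀` (`mem_lieOfGroup_sInf`), where characteristic zero
enters because `𝐀` is an intersection of groups.

Everything else follows from one point `s ∈ η + V` with `dim 𝔞^s ≤ dim V`, together with `dim V ≤
dim 𝔞^ζ` for all `ζ` (`IsWeierstrassSection.exists_finrank_stabilizer`). Then `s` is regular, and
transversality gives `𝔞·s ⊕ V = 𝔞*`. A function vanishing on `𝐀·(η + V)` then has zero Taylor
expansion at `s` (`eq_zero_of_sup_eq_top`), which is density.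

To find `s`, let `Ω = ([X_i, X_j])` be the commutator matrix and `m = dim 𝔞 - dim V`. The lifts
`f_i` of the coordinates of `η + V` generate `Y(𝔞)`, so there are `m` elements of `S(𝔞)`
algebraically independent over `Y(𝔞)`. A differential form of Rosenlicht's theorem
(`card_le_rank_of_model`) shows that the generic rank of `Ω` is at least `m`. Its proof works in the
function field of a formal model of pairs (point `ξ` of `𝔞*`, group element `g`). Functions
independent over `Y(𝔞)` become, at the moved point `x ↦ ξ(g⁻¹xg)`, independent over the functions of
`ξ`: a shortest relation has coefficient ratios killed by `𝔞`, and `Sy = Y` makes these ratios of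
invariants. Derivations dual to the moved functions differentiate `g` along the Lie algebra only, so
their Jacobian factors through `Ω`.

The Jacobian matrix `B` of the `f_i` satisfies `B Ω = 0`, and its leading minor `b` equals `1` on `η
+ V`. Hence the generic rank is exactly `m` and the complementary diagonal minor `q` of `Ω` is
nonzero. The logarithmic derivative of `q / b²` along `x` is `2 tr (ad x)`, so its reduced numerator
`g` is semi-invariant, hence invariant. As restriction is injective, `g(s) ≠ 0` for some `s ∈ η +
V`; since `b = 1` there, `q(s) ≠ 0`. -/

theorem algHom_congr {φ ψ : SymmetricAlgebra k M →ₐ[k] B}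
    (h : ∀ m, φ (ι k M m) = ψ (ι k M m)) (f : SymmetricAlgebra k M) : φ f = ψ f := by
  have : φ = ψ := SymmetricAlgebra.algHom_ext (LinearMap.ext h)
  rw [this]

/-- Two derivations of `S(M)` along the same algebra homomorphism agree if they agree on `M`. -/
theorem leibniz_ext (φ : SymmetricAlgebra k M →ₐ[k] B) (d₁ d₂ : SymmetricAlgebra k M →ₗ[k] B)
    (h₁ : ∀ f g, d₁ (f * g) = φ f * d₁ g + φ g * d₁ f)
    (h₂ : ∀ f g, d₂ (f * g) = φ f * d₂ g + φ g * d₂ f)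
    (h : ∀ m, d₁ (ι k M m) = d₂ (ι k M m)) (f : SymmetricAlgebra k M) : d₁ f = d₂ f := by
  have one : ∀ d : SymmetricAlgebra k M →ₗ[k] B,
      (∀ f g, d (f * g) = φ f * d g + φ g * d f) → d 1 = 0 := by
    intro d hd
    have := hd 1 1
    simpa using this
  induction f using SymmetricAlgebra.induction with
  | algebraMap r =>
    rw [Algebra.algebraMap_eq_smul_one, map_smul, map_smul, one _ h₁, one _ h₂]
  | ι x => exact h x
  | mul a b ha hb => rw [h₁, h₂, ha, hb]
  | add a b ha hb => rw [map_add, map_add, ha, hb]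

/-- An algebra homomorphism intertwines two derivations if it does so on generators. -/
theorem map_derivation_eq (φ : SymmetricAlgebra k M →ₐ[k] B)
    (D : Derivation k (SymmetricAlgebra k M) (SymmetricAlgebra k M)) (D' : Derivation k B B)
    (h : ∀ m, D' (φ (ι k M m)) = φ (D (ι k M m))) (f : SymmetricAlgebra k M) :
    D' (φ f) = φ (D f) := by
  refine leibniz_ext φ (D'.toLinearMap ∘ₗ φ.toLinearMap) (φ.toLinearMap ∘ₗ D.toLinearMap)
    ?_ ?_ h f
  · intro f g
    simp [Derivation.leibniz]
  · intro f g
    simp [Derivation.leibniz]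

theorem derivation_ext {D D' : Derivation k (SymmetricAlgebra k M) (SymmetricAlgebra k M)}
    (h : ∀ m, D (ι k M m) = D' (ι k M m)) : D = D' := by
  ext f
  exact (map_derivation_eq (AlgHom.id k _) D' D h f)

end Leibniz

/-! ## Ideals stable under derivations -/

section Stable

variable {k R : Type*} [Field k] [CommRing R] [Algebra k R]

/-- `I` is stable under all the derivations in `𝓓`. -/
def IsStable (𝓓 : Set (Derivation k R R)) (I : Ideal R) : Prop :=
  ∀ D ∈ 𝓓, ∀ f ∈ I, D f ∈ I

theorem IsStable.sSup {𝓓 : Set (Derivation k R R)} {T : Set (Ideal R)}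
    (h : ∀ I ∈ T, IsStable 𝓓 I) : IsStable 𝓓 (sSup T) := by
  intro D hD f hf
  rw [sSup_eq_iSup'] at hf ⊢
  induction hf using Submodule.iSup_induction' with
  | mem I x hx => exact Submodule.mem_iSup_of_mem I (h I I.2 D hD x hx)
  | zero => simp
  | add x y _ _ hx hy => rw [map_add]; exact add_mem hx hy

/-- A set whose derivatives lie in an ideal spans, together with it, a stable ideal. -/
theorem IsStable.span {𝓓 : Set (Derivation k R R)} {T : Set R}
    (h : ∀ D ∈ 𝓓, ∀ t ∈ T, D t ∈ Ideal.span T) : IsStable 𝓓 (Ideal.span T) := by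
  intro D hD f hf
  induction hf using Submodule.span_induction with
  | mem t ht => exact h D hD t ht
  | zero => simp
  | add x y _ _ hx hy => rw [map_add]; exact add_mem hx hy
  | smul a x hx hx' =>
    rw [smul_eq_mul, Derivation.leibniz, smul_eq_mul, smul_eq_mul]
    exact add_mem (Ideal.mul_mem_left _ _ hx') (Ideal.mul_mem_right _ _ hx)

/-- In characteristic zero the minimal primes over a stable ideal are stable. -/
theorem IsStable.minimalPrime [CharZero k] {𝓓 : Set (Derivation k R R)} {I p : Ideal R}
    (hI : IsStable 𝓓 I) (hp : p ∈ I.minimalPrimes) : IsStable 𝓓 p := by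
  have hpp : p.IsPrime := hp.1.1
  intro D hD f hf
  -- By minimality of `p`, the element `f` is nilpotent in the localization of `R/I` at `p`;
  -- otherwise a prime over `I` avoiding both `f` and the complement of `p` would exist.
  have key : ∃ n : ℕ, ∃ s, s ∉ p ∧ s * f ^ n ∈ I := by
    by_contra! hcon
    let M : Submonoid R := p.primeCompl ⊔ Submonoid.powers f
    have hdisj : Disjoint (I : Set R) M := by
      rw [Set.disjoint_left]
      intro x hxI hxM
      obtain ⟨s, hs, t, ⟨n, rfl⟩, rfl⟩ := Submonoid.mem_sup.1 hxM
      exact hcon n s hs hxI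
    obtain ⟨q, hq, hIq, hqM⟩ := Ideal.exists_le_prime_disjoint I M hdisj
    have hqp : q ≤ p := by
      intro x hx
      by_contra hxp
      exact Set.disjoint_left.1 hqM hx (Submonoid.mem_sup_left hxp)
    have := hp.2 ⟨hq, hIq⟩ hqp hf
    exact Set.disjoint_left.1 hqM this (Submonoid.mem_sup_right (Submonoid.mem_powers f))
  by_contra hDf
  classical
  obtain ⟨s, hs, hsf⟩ := Nat.find_spec key
  have hn : Nat.find key ≠ 0 := by
    intro h0
    rw [h0, pow_zero, mul_one] at hsf
    exact hs (hp.1.2 hsf)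
  obtain ⟨n, hn'⟩ := Nat.exists_eq_succ_of_ne_zero hn
  rw [hn'] at hsf
  -- Differentiating `s f^(n+1) ∈ I` and multiplying by `s` leaves `(n+1) s² D(f) fⁿ` modulo `I`. If
  -- `D f ∉ p`, the multiplier `s² D(f)` contradicts the minimality of the exponent; dividing by
  -- `n+1` uses characteristic zero.
  refine Nat.find_min key (m := n) (by omega) ⟨s * s * D f, ?_, ?_⟩
  · intro h
    rcases hpp.mem_or_mem h with h | h
    · exact (hpp.mem_or_mem h).elim hs hs
    · exact hDf h
  · have h1 := hI D hD _ hsf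
    have h2 : ((n + 1 : ℕ) : R) * (s * s * D f * f ^ n) ∈ I := by
      have : ((n + 1 : ℕ) : R) * (s * s * D f * f ^ n) =
          s * D (s * f ^ (n + 1)) - D s * (s * f ^ (n + 1)) := by
        rw [Derivation.leibniz, Derivation.leibniz_pow]
        simp only [smul_eq_mul, nsmul_eq_mul, Nat.add_sub_cancel]
        ring
      rw [this]
      exact sub_mem (Ideal.mul_mem_left _ _ h1) (Ideal.mul_mem_left _ _ hsf)
    have h3 := Ideal.mul_mem_left I (algebraMap k R ((n + 1 : ℕ) : k)⁻¹) h2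
    rw [← mul_assoc, ← map_natCast (algebraMap k R), ← map_mul, inv_mul_cancel₀
      (Nat.cast_ne_zero.2 (Nat.succ_ne_zero n)), map_one, one_mul] at h3
    exact h3

theorem IsStable.radical [CharZero k] {𝓓 : Set (Derivation k R R)} {I : Ideal R}
    (hI : IsStable 𝓓 I) : IsStable 𝓓 I.radical := by
  intro D hD f hf
  rw [← Ideal.sInf_minimalPrimes, Ideal.mem_sInf] at hf ⊢
  intro p hp
  exact hI.minimalPrime hp D hD f (hf hp)

/-- The largest stable ideal contained in an ideal. -/
def maxStable (𝓓 : Set (Derivation k R R)) (m : Ideal R) : Ideal R :=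
  sSup {I | IsStable 𝓓 I ∧ I ≤ m}

theorem isStable_maxStable (𝓓 : Set (Derivation k R R)) (m : Ideal R) :
    IsStable 𝓓 (maxStable 𝓓 m) :=
  IsStable.sSup fun _ h => h.1

theorem maxStable_le (𝓓 : Set (Derivation k R R)) (m : Ideal R) : maxStable 𝓓 m ≤ m :=
  sSup_le fun _ h => h.2

theorem le_maxStable {𝓓 : Set (Derivation k R R)} {m I : Ideal R} (h : IsStable 𝓓 I)
    (h' : I ≤ m) : I ≤ maxStable 𝓓 m :=
  le_sSup ⟨h, h'⟩

theorem subset_maxStable {𝓓 : Set (Derivation k R R)} {m : Ideal R} {T : Set R}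
    (h : ∀ D ∈ 𝓓, ∀ t ∈ T, D t ∈ Ideal.span T) (h' : T ⊆ m) : T ⊆ maxStable 𝓓 m :=
  fun _ ht => le_maxStable (IsStable.span h) (Ideal.span_le.2 h') (Ideal.subset_span ht)

/-- A minimal prime over the largest stable ideal lying inside `m` is itself stable and inside `m`,
so maximality makes the two equal. -/
theorem maxStable_isPrime [CharZero k] (𝓓 : Set (Derivation k R R)) (m : Ideal R)
    [m.IsPrime] : (maxStable 𝓓 m).IsPrime := by
  obtain ⟨p, hp, hpm⟩ := Ideal.exists_minimalPrimes_le (maxStable_le 𝓓 m)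
  have : maxStable 𝓓 m = p :=
    le_antisymm hp.1.2 (le_maxStable ((isStable_maxStable 𝓓 m).minimalPrime hp) hpm)
  rw [this]
  exact hp.1.1

end Stable

end CoadjointSlice

namespace CoadjointSlice

open SymmetricAlgebra

/-! ## Values of polynomial functions -/

section Values

variable {k M : Type*} [Field k] [AddCommGroup M] [Module k M]

@[simp]
theorem evalAt_ι (ξ : Module.Dual k M) (m : M) : evalAt ξ (ι k M m) = ξ m := by
  simp [evalAt]

/-- Hilbert's Nullstellensatz for the algebra of polynomial functions on `M*`. -/
theorem mem_radical_of_forall_evalAt [IsAlgClosed k] [FiniteDimensional k M]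
    {I : Ideal (SymmetricAlgebra k M)} {f : SymmetricAlgebra k M}
    (h : ∀ ξ : Module.Dual k M, (∀ p ∈ I, evalAt ξ p = 0) → evalAt ξ f = 0) : f ∈ I.radical := by
  let b := Module.finBasis k M
  let e := SymmetricAlgebra.equivMvPolynomial b
  have hev : ∀ (x : Fin (Module.finrank k M) → k) p,
      MvPolynomial.aeval x (e p) = evalAt (b.constr k x) p := by
    intro x p
    have : (MvPolynomial.aeval x).comp e.toAlgHom = evalAt (b.constr k x) := by
      apply SymmetricAlgebra.algHom_ext
      apply b.ext
      intro i
      simp [e]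
    exact DFunLike.congr_fun this p
  have hmem : e f ∈ MvPolynomial.vanishingIdeal k
      (MvPolynomial.zeroLocus k (I.map e)) := by
    intro x hx
    rw [hev]
    apply h
    intro p hp
    rw [← hev]
    exact hx _ (Ideal.mem_map_of_mem _ hp)
  rw [MvPolynomial.vanishingIdeal_zeroLocus_eq_radical] at hmem
  obtain ⟨n, hn⟩ := hmem
  refine ⟨n, ?_⟩
  rw [← map_pow] at hn
  rw [Ideal.mem_map_iff_of_surjective _ e.surjective] at hn
  obtain ⟨x, hx, hxe⟩ := hn
  rwa [← e.injective hxe]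

/-- A polynomial function with no values except zero vanishes. -/
theorem eq_zero_of_forall_evalAt [Infinite k] [FiniteDimensional k M]
    {f : SymmetricAlgebra k M} (h : ∀ ξ : Module.Dual k M, evalAt ξ f = 0) : f = 0 := by
  let b := Module.finBasis k M
  let e := SymmetricAlgebra.equivMvPolynomial b
  apply e.injective
  rw [map_zero]
  apply MvPolynomial.funext
  intro x
  have : (MvPolynomial.aeval x).comp e.toAlgHom = evalAt (b.constr k x) := by
    apply SymmetricAlgebra.algHom_ext
    apply b.ext
    intro i
    simp [e]
  have h2 := DFunLike.congr_fun this f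
  simp only [AlgHom.comp_apply] at h2
  rw [h] at h2
  rw [map_zero]
  exact h2

end Values

/-! ## Invariant derivations on `End(W)` -/

section Groups

variable {k W : Type*} [Field k] [AddCommGroup W] [Module k W]

/-- Polynomial functions on `End(W)`. -/
abbrev EndPoly (k W : Type*) [Field k] [AddCommGroup W] [Module k W] :=
  SymmetricAlgebra k (Module.Dual k (Module.End k W))

/-- The polynomial function `v ↦ p(u v)`. -/
noncomputable def leftTranslate (u : Module.End k W) : EndPoly k W →ₐ[k] EndPoly k W :=
  SymmetricAlgebra.lift (ι k _ ∘ₗ (LinearMap.mulLeft k u).dualMap)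

/-- The polynomial function `v ↦ p(v u)`. -/
noncomputable def rightTranslate (u : Module.End k W) : EndPoly k W →ₐ[k] EndPoly k W :=
  SymmetricAlgebra.lift (ι k _ ∘ₗ (LinearMap.mulRight k u).dualMap)

/-- The left invariant derivation attached to `z ∈ End(W)`. -/
noncomputable def leftInvDerivation (z : Module.End k W) :
    Derivation k (EndPoly k W) (EndPoly k W) :=
  derivationOfLinear (ι k _ ∘ₗ (LinearMap.mulRight k z).dualMap)

/-- The right invariant derivation attached to `z ∈ End(W)`. -/
noncomputable def rightInvDerivation (z : Module.End k W) :
    Derivation k (EndPoly k W) (EndPoly k W) :=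
  derivationOfLinear (ι k _ ∘ₗ (LinearMap.mulLeft k z).dualMap)

@[simp]
theorem evalEnd_ι (u : Module.End k W) (φ : Module.Dual k (Module.End k W)) :
    evalEnd u (ι k _ φ) = φ u := by
  simp [evalEnd]

@[simp]
theorem directionalDerivative_ι (z : Module.End k W) (φ : Module.Dual k (Module.End k W)) :
    directionalDerivative z (ι k _ φ) = algebraMap k _ (φ z) := by
  simp [directionalDerivative]

theorem evalEnd_leftTranslate (u v : Module.End k W) (p : EndPoly k W) :
    evalEnd v (leftTranslate u p) = evalEnd (u * v) p := by
  have : (evalEnd v).comp (leftTranslate u) = evalEnd (u * v) := by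
    apply SymmetricAlgebra.algHom_ext
    ext φ
    simp [leftTranslate]
  exact DFunLike.congr_fun this p

theorem evalEnd_rightTranslate (u v : Module.End k W) (p : EndPoly k W) :
    evalEnd v (rightTranslate u p) = evalEnd (v * u) p := by
  have : (evalEnd v).comp (rightTranslate u) = evalEnd (v * u) := by
    apply SymmetricAlgebra.algHom_ext
    ext φ
    simp [rightTranslate]
  exact DFunLike.congr_fun this p

theorem evalEnd_leftInvDerivation (u z : Module.End k W) (p : EndPoly k W) :
    evalEnd u (leftInvDerivation z p) =
      evalEnd 1 (directionalDerivative z (leftTranslate u p)) := by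
  refine leibniz_ext (evalEnd u) ((evalEnd u).toLinearMap ∘ₗ (leftInvDerivation z).toLinearMap)
    ((evalEnd 1).toLinearMap ∘ₗ (directionalDerivative z).toLinearMap ∘ₗ
      (leftTranslate u).toLinearMap) ?_ ?_ ?_ p
  · intro f g
    simp [Derivation.leibniz]
  · intro f g
    simp [Derivation.leibniz, evalEnd_leftTranslate]
  · intro φ
    simp [leftInvDerivation, leftTranslate]

theorem evalEnd_rightInvDerivation (u z : Module.End k W) (p : EndPoly k W) :
    evalEnd u (rightInvDerivation z p) =
      evalEnd 1 (directionalDerivative z (rightTranslate u p)) := by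
  refine leibniz_ext (evalEnd u) ((evalEnd u).toLinearMap ∘ₗ (rightInvDerivation z).toLinearMap)
    ((evalEnd 1).toLinearMap ∘ₗ (directionalDerivative z).toLinearMap ∘ₗ
      (rightTranslate u).toLinearMap) ?_ ?_ ?_ p
  · intro f g
    simp [Derivation.leibniz]
  · intro f g
    simp [Derivation.leibniz, evalEnd_rightTranslate]
  · intro φ
    simp [rightInvDerivation, rightTranslate]

/-- The ideal of polynomial functions vanishing on a subgroup of `GL(W)`. -/
noncomputable def groupIdeal (H : Subgroup (LinearMap.GeneralLinearGroup k W)) :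
    Ideal (EndPoly k W) where
  carrier := {p | ∀ h ∈ H, evalEnd (h : Module.End k W) p = 0}
  add_mem' hp hq h hh := by rw [map_add, hp h hh, hq h hh, add_zero]
  zero_mem' _ _ := map_zero _
  smul_mem' c p hp h hh := by rw [smul_eq_mul, map_mul, hp h hh, mul_zero]

theorem mem_lieOfGroup {H : Subgroup (LinearMap.GeneralLinearGroup k W)} {z : Module.End k W} :
    z ∈ lieOfGroup H ↔ ∀ p ∈ groupIdeal H, evalEnd 1 (directionalDerivative z p) = 0 := Iff.rfl

theorem leftTranslate_mem {H : Subgroup (LinearMap.GeneralLinearGroup k W)} {p : EndPoly k W}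
    (hp : p ∈ groupIdeal H) {h : LinearMap.GeneralLinearGroup k W} (hh : h ∈ H) :
    leftTranslate (h : Module.End k W) p ∈ groupIdeal H := by
  intro g hg
  rw [evalEnd_leftTranslate, ← Units.val_mul]
  exact hp _ (H.mul_mem hh hg)

theorem rightTranslate_mem {H : Subgroup (LinearMap.GeneralLinearGroup k W)} {p : EndPoly k W}
    (hp : p ∈ groupIdeal H) {h : LinearMap.GeneralLinearGroup k W} (hh : h ∈ H) :
    rightTranslate (h : Module.End k W) p ∈ groupIdeal H := by
  intro g hg
  rw [evalEnd_rightTranslate, ← Units.val_mul]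
  exact hp _ (H.mul_mem hg hh)

/-- Tangency at `1` spreads over the group by translation: the value of the derivation at `h` is the
derivative at `1` of the translated function, which again vanishes on `H`. -/
theorem leftInvDerivation_mem {H : Subgroup (LinearMap.GeneralLinearGroup k W)}
    {z : Module.End k W} (hz : z ∈ lieOfGroup H) {p : EndPoly k W} (hp : p ∈ groupIdeal H) :
    leftInvDerivation z p ∈ groupIdeal H := by
  intro h hh
  rw [evalEnd_leftInvDerivation]
  exact hz _ (leftTranslate_mem hp hh)

theorem rightInvDerivation_mem {H : Subgroup (LinearMap.GeneralLinearGroup k W)}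
    {z : Module.End k W} (hz : z ∈ lieOfGroup H) {p : EndPoly k W} (hp : p ∈ groupIdeal H) :
    rightInvDerivation z p ∈ groupIdeal H := by
  intro h hh
  rw [evalEnd_rightInvDerivation]
  exact hz _ (rightTranslate_mem hp hh)

variable (k W) in
/-- The determinant, as a polynomial function on `End(W)`. -/
theorem exists_det_poly [FiniteDimensional k W] :
    ∃ δ : EndPoly k W, ∀ u, evalEnd u δ = LinearMap.det u := by
  let b := Module.finBasis k W
  refine ⟨Matrix.det (Matrix.of fun i j => ι k _
    (b.coord i ∘ₗ LinearMap.applyₗ (b j) : Module.Dual k (Module.End k W))), fun u => ?_⟩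
  rw [AlgHom.map_det, ← LinearMap.det_toMatrix b]
  congr 1
  ext i j
  simp [LinearMap.toMatrix_apply]

/-- In characteristic zero, the Lie algebra of an intersection of algebraic groups contains the
intersection of their Lie algebras. -/
theorem mem_lieOfGroup_sInf [IsAlgClosed k] [CharZero k] [FiniteDimensional k W]
    {𝓗 : Set (Subgroup (LinearMap.GeneralLinearGroup k W))} (hcl : ∀ H ∈ 𝓗, IsZariskiClosed H)
    {z : Module.End k W} (hz : ∀ H ∈ 𝓗, z ∈ lieOfGroup H) : z ∈ lieOfGroup (sInf 𝓗) := by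
  obtain ⟨δ, hδ⟩ := exists_det_poly k W
  let Q : Ideal (EndPoly k W) := sSup (groupIdeal '' 𝓗)
  have hQst : IsStable {leftInvDerivation z} Q := by
    apply IsStable.sSup
    rintro _ ⟨H, hH, rfl⟩ D rfl p hp
    exact leftInvDerivation_mem (hz H hH) hp
  have hQ1 : Q ≤ RingHom.ker (evalEnd (1 : Module.End k W)) := by
    apply sSup_le
    rintro _ ⟨H, hH, rfl⟩ p hp
    exact hp 1 H.one_mem
  have hrad : Q.radical ≤ RingHom.ker (evalEnd (1 : Module.End k W)) := by
    have : (RingHom.ker (evalEnd (1 : Module.End k W))).IsPrime := RingHom.ker_isPrime _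
    exact this.radical_le_iff.2 hQ1
  rw [mem_lieOfGroup]
  intro p hp
  -- The Nullstellensatz sees all zeros of `Q` in `End(W)`. The invertible ones lie in the
  -- intersection, where `p` vanishes; the factor `det` takes care of the others and equals `1` at
  -- the identity.
  have hpδ : p * δ ∈ Q.radical := by
    apply mem_radical_of_forall_evalAt
    intro ξ hξ
    obtain ⟨u, rfl⟩ := (Module.evalEquiv k (Module.End k W)).surjective ξ
    change evalEnd u (p * δ) = 0
    rw [map_mul, hδ]
    by_cases hu : LinearMap.det u = 0
    · rw [hu, mul_zero]
    · have hunit : IsUnit u := by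
        rw [LinearMap.isUnit_iff_isUnit_det]
        exact isUnit_iff_ne_zero.2 hu
      obtain ⟨g, rfl⟩ := hunit
      have hg : g ∈ sInf 𝓗 := by
        rw [Subgroup.mem_sInf]
        intro H hH
        obtain ⟨P, hP⟩ := hcl H hH
        rw [hP]
        intro q hq
        refine hξ q ((le_sSup ⟨H, hH, rfl⟩ : groupIdeal H ≤ Q) ?_)
        intro h hh
        exact (hP h).1 hh q hq
      rw [hp g hg, zero_mul]
  have h1 : evalEnd 1 (leftInvDerivation z (p * δ)) = 0 :=
    hrad (hQst.radical _ rfl _ hpδ)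
  have h2 : evalEnd (1 : Module.End k W) p = 0 := by
    have := hp 1 (Subgroup.one_mem _)
    simpa using this
  have h3 : evalEnd 1 (leftInvDerivation z p) = evalEnd 1 (directionalDerivative z p) := by
    rw [evalEnd_leftInvDerivation]
    congr 2
    have : leftTranslate (1 : Module.End k W) = AlgHom.id k _ := by
      apply SymmetricAlgebra.algHom_ext
      apply LinearMap.ext
      intro φ
      simp [leftTranslate]
    rw [this]
    rfl
  rw [Derivation.leibniz, map_add, smul_eq_mul, smul_eq_mul, map_mul, map_mul, h2, zero_mul,
    zero_add, hδ, map_one, one_mul, h3] at h1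
  exact h1

end Groups

end CoadjointSlice

namespace CoadjointSlice

open SymmetricAlgebra

/-! ## Constant vector fields on `M*` -/

section Constant

variable {k M : Type*} [Field k] [AddCommGroup M] [Module k M]

/-- The derivative of polynomial functions on `M*` in the constant direction `v ∈ M*`. -/
noncomputable def partialDerivative (v : Module.Dual k M) :
    Derivation k (SymmetricAlgebra k M) (SymmetricAlgebra k M) :=
  derivationOfLinear (Algebra.linearMap k _ ∘ₗ v)

@[simp]
theorem partialDerivative_ι (v : Module.Dual k M) (m : M) :
    partialDerivative v (ι k M m) = algebraMap k _ (v m) := by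
  simp [partialDerivative]

theorem partialDerivative_add (v w : Module.Dual k M) :
    partialDerivative (v + w) = partialDerivative v + partialDerivative w :=
  derivation_ext fun m => by simp

/-- The restriction of a polynomial function to the line through `s` in the direction `v`. -/
noncomputable def restrictLine (s v : Module.Dual k M) :
    SymmetricAlgebra k M →ₐ[k] Polynomial k :=
  SymmetricAlgebra.lift (Algebra.linearMap k (Polynomial k) ∘ₗ s +
    LinearMap.mulLeft k Polynomial.X ∘ₗ Algebra.linearMap k (Polynomial k) ∘ₗ v)

theorem eval_restrictLine (s v : Module.Dual k M) (t : k) (f : SymmetricAlgebra k M) :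
    (restrictLine s v f).eval t = evalAt (s + t • v) f := by
  have : (Polynomial.aeval t).comp (restrictLine s v) = evalAt (s + t • v) := by
    apply SymmetricAlgebra.algHom_ext
    ext m
    simp [restrictLine]
    ring
  rw [← this]
  simp

theorem derivative_restrictLine (s v : Module.Dual k M) (f : SymmetricAlgebra k M) :
    Polynomial.derivative (restrictLine s v f) = restrictLine s v (partialDerivative v f) := by
  refine map_derivation_eq (restrictLine s v) (partialDerivative v) Polynomial.derivative' ?_ f
  intro m
  simp [restrictLine]

theorem iterate_derivative_restrictLine (s v : Module.Dual k M) (n : ℕ)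
    (f : SymmetricAlgebra k M) :
    Polynomial.derivative^[n] (restrictLine s v f) =
      restrictLine s v ((partialDerivative v)^[n] f) := by
  induction n generalizing f with
  | zero => rfl
  | succ n ih => rw [Function.iterate_succ_apply, derivative_restrictLine, ih,
      Function.iterate_succ_apply]

/-- The directional derivative of a function which vanishes along a line. -/
theorem evalAt_partialDerivative_eq_zero [Infinite k] {s v : Module.Dual k M}
    {f : SymmetricAlgebra k M} (h : ∀ t : k, evalAt (s + t • v) f = 0) :
    evalAt s (partialDerivative v f) = 0 := by
  have h0 : restrictLine s v f = 0 := by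
    apply Polynomial.funext
    intro t
    rw [eval_restrictLine, h, Polynomial.eval_zero]
  have h1 := derivative_restrictLine s v f
  rw [h0, Polynomial.derivative_zero] at h1
  have h2 := eval_restrictLine s v 0 (partialDerivative v f)
  rw [← h1, zero_smul, add_zero, Polynomial.eval_zero] at h2
  exact h2.symm

/-- In characteristic zero, a polynomial function all of whose iterated directional derivatives
vanish at a point is zero. -/
theorem eq_zero_of_iterate_partialDerivative [CharZero k] [FiniteDimensional k M]
    (s : Module.Dual k M) {f : SymmetricAlgebra k M}
    (h : ∀ v : Module.Dual k M, ∀ n, evalAt s ((partialDerivative v)^[n] f) = 0) : f = 0 := by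
  apply eq_zero_of_forall_evalAt
  intro ξ
  -- The `n`-th derivative at `0` is `n!` times the `n`-th coefficient, and `n! ≠ 0` in `k`.
  have h0 : restrictLine s (ξ - s) f = 0 := by
    ext n
    have h1 := iterate_derivative_restrictLine s (ξ - s) n f
    have h2 := congrArg (Polynomial.eval 0) h1
    rw [eval_restrictLine, zero_smul, add_zero, h, ← Polynomial.coeff_zero_eq_eval_zero,
      Polynomial.coeff_iterate_derivative, zero_add, nsmul_eq_mul, mul_eq_zero] at h2
    rw [Polynomial.coeff_zero]
    refine h2.resolve_left ?_
    rw [Nat.descFactorial_self]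
    exact_mod_cast Nat.factorial_ne_zero n
  have h1 := eval_restrictLine s (ξ - s) 1 f
  rw [h0, Polynomial.eval_zero, one_smul, add_sub_cancel] at h1
  exact h1.symm

end Constant

/-! ## The adjoint group and its Lie algebra -/

section Adjoint

variable {k 𝔞 : Type*} [Field k] [LieRing 𝔞] [LieAlgebra k 𝔞]

@[simp]
theorem symAd_ι (x y : 𝔞) : symAd x (ι k 𝔞 y) = ι k 𝔞 ⁅x, y⁆ := by
  simp [symAd]

@[simp]
theorem infinitesimalAction_apply (ξ : Module.Dual k 𝔞) (x y : 𝔞) :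
    infinitesimalAction ξ x y = - ξ ⁅x, y⁆ := by
  simp [infinitesimalAction]

/-- The value of `symAd x f` at `ξ` is minus the derivative of `f` at `ξ` along `x·ξ`. -/
theorem evalAt_symAd (ξ : Module.Dual k 𝔞) (x : 𝔞) (f : SymmetricAlgebra k 𝔞) :
    evalAt ξ (symAd x f) = - evalAt ξ (partialDerivative (infinitesimalAction ξ x) f) := by
  refine leibniz_ext (evalAt ξ) ((evalAt ξ).toLinearMap ∘ₗ (symAd x).toLinearMap)
    (-((evalAt ξ).toLinearMap ∘ₗ
      (partialDerivative (infinitesimalAction ξ x)).toLinearMap)) ?_ ?_ ?_ f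
  · intro f g
    simp [Derivation.leibniz]
  · intro f g
    simp [Derivation.leibniz]
    ring
  · intro m
    simp

/-- The commutator of a constant vector field and an adjoint one. -/
theorem symAd_partialDerivative (v : Module.Dual k 𝔞) (x : 𝔞) (f : SymmetricAlgebra k 𝔞) :
    symAd x (partialDerivative v f) =
      partialDerivative v (symAd x f) + partialDerivative (infinitesimalAction v x) f := by
  have : ⁅symAd (k := k) x, partialDerivative v⁆ =
      partialDerivative (infinitesimalAction v x) := by
    apply derivation_ext
    intro m
    simp [Derivation.commutator_apply]
  rw [← this, Derivation.commutator_apply]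
  ring

/-- For `f ∈ S(𝔞)` and `ξ ∈ 𝔞*`, the polynomial function `u ↦ f(ξ ∘ u)` on `End(𝔞)`. -/
noncomputable def orbitFunction (ξ : Module.Dual k 𝔞) :
    SymmetricAlgebra k 𝔞 →ₐ[k] EndPoly k 𝔞 :=
  SymmetricAlgebra.lift (ι k _ ∘ₗ
    (LinearMap.compRight k ξ ∘ₗ LinearMap.applyₗ : 𝔞 →ₗ[k] Module.Dual k (Module.End k 𝔞)))

theorem evalEnd_orbitFunction (ξ : Module.Dual k 𝔞) (u : Module.End k 𝔞)
    (f : SymmetricAlgebra k 𝔞) : evalEnd u (orbitFunction ξ f) = evalAt (ξ ∘ₗ u) f := by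
  have : (evalEnd u).comp (orbitFunction ξ) = evalAt (ξ ∘ₗ u) := by
    apply SymmetricAlgebra.algHom_ext
    ext m
    simp [orbitFunction]
  exact DFunLike.congr_fun this f

theorem evalEnd_directionalDerivative_orbitFunction (ξ : Module.Dual k 𝔞) (x : 𝔞)
    (f : SymmetricAlgebra k 𝔞) :
    evalEnd 1 (directionalDerivative (LieAlgebra.ad k 𝔞 x) (orbitFunction ξ f)) =
      evalAt ξ (symAd x f) := by
  refine leibniz_ext (evalAt ξ) ((evalEnd 1).toLinearMap ∘ₗ
    (directionalDerivative (LieAlgebra.ad k 𝔞 x)).toLinearMap ∘ₗ (orbitFunction ξ).toLinearMap)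
    ((evalAt ξ).toLinearMap ∘ₗ (symAd x).toLinearMap) ?_ ?_ ?_ f
  · intro f g
    have : ξ ∘ₗ (1 : Module.End k 𝔞) = ξ := LinearMap.comp_id _
    simp [Derivation.leibniz, evalEnd_orbitFunction, this]
  · intro f g
    simp [Derivation.leibniz]
  · intro m
    simp [orbitFunction]

theorem evalAt_symAction (a : LinearMap.GeneralLinearGroup k 𝔞) (ξ : Module.Dual k 𝔞)
    (f : SymmetricAlgebra k 𝔞) :
    evalAt ξ (symAction a f) = evalAt (ξ ∘ₗ (a : 𝔞 →ₗ[k] 𝔞)) f := by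
  have : (evalAt ξ).comp (symAction a) = evalAt (ξ ∘ₗ (a : 𝔞 →ₗ[k] 𝔞)) := by
    apply SymmetricAlgebra.algHom_ext
    ext m
    simp [symAction]
  exact DFunLike.congr_fun this f

theorem coadjoint_inv (a : LinearMap.GeneralLinearGroup k 𝔞) (ξ : Module.Dual k 𝔞) :
    coadjoint a⁻¹ ξ = ξ ∘ₗ (a : 𝔞 →ₗ[k] 𝔞) := by
  simp [coadjoint]

theorem coadjoint_one (ξ : Module.Dual k 𝔞) : coadjoint 1 ξ = ξ := by
  ext; simp [coadjoint]

theorem coadjoint_mul (a b : LinearMap.GeneralLinearGroup k 𝔞) (ξ : Module.Dual k 𝔞) :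
    coadjoint (a * b) ξ = coadjoint a (coadjoint b ξ) := by
  ext; simp [coadjoint]

/-- Invariants are constant on orbits. -/
theorem evalAt_coadjoint {f : SymmetricAlgebra k 𝔞} (hf : f ∈ invariants k 𝔞)
    {a : LinearMap.GeneralLinearGroup k 𝔞} (ha : a ∈ adjointGroup k 𝔞) (ξ : Module.Dual k 𝔞) :
    evalAt (coadjoint a ξ) f = evalAt ξ f := by
  have h1 := evalAt_symAction a⁻¹ ξ f
  rw [hf _ (inv_mem ha)] at h1
  exact h1.symm

theorem mem_coadjointOrbit_self (ξ : Module.Dual k 𝔞) : ξ ∈ coadjointOrbit ξ :=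
  ⟨1, Subgroup.one_mem _, (coadjoint_one ξ).symm⟩

theorem subset_saturation (T : Set (Module.Dual k 𝔞)) : T ⊆ saturation T :=
  fun ξ hξ => ⟨ξ, hξ, mem_coadjointOrbit_self ξ⟩

variable [IsAlgClosed k] [CharZero k] [FiniteDimensional k 𝔞]

theorem ad_mem_lieOfGroup_adjointGroup (x : 𝔞) :
    (LieAlgebra.ad k 𝔞 x : Module.End k 𝔞) ∈ lieOfGroup (adjointGroup k 𝔞) :=
  mem_lieOfGroup_sInf (fun _ hH => hH.1) (fun _ hH => hH.2 x)

/-- A function vanishing on an orbit of the adjoint group has vanishing derivatives along it. -/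
theorem evalAt_symAd_eq_zero {ξ : Module.Dual k 𝔞} {f : SymmetricAlgebra k 𝔞}
    (hf : ∀ ζ ∈ coadjointOrbit ξ, evalAt ζ f = 0) (x : 𝔞) : evalAt ξ (symAd x f) = 0 := by
  rw [← evalEnd_directionalDerivative_orbitFunction]
  refine ad_mem_lieOfGroup_adjointGroup x _ fun a ha => ?_
  rw [evalEnd_orbitFunction, ← coadjoint_inv]
  exact hf _ ⟨a⁻¹, inv_mem ha, rfl⟩

/-- Invariants of the adjoint group are annihilated by `𝔞`. -/
theorem symAd_eq_zero {f : SymmetricAlgebra k 𝔞} (hf : f ∈ invariants k 𝔞) (x : 𝔞) :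
    symAd x f = 0 := by
  apply eq_zero_of_forall_evalAt
  intro ξ
  -- The function `f - f(ξ)` vanishes on the orbit of `ξ`, and the constant is killed by the
  -- derivation.
  have := evalAt_symAd_eq_zero (ξ := ξ) (f := f - algebraMap k _ (evalAt ξ f)) ?_ x
  · simpa using this
  · rintro _ ⟨a, ha, rfl⟩
    rw [map_sub, evalAt_coadjoint hf ha, AlgHom.commutes]
    exact sub_self _

/-- The functions vanishing on a union of orbits are stable under `𝔞`. -/
theorem evalAt_symAd_saturation {T : Set (Module.Dual k 𝔞)} {f : SymmetricAlgebra k 𝔞}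
    (hf : ∀ ζ ∈ saturation T, evalAt ζ f = 0) (x : 𝔞) :
    ∀ ζ ∈ saturation T, evalAt ζ (symAd x f) = 0 := by
  rintro _ ⟨ξ, hξ, a, ha, rfl⟩
  apply evalAt_symAd_eq_zero
  rintro _ ⟨b, hb, rfl⟩
  exact hf _ ⟨ξ, hξ, b * a, mul_mem hb ha, (coadjoint_mul b a ξ).symm⟩

end Adjoint

/-! ## Separation of orbits and transversality -/

section Separation

variable {k 𝔞 : Type*} [Field k] [LieRing 𝔞] [LieAlgebra k 𝔞]

theorem add_mem_linearSubvariety {η : Module.Dual k 𝔞} {V : Submodule k (Module.Dual k 𝔞)}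
    {s v : Module.Dual k 𝔞} (hs : s ∈ linearSubvariety η V) (hv : v ∈ V) :
    s + v ∈ linearSubvariety η V := by
  obtain ⟨w, hw, rfl⟩ := hs
  exact ⟨w + v, V.add_mem hw hv, add_assoc _ _ _⟩

/-- Every polynomial function agrees on a Weierstrass section with an invariant. -/
theorem IsWeierstrassSection.exists_invariant {η : Module.Dual k 𝔞}
    {V : Submodule k (Module.Dual k 𝔞)} (hφ : IsWeierstrassSection η V)
    (p : SymmetricAlgebra k 𝔞) :
    ∃ f ∈ invariants k 𝔞, ∀ s ∈ linearSubvariety η V, evalAt s f = evalAt s p := by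
  obtain ⟨f, hf⟩ := hφ.2 ⟨restriction _ p, p, rfl⟩
  refine ⟨f, f.2, fun s hs => ?_⟩
  have := congrFun (congrArg Subtype.val hf) ⟨s, hs⟩
  exact this

/-- An invariant vanishing on a Weierstrass section is zero. -/
theorem IsWeierstrassSection.eq_zero {η : Module.Dual k 𝔞}
    {V : Submodule k (Module.Dual k 𝔞)} (hφ : IsWeierstrassSection η V)
    {f : SymmetricAlgebra k 𝔞} (hf : f ∈ invariants k 𝔞)
    (h : ∀ s ∈ linearSubvariety η V, evalAt s f = 0) : f = 0 := by
  have : (⟨f, hf⟩ : invariants k 𝔞) = 0 := by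
    apply hφ.1
    rw [map_zero]
    apply Subtype.ext
    funext s
    exact h s s.2
  exact congrArg Subtype.val this

/-- For every `m ∈ 𝔞` some invariant agrees with `m` on the section, and it takes one value on the
orbit. Two common points therefore agree on every `m`. -/
theorem IsWeierstrassSection.subsingleton_inter {η : Module.Dual k 𝔞}
    {V : Submodule k (Module.Dual k 𝔞)} (hφ : IsWeierstrassSection η V) (ξ : Module.Dual k 𝔞) :
    (coadjointOrbit ξ ∩ linearSubvariety η V).Subsingleton := by
  rintro s ⟨⟨a, ha, hs⟩, hsV⟩ t ⟨⟨b, hb, ht⟩, htV⟩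
  ext m
  obtain ⟨f, hf, hfm⟩ := hφ.exists_invariant (ι k 𝔞 m)
  rw [← evalAt_ι s, ← evalAt_ι t, ← hfm s hsV, ← hfm t htV, hs, ht, evalAt_coadjoint hf ha,
    evalAt_coadjoint hf hb]

/-- Let `v` be tangent both to the orbit and to the section, and let `f` be an invariant equal to
`m` on the section. Then `∂_v f` vanishes at `s` by invariance, while `∂_v f = ∂_v m = v(m)` there
because `f - m` vanishes along `s + k v`. -/
theorem IsWeierstrassSection.isTransversalAt [IsAlgClosed k] [CharZero k] [FiniteDimensional k 𝔞]
    {η : Module.Dual k 𝔞} {V : Submodule k (Module.Dual k 𝔞)} (hφ : IsWeierstrassSection η V)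
    {s : Module.Dual k 𝔞} (hs : s ∈ linearSubvariety η V) : IsTransversalAt V s := by
  rw [IsTransversalAt, Submodule.disjoint_def]
  rintro _ ⟨x, rfl⟩ hv
  set v := infinitesimalAction s x with hvdef
  ext m
  obtain ⟨f, hf, hfm⟩ := hφ.exists_invariant (ι k 𝔞 m)
  have h1 : evalAt s (partialDerivative v f) = 0 := by
    have := evalAt_symAd s x f
    rw [symAd_eq_zero hf, map_zero] at this
    exact neg_eq_zero.1 this.symm
  have h2 : evalAt s (partialDerivative v (f - ι k 𝔞 m)) = 0 := by
    apply evalAt_partialDerivative_eq_zero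
    intro t
    rw [map_sub, sub_eq_zero]
    exact hfm _ (add_mem_linearSubvariety hs (V.smul_mem t hv))
  rw [map_sub, map_sub, h1, partialDerivative_ι, AlgHom.commutes, zero_sub, neg_eq_zero] at h2
  simpa using h2

end Separation

end CoadjointSlice

namespace CoadjointSlice

open SymmetricAlgebra

/-! ## Semi-invariants -/

section Degree

variable {k M : Type*} [Field k] [AddCommGroup M] [Module k M]

instance : UniqueFactorizationMonoid (SymmetricAlgebra k M) :=
  (SymmetricAlgebra.equivMvPolynomial (Module.Basis.ofVectorSpace k M)).symm.toMulEquiv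
    |>.uniqueFactorizationMonoid inferInstance

variable (k M) in
/-- The algebra homomorphism `f ↦ ∑ tⁱ fᵢ`, where `fᵢ` are the homogeneous components of `f`. -/
noncomputable def gradingHom :
    SymmetricAlgebra k M →ₐ[k] Polynomial (SymmetricAlgebra k M) :=
  SymmetricAlgebra.lift (LinearMap.mulLeft k (Polynomial.X : Polynomial (SymmetricAlgebra k M)) ∘ₗ
    (Polynomial.CAlgHom (R := k) (A := SymmetricAlgebra k M)).toLinearMap ∘ₗ ι k M)

@[simp]
theorem gradingHom_ι (m : M) :
    gradingHom k M (ι k M m) = Polynomial.X * Polynomial.C (ι k M m) := by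
  simp [gradingHom]

theorem eval_one_gradingHom (f : SymmetricAlgebra k M) :
    (gradingHom k M f).eval 1 = f := by
  have : ((Polynomial.aeval (R := SymmetricAlgebra k M)
      (1 : SymmetricAlgebra k M)).restrictScalars k).comp (gradingHom k M) =
      AlgHom.id k _ := by
    apply SymmetricAlgebra.algHom_ext
    ext m
    simp
  have h := DFunLike.congr_fun this f
  simpa [Polynomial.aeval_def] using h

theorem eval_zero_gradingHom (f : SymmetricAlgebra k M) :
    (gradingHom k M f).eval 0 = algebraMap k _ (algebraMapInv f) := by
  have : ((Polynomial.aeval (R := SymmetricAlgebra k M)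
      (0 : SymmetricAlgebra k M)).restrictScalars k).comp (gradingHom k M) =
      (Algebra.ofId k _).comp algebraMapInv := by
    apply SymmetricAlgebra.algHom_ext
    ext m
    have : algebraMapInv (ι k M m) = 0 := algebraMapInv_ι m
    simp [Algebra.ofId_apply, this]
  have h := DFunLike.congr_fun this f
  simpa [Polynomial.aeval_def, Algebra.ofId_apply] using h

theorem gradingHom_ne_zero {f : SymmetricAlgebra k M} (hf : f ≠ 0) : gradingHom k M f ≠ 0 := by
  intro h
  apply hf
  rw [← eval_one_gradingHom f, h, Polynomial.eval_zero]

theorem eq_algebraMap_of_natDegree_gradingHom {f : SymmetricAlgebra k M}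
    (hf : (gradingHom k M f).natDegree = 0) : ∃ c : k, f = algebraMap k _ c := by
  refine ⟨algebraMapInv f, ?_⟩
  rw [← eval_zero_gradingHom]
  conv_lhs => rw [← eval_one_gradingHom f]
  rw [Polynomial.eq_C_of_natDegree_eq_zero hf, Polynomial.eval_C, Polynomial.eval_C]

/-- A derivation preserving the generators acts on homogeneous components. -/
theorem coeff_gradingHom_derivation (d : M →ₗ[k] M) (f : SymmetricAlgebra k M) (i : ℕ) :
    (gradingHom k M (derivationOfLinear (ι k M ∘ₗ d) f)).coeff i =
      derivationOfLinear (ι k M ∘ₗ d) ((gradingHom k M f).coeff i) := by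
  induction f using SymmetricAlgebra.induction generalizing i with
  | algebraMap r =>
    rw [Derivation.map_algebraMap, AlgHom.commutes, map_zero, Polynomial.coeff_zero,
      Polynomial.algebraMap_apply, Polynomial.coeff_C]
    split_ifs
    · rw [Derivation.map_algebraMap]
    · rw [map_zero]
  | ι x =>
    rw [derivationOfLinear_ι, LinearMap.comp_apply, gradingHom_ι, gradingHom_ι]
    rcases i with _ | i
    · simp
    · simp only [Polynomial.coeff_X_mul, Polynomial.coeff_C]
      split_ifs
      · simp
      · simp
  | mul a b ha hb =>
    rw [Derivation.leibniz, map_add, smul_eq_mul, smul_eq_mul, mul_comm b, map_mul, map_mul,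
      map_mul, Polynomial.coeff_add, Polynomial.coeff_mul, Polynomial.coeff_mul,
      Polynomial.coeff_mul, map_sum, ← Finset.sum_add_distrib]
    refine Finset.sum_congr rfl fun x _ => ?_
    rw [ha, hb, Derivation.leibniz, smul_eq_mul, smul_eq_mul]
    ring
  | add a b ha hb => simp [ha, hb]

/-- The derivation does not raise degrees and degrees add in a product, so the cofactor of `q` has
degree zero. -/
theorem exists_smul_of_dvd_derivation (d : M →ₗ[k] M) {q : SymmetricAlgebra k M} (hq : q ≠ 0)
    (h : q ∣ derivationOfLinear (ι k M ∘ₗ d) q) :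
    ∃ c : k, derivationOfLinear (ι k M ∘ₗ d) q = c • q := by
  obtain ⟨χ, hχ⟩ := h
  by_cases hχ0 : χ = 0
  · exact ⟨0, by rw [hχ, hχ0, mul_zero, zero_smul]⟩
  have hdeg : (gradingHom k M (derivationOfLinear (ι k M ∘ₗ d) q)).natDegree ≤
      (gradingHom k M q).natDegree := by
    rw [Polynomial.natDegree_le_iff_coeff_eq_zero]
    intro N hN
    rw [coeff_gradingHom_derivation, Polynomial.coeff_eq_zero_of_natDegree_lt hN, map_zero]
  rw [hχ, map_mul, Polynomial.natDegree_mul (gradingHom_ne_zero hq) (gradingHom_ne_zero hχ0)]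
    at hdeg
  obtain ⟨c, rfl⟩ := eq_algebraMap_of_natDegree_gradingHom (f := χ) (by omega)
  exact ⟨c, by rw [hχ, mul_comm, Algebra.smul_def]⟩

end Degree

/-! ### Rational functions annihilated by the Lie algebra. -/

section SemiInvariants

variable {k 𝔞 : Type*} [Field k] [LieRing 𝔞] [LieAlgebra k 𝔞]

/-- The form in which `Sy = Y` is applied: divisibility already forces scalar weights, so `q` is a
semi-invariant. -/
theorem mem_invariants_of_dvd
    (hSy : poissonSemicentre k 𝔞 = Subalgebra.toSubmodule (invariants k 𝔞))
    {q : SymmetricAlgebra k 𝔞} (hq : q ≠ 0) (h : ∀ x : 𝔞, q ∣ symAd x q) :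
    q ∈ invariants k 𝔞 := by
  choose χ hχ using fun x => exists_smul_of_dvd_derivation (LieAlgebra.ad k 𝔞 x : 𝔞 →ₗ[k] 𝔞) hq
    (h x)
  rw [← Subalgebra.mem_toSubmodule, ← hSy]
  exact Submodule.subset_span ⟨χ, hχ⟩

/-- A rational function annihilated by `𝔞` is a quotient of invariants. -/
theorem exists_invariants_of_ratio
    (hSy : poissonSemicentre k 𝔞 = Subalgebra.toSubmodule (invariants k 𝔞))
    {p q : SymmetricAlgebra k 𝔞} (hq : q ≠ 0) (h : ∀ x : 𝔞, q * symAd x p = p * symAd x q) :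
    ∃ y ∈ invariants k 𝔞, ∃ z ∈ invariants k 𝔞, z ≠ 0 ∧ p * z = q * y := by
  by_cases hp : p = 0
  · exact ⟨0, zero_mem _, 1, one_mem _, one_ne_zero, by rw [hp]; ring⟩
  obtain ⟨q', p', c, hrel, hcq, hcp⟩ := UniqueFactorizationMonoid.exists_reduced_factors q hq p
  have hc : c ≠ 0 := by rintro rfl; rw [zero_mul] at hcq; exact hq hcq.symm
  have hq' : q' ≠ 0 := by rintro rfl; rw [mul_zero] at hcq; exact hq hcq.symm
  have hp' : p' ≠ 0 := by rintro rfl; rw [mul_zero] at hcp; exact hp hcp.symm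
  -- The common factor cancels from the vanishing derivative of the quotient; coprimality then makes
  -- each of `p'`, `q'` divide its own derivatives.
  have key : ∀ x : 𝔞, q' * symAd x p' = p' * symAd x q' := by
    intro x
    have h1 := h x
    rw [← hcq, ← hcp, Derivation.leibniz, Derivation.leibniz] at h1
    simp only [smul_eq_mul] at h1
    apply mul_left_cancel₀ (mul_ne_zero hc hc)
    linear_combination h1
  refine ⟨p', mem_invariants_of_dvd hSy hp' fun x => ?_, q',
    mem_invariants_of_dvd hSy hq' fun x => ?_, hq', by rw [← hcq, ← hcp]; ring⟩
  · exact hrel.symm.dvd_of_dvd_mul_left ⟨_, key x⟩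
  · exact hrel.dvd_of_dvd_mul_left ⟨_, (key x).symm⟩

end SemiInvariants

end CoadjointSlice

namespace CoadjointSlice

open SymmetricAlgebra TensorProduct

/-! ## Extension of derivations -/

section Extension

variable {R P L : Type*} [CommRing R] [CommRing P] [Field L] [Algebra R P] [Algebra R L]
  [Algebra P L] [IsScalarTower R P L]

/-- For formally étale `L` over `P` the differentials of `L` are `L ⊗ Ω_P`, so the linear map on
`Ω_P` representing `d` extends by scalars. -/
theorem exists_derivation_extension_of_formallyEtale [Algebra.FormallyEtale P L]
    (d : Derivation R P L) : ∃ δ : Derivation R L L, ∀ p, δ (algebraMap P L p) = d p := by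
  let e := KaehlerDifferential.tensorKaehlerEquivOfFormallyEtale R P L
  let g : L ⊗[P] KaehlerDifferential R P →ₗ[L] L := d.liftKaehlerDifferential.liftBaseChange L
  refine ⟨(g ∘ₗ e.symm.toLinearMap).compDer (KaehlerDifferential.D R L), fun p => ?_⟩
  have := KaehlerDifferential.tensorKaehlerEquivOfFormallyEtale_symm_D_algebraMap R P L p
  change g (e.symm (KaehlerDifferential.D R L (algebraMap P L p))) = d p
  rw [this]
  simp [g]

/-- The extension passes through the fraction field of `P`: localization is formally étale, and so
is the algebraic extension above it, being separable in characteristic zero. -/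
theorem exists_derivation_extension [IsDomain P] [CharZero L] [FaithfulSMul P L]
    [Algebra.IsAlgebraic P L] (d : Derivation R P L) :
    ∃ δ : Derivation R L L, ∀ p, δ (algebraMap P L p) = d p := by
  let E := FractionRing P
  let : Algebra E L := FractionRing.liftAlgebra P L
  have : IsScalarTower P E L := FractionRing.isScalarTower_liftAlgebra P L
  have : Algebra.IsAlgebraic E L := 
    (IsFractionRing.comap_isAlgebraic_iff (A := P) (K := E) (C := L)).1 inferInstance
  have : CharZero E := (algebraMap E L).charZero
  have : Algebra.FormallyEtale P E := Algebra.FormallyEtale.of_isLocalization (nonZeroDivisors P)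
  have : Algebra.FormallyEtale E L := Algebra.FormallyEtale.of_isSeparable E L
  have : Algebra.FormallyEtale P L := Algebra.FormallyEtale.comp P E L
  exact exists_derivation_extension_of_formallyEtale d

end Extension

/-- In characteristic zero there are derivations dual to an algebraically independent family. -/
theorem AlgebraicIndependent.exists_dual_derivations {S L ι' : Type*} [CommRing S] [IsDomain S]
    [Field L] [CharZero L] [Algebra S L] [DecidableEq ι'] {b : ι' → L}
    (hb : AlgebraicIndependent S b) :
    ∃ δ : ι' → Derivation S L L, ∀ i j, δ i (b j) = if i = j then 1 else 0 := by
  classical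
  -- Over the polynomial ring on a transcendence basis containing the family, derivations are
  -- prescribed freely on the variables; `L` is algebraic over that ring.
  obtain ⟨t, hbt, ht⟩ := exists_isTranscendenceBasis_superset
    (R := S) (s := Set.range b) hb.to_subtype_range
  let P := MvPolynomial t S
  let : Algebra P L := (MvPolynomial.aeval (R := S) (fun x : t => (x : L))).toAlgebra
  have hal : ∀ p : P, algebraMap P L p = MvPolynomial.aeval (fun x : t => (x : L)) p :=
    fun _ => rfl
  have : IsScalarTower S P L := IsScalarTower.of_algebraMap_eq fun s => by
    rw [hal, MvPolynomial.algebraMap_eq, MvPolynomial.aeval_C]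
  have : FaithfulSMul P L := (faithfulSMul_iff_algebraMap_injective P L).2 ht.1
  have : Algebra.IsAlgebraic P L := by
    have hal' : Algebra.IsAlgebraic (Algebra.adjoin S (Set.range (Subtype.val : t → L))) L :=
      ht.isAlgebraic
    let f : P →+* Algebra.adjoin S (Set.range (Subtype.val : t → L)) :=
      ht.1.aevalEquiv.toAlgHom.toRingHom
    exact Algebra.IsAlgebraic.of_ringHom_of_comp_eq f (RingHom.id L)
      ht.1.aevalEquiv.surjective Function.injective_id
      (RingHom.ext fun p => ht.1.algebraMap_aevalEquiv p)
  have key : ∀ i, ∃ δ : Derivation S L L, ∀ p : P, δ (algebraMap P L p) =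
      MvPolynomial.mkDerivation S (fun x : t => if b i = x then (1 : L) else 0) p :=
    fun i => exists_derivation_extension _
  choose δ hδ using key
  refine ⟨δ, fun i j => ?_⟩
  have := hδ i (MvPolynomial.X ⟨b j, hbt ⟨j, rfl⟩⟩)
  rw [hal, MvPolynomial.aeval_X, MvPolynomial.mkDerivation_X] at this
  rw [this]
  simp only [hb.injective.eq_iff]

end CoadjointSlice

namespace CoadjointSlice

open SymmetricAlgebra TensorProduct

/-! ## Points of an algebraic group over extensions -/

/-- An element of `L ⊗ V` killed by the forms in `Φ` comes from the common kernel of `Φ`. -/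
theorem mem_span_tmul_of_forms {k L V : Type*} [Field k] [CommRing L] [Algebra k L]
    [AddCommGroup V] [Module k V] (Φ : Set (Module.Dual k V)) (t : L ⊗[k] V)
    (h : ∀ φ ∈ Φ, TensorProduct.rid k L (LinearMap.lTensor L φ t) = 0) :
    t ∈ Submodule.span k {x | ∃ (a : L) (v : V), (∀ φ ∈ Φ, φ v = 0) ∧ x = a ⊗ₜ v} := by
  classical
  -- Expanding `t` along a basis of `L` over `k`, a form kills `t` exactly when it kills every
  -- coefficient in `V`.
  let e := Module.Basis.ofVectorSpace k L
  obtain ⟨f, rfl⟩ := (TensorProduct.equivFinsuppOfBasisLeft (N := V) e).symm.surjective t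
  rw [TensorProduct.equivFinsuppOfBasisLeft_symm_apply]
  refine Submodule.sum_mem _ fun i _ => Submodule.subset_span ⟨_, _, fun φ hφ => ?_, rfl⟩
  have h1 := h φ hφ
  rw [TensorProduct.equivFinsuppOfBasisLeft_symm_apply] at h1
  simp only [Finsupp.sum, map_sum, LinearMap.lTensor_tmul, TensorProduct.rid_tmul] at h1
  by_cases hi : i ∈ f.support
  · exact linearIndependent_iff'.1 e.linearIndependent f.support (fun i => φ (f i)) h1 i hi
  · rw [Finsupp.notMem_support_iff.1 hi, map_zero]

/-! ### Matrices over a `k`-algebra as points of `End(kⁿ)`, and their logarithmic derivatives. -/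

section MatrixPoints

variable {k : Type*} [Field k] {n : Type*} [Fintype n] [DecidableEq n]

/-- The elementary endomorphisms of `kⁿ`. -/
noncomputable def elementary (k : Type*) [Field k] {n : Type*} [Fintype n] [DecidableEq n]
    (i j : n) : Module.End k (n → k) :=
  Matrix.toLin' (Matrix.single i j 1)

theorem sum_elementary (u : Module.End k (n → k)) :
    ∑ i, ∑ j, LinearMap.toMatrix' u i j • elementary k i j = u := by
  conv_rhs => rw [← Matrix.toLin'_toMatrix' u, Matrix.matrix_eq_sum_single (LinearMap.toMatrix' u)]
  rw [map_sum]
  refine Finset.sum_congr rfl fun i _ => ?_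
  rw [map_sum]
  refine Finset.sum_congr rfl fun j _ => ?_
  rw [elementary, ← map_smul, Matrix.smul_single, smul_eq_mul, mul_one]

theorem form_eq_sum (φ : Module.Dual k (Module.End k (n → k))) (u : Module.End k (n → k)) :
    φ u = ∑ i, ∑ j, φ (elementary k i j) * LinearMap.toMatrix' u i j := by
  conv_lhs => rw [← sum_elementary u]
  simp only [map_sum, map_smul, smul_eq_mul, mul_comm]

variable {B B' : Type*} [CommRing B] [Algebra k B] [CommRing B'] [Algebra k B']

/-- The value of polynomial functions on `End(kⁿ)` at a matrix with entries in a `k`-algebra. -/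
noncomputable def matrixPoint (U : Matrix n n B) : EndPoly k (n → k) →ₐ[k] B :=
  SymmetricAlgebra.lift (∑ i, ∑ j, LinearMap.toSpanSingleton k B (U i j) ∘ₗ
    Module.Dual.eval k _ (elementary k i j))

@[simp]
theorem matrixPoint_ι (U : Matrix n n B) (φ : Module.Dual k (Module.End k (n → k))) :
    matrixPoint U (ι k _ φ) = ∑ i, ∑ j, φ (elementary k i j) • U i j := by
  simp [matrixPoint]

theorem map_matrixPoint (f : B →ₐ[k] B') (U : Matrix n n B) (p : EndPoly k (n → k)) :
    f (matrixPoint U p) = matrixPoint (U.map f) p := by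
  have : f.comp (matrixPoint U) = matrixPoint (U.map f) := by
    apply SymmetricAlgebra.algHom_ext
    ext φ
    simp
  exact DFunLike.congr_fun this p

theorem matrixPoint_toMatrix (u : Module.End k (n → k)) (p : EndPoly k (n → k)) :
    matrixPoint ((LinearMap.toMatrix' u).map (algebraMap k B)) p =
      algebraMap k B (evalEnd u p) := by
  refine algHom_congr (ψ := (Algebra.ofId k B).comp (evalEnd u)) (fun φ => ?_) p
  rw [AlgHom.comp_apply, evalEnd_ι, form_eq_sum φ u, matrixPoint_ι]
  simp [Algebra.smul_def, Algebra.ofId_apply]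

theorem elementary_mul (i j : n) (u : Module.End k (n → k)) :
    elementary k i j * u = ∑ l, LinearMap.toMatrix' u j l • elementary k i l := by
  apply (LinearMap.toMatrix' (R := k)).injective
  rw [LinearMap.toMatrix'_mul, map_sum]
  simp only [map_smul, elementary, LinearMap.toMatrix'_toLin']
  ext a b
  rw [Matrix.sum_apply]
  by_cases h : a = i
  · subst h
    simp [Matrix.single_apply]
  · simp [h, Ne.symm h]

theorem matrixPoint_rightTranslate (U : Matrix n n B) (u : Module.End k (n → k))
    (p : EndPoly k (n → k)) :
    matrixPoint U (rightTranslate u p) =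
      matrixPoint (U * (LinearMap.toMatrix' u).map (algebraMap k B)) p := by
  refine algHom_congr (φ := (matrixPoint U).comp (rightTranslate u)) (fun φ => ?_) p
  have h1 : rightTranslate u (ι k _ φ) = ι k _ (φ ∘ₗ LinearMap.mulRight k u) := by
    rw [rightTranslate, lift_ι_apply]
    rfl
  rw [AlgHom.comp_apply, h1, matrixPoint_ι, matrixPoint_ι]
  simp only [LinearMap.comp_apply, LinearMap.mulRight_apply, elementary_mul, map_sum, map_smul,
    Matrix.mul_apply, Matrix.map_apply, Finset.sum_smul, Finset.smul_sum]
  refine Finset.sum_congr rfl fun i _ => ?_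
  rw [Finset.sum_comm]
  refine Finset.sum_congr rfl fun j _ => Finset.sum_congr rfl fun l _ => ?_
  simp only [smul_eq_mul, Algebra.smul_def (R := k) (A := B), map_mul]
  ring

/-- The differential at `1` of a polynomial function on `End(W)`. -/
noncomputable def tangentForm {W : Type*} [AddCommGroup W] [Module k W] (q : EndPoly k W) :
    Module.Dual k (Module.End k W) where
  toFun z := evalEnd 1 (directionalDerivative z q)
  map_add' z w := by
    have : directionalDerivative (z + w) = directionalDerivative z + directionalDerivative w :=
      derivation_ext fun φ => by simp
    simp [this]
  map_smul' c z := by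
    have : directionalDerivative (c • z) = c • directionalDerivative z :=
      derivation_ext fun φ => by
        rw [directionalDerivative_ι, Derivation.smul_apply, directionalDerivative_ι, map_smul,
          smul_eq_mul, map_mul, Algebra.smul_def]
    simp [this]

/-- The linear form on `End(kⁿ)` given by a matrix entry. -/
noncomputable def matrixEntry (i j : n) : Module.Dual k (Module.End k (n → k)) where
  toFun u := LinearMap.toMatrix' u i j
  map_add' u v := by rw [map_add, Matrix.add_apply]
  map_smul' c u := by rw [map_smul, Matrix.smul_apply, RingHom.id_apply]

theorem sum_matrixEntry_elementary {A : Type*} [AddCommMonoid A] [Module k A] (i j : n)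
    (U : n → n → A) :
    ∑ a, ∑ b, matrixEntry (k := k) i j (elementary k a b) • U a b = U i j := by
  have h : ∀ a b, matrixEntry (k := k) i j (elementary k a b) =
      if a = i then if b = j then 1 else 0 else 0 := by
    intro a b
    change LinearMap.toMatrix' (Matrix.toLin' (Matrix.single a b (1 : k))) i j = _
    rw [LinearMap.toMatrix'_toLin', Matrix.single_apply, ite_and]
  simp [h, ite_smul]

variable (k n) in
/-- The generic matrix. -/
noncomputable def genericMatrix : Matrix n n (EndPoly k (n → k)) :=
  Matrix.of fun i j => ι k _ (matrixEntry i j)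

theorem matrixPoint_genericMatrix (U : Matrix n n B) :
    (genericMatrix k n).map (matrixPoint U) = U := by
  ext i j
  rw [genericMatrix, Matrix.map_apply, Matrix.of_apply, matrixPoint_ι]
  exact sum_matrixEntry_elementary i j U

/-- First-order Taylor expansion at the identity: both sides are derivations along evaluation at `1`
and agree on linear forms. -/
theorem snd_matrixPoint (N : Matrix n n (DualNumber B))
    (hN : N.map TrivSqZeroExt.fst = 1) (q : EndPoly k (n → k)) :
    (matrixPoint N q).snd = ∑ i, ∑ j, tangentForm q (elementary k i j) • (N i j).snd := by
  have h1 : ∀ f : EndPoly k (n → k),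
      (matrixPoint N f).fst = algebraMap k B (evalEnd 1 f) := by
    intro f
    have := map_matrixPoint (TrivSqZeroExt.fstHom k B B) N f
    have h2 : N.map (TrivSqZeroExt.fstHom k B B) =
        (LinearMap.toMatrix' (1 : Module.End k (n → k))).map (algebraMap k B) := by
      rw [LinearMap.toMatrix'_one, Matrix.map_one _ (map_zero _) (map_one _)]
      exact hN
    rw [h2, matrixPoint_toMatrix] at this
    exact this
  refine leibniz_ext ((Algebra.ofId k B).comp (evalEnd 1))
    ((TrivSqZeroExt.sndHom B B).restrictScalars k ∘ₗ (matrixPoint N).toLinearMap)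
    (∑ i, ∑ j, LinearMap.toSpanSingleton k B (N i j).snd ∘ₗ (evalEnd 1).toLinearMap ∘ₗ
      (directionalDerivative (elementary k i j)).toLinearMap) ?_ ?_ ?_ q
    |>.trans ?_
  · intro f g
    simp [h1, Algebra.ofId_apply, TrivSqZeroExt.snd_mul, mul_comm]
  · intro f g
    simp only [LinearMap.coe_sum, Finset.sum_apply, LinearMap.comp_apply, AlgHom.toLinearMap_apply,
      Derivation.coeFn_coe, Derivation.leibniz, map_add,
      smul_eq_mul, map_mul, LinearMap.toSpanSingleton_apply, AlgHom.comp_apply,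
      Algebra.ofId_apply, Finset.mul_sum, ← Finset.sum_add_distrib]
    refine Finset.sum_congr rfl fun i _ => Finset.sum_congr rfl fun j _ => ?_
    simp only [Algebra.smul_def, map_mul]
    ring
  · intro φ
    simp
  · simp [tangentForm]

/-- The algebra homomorphism `a ↦ a + ε δ(a)`. -/
noncomputable def dualNumberHom (δ : Derivation k B B) : B →ₐ[k] DualNumber B :=
  AlgHom.ofLinearMap
    ((TrivSqZeroExt.inlAlgHom k B B).toLinearMap +
      (TrivSqZeroExt.inrHom B B).restrictScalars k ∘ₗ δ.toLinearMap)
    (by ext <;> simp)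
    (by
      intro x y
      ext
      · simp
      · simp [TrivSqZeroExt.snd_mul, mul_comm])

@[simp]
theorem fst_dualNumberHom (δ : Derivation k B B) (x : B) : (dualNumberHom δ x).fst = x := by
  simp [dualNumberHom]

@[simp]
theorem snd_dualNumberHom (δ : Derivation k B B) (x : B) : (dualNumberHom δ x).snd = δ x := by
  simp [dualNumberHom]

/-- The logarithmic derivative of a point of an algebraic group lies in its Lie algebra. -/
theorem tangentForm_logDerivative (G : Subgroup (LinearMap.GeneralLinearGroup k (n → k)))
    (δ : Derivation k B B) {H H' : Matrix n n B} (hH : H' * H = 1)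
    (hp : ∀ p ∈ groupIdeal G, matrixPoint H p = 0)
    (hp' : ∀ p ∈ groupIdeal G, matrixPoint H' p = 0) {q : EndPoly k (n → k)}
    (hq : q ∈ groupIdeal G) :
    ∑ i, ∑ j, tangentForm q (elementary k i j) • (H' * H.map δ) i j = 0 := by
  -- `Δ p` is the function `g ↦ p(H' g)` with coefficients in `B`. The map `T` evaluates it at `g =
  -- H + ε δ(H)`, so that the argument becomes `N = 1 + ε H' δ(H)`.
  let Δ : EndPoly k (n → k) →ₐ[k] B ⊗[k] EndPoly k (n → k) :=
    matrixPoint (H'.map (Algebra.TensorProduct.includeLeft (R := k) (S := k)) *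
      (genericMatrix k n).map Algebra.TensorProduct.includeRight)
  let T : B ⊗[k] EndPoly k (n → k) →ₐ[k] DualNumber B :=
    Algebra.TensorProduct.productMap (TrivSqZeroExt.inlAlgHom k B B)
      (matrixPoint (H.map (dualNumberHom δ)))
  let N : Matrix n n (DualNumber B) :=
    H'.map (TrivSqZeroExt.inlAlgHom k B B) * H.map (dualNumberHom δ)
  have hTΔ : T (Δ q) = matrixPoint N q := by
    rw [map_matrixPoint, Matrix.map_mul, Matrix.map_map, Matrix.map_map]
    have h1 : (⇑T ∘ ⇑(Algebra.TensorProduct.includeLeft (R := k) (S := k))) =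
        TrivSqZeroExt.inlAlgHom k B B := by
      funext b
      simp [T]
    have h2 : (⇑T ∘ ⇑(Algebra.TensorProduct.includeRight)) =
        matrixPoint (H.map (dualNumberHom δ)) := by
      funext b
      simp [T]
    rw [h1, h2, matrixPoint_genericMatrix]
  -- For `g ∈ G` the value `q(H' g)` is zero, because `H'` satisfies the equations of `G` and these
  -- are stable under right translation. Hence `Δ q` lies in `B ⊗ I(G)`.
  have hΔ : Δ q ∈ Submodule.span k {x | ∃ (a : B) (v : EndPoly k (n → k)),
      (∀ φ ∈ {φ | ∃ g ∈ G, φ = (evalEnd (g : Module.End k (n → k))).toLinearMap}, φ v = 0) ∧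
        x = a ⊗ₜ v} := by
    apply mem_span_tmul_of_forms
    rintro _ ⟨g, hg, rfl⟩
    let E : B ⊗[k] EndPoly k (n → k) →ₐ[k] B :=
      Algebra.TensorProduct.productMap (AlgHom.id k B)
        ((Algebra.ofId k B).comp (evalEnd (g : Module.End k (n → k))))
    have hE : ∀ t, TensorProduct.rid k B (LinearMap.lTensor B
        (evalEnd (g : Module.End k (n → k))).toLinearMap t) = E t := by
      intro t
      induction t with
      | zero => simp
      | tmul a p => simp [E, Algebra.smul_def, mul_comm, Algebra.ofId_apply]
      | add x y hx hy => rw [map_add, map_add, map_add, hx, hy]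
    rw [hE, map_matrixPoint, Matrix.map_mul, Matrix.map_map, Matrix.map_map]
    have h1 : (⇑E ∘ ⇑(Algebra.TensorProduct.includeLeft (R := k) (S := k))) = id := by
      funext b
      simp [E]
    have h2 : (⇑E ∘ ⇑(Algebra.TensorProduct.includeRight)) = matrixPoint
        ((LinearMap.toMatrix' (g : Module.End k (n → k))).map (algebraMap k B)) := by
      funext b
      simp [E, matrixPoint_toMatrix, Algebra.ofId_apply]
    rw [h1, h2, matrixPoint_genericMatrix, Matrix.map_id, ← matrixPoint_rightTranslate]
    exact hp' _ (rightTranslate_mem hq hg)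
  -- Applying `a ↦ a + ε δ(a)` to the equations satisfied by `H` shows that `H + ε δ(H)` satisfies
  -- them too.
  have hT0 : T (Δ q) = 0 := by
    generalize Δ q = t at hΔ
    induction hΔ using Submodule.span_induction with
    | mem x hx =>
      obtain ⟨a, v, hv, rfl⟩ := hx
      have hvG : v ∈ groupIdeal G := fun g hg => hv _ ⟨g, hg, rfl⟩
      rw [Algebra.TensorProduct.productMap_apply_tmul, ← map_matrixPoint, hp v hvG, map_zero,
        mul_zero]
    | zero => exact map_zero _
    | add x y _ _ hx hy => rw [map_add, hx, hy, add_zero]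
    | smul c x _ hx => rw [map_smul, hx, smul_zero]
  have hN1 : N.map TrivSqZeroExt.fst = 1 := by
    rw [← hH]
    ext i j
    simp [N, Matrix.mul_apply, TrivSqZeroExt.fst_sum]
  have hN2 : ∀ i j, (N i j).snd = (H' * H.map δ) i j := by
    intro i j
    simp [N, Matrix.mul_apply, TrivSqZeroExt.snd_sum, TrivSqZeroExt.snd_mul]
  have h3 := snd_matrixPoint N hN1 q
  rw [← hTΔ, hT0, TrivSqZeroExt.snd_zero] at h3
  simp only [hN2] at h3
  exact h3.symm

/-- A matrix over an extension killed by the linear forms defining a subspace of matrices is a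
linear combination of elements of this subspace. -/
theorem exists_combination_of_forms (Φ : Set (Module.Dual k (Module.End k (n → k))))
    (U : Matrix n n B) (hU : ∀ φ ∈ Φ, ∑ i, ∑ j, φ (elementary k i j) • U i j = 0)
    {κ : Type*} [Fintype κ] (z : κ → Module.End k (n → k))
    (hz : ∀ u, (∀ φ ∈ Φ, φ u = 0) → u ∈ Submodule.span k (Set.range z)) :
    ∃ c : κ → B, U = ∑ l, c l • (LinearMap.toMatrix' (z l)).map (algebraMap k B) := by
  let F : B ⊗[k] Module.End k (n → k) →ₗ[k] Matrix n n B :=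
    TensorProduct.lift (LinearMap.mk₂ k
      (fun a u => a • (LinearMap.toMatrix' u).map (algebraMap k B))
      (fun a b u => add_smul _ _ _) (fun c a u => smul_assoc _ _ _)
      (fun a u v => by
        ext i j
        simp [mul_add])
      (fun c a u => by
        ext i j
        rw [map_smul, Matrix.smul_apply, Matrix.smul_apply, Matrix.smul_apply, Matrix.map_apply,
          Matrix.map_apply, Matrix.smul_apply, smul_eq_mul, smul_eq_mul, smul_eq_mul, map_mul,
          Algebra.smul_def, mul_left_comm]))
  have hF : ∀ a u, F (a ⊗ₜ u) = a • (LinearMap.toMatrix' u).map (algebraMap k B) :=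
    fun a u => rfl
  -- The matrix `U` seen as a tensor; the defining forms kill it, so it is a combination of tensors
  -- `a ⊗ v` with `v` in the subspace.
  let t : B ⊗[k] Module.End k (n → k) := ∑ i, ∑ j, U i j ⊗ₜ elementary k i j
  have ht : F t = U := by
    ext a b
    simp only [t, map_sum, hF, elementary, LinearMap.toMatrix'_toLin', Matrix.sum_apply,
      Matrix.smul_apply, Matrix.map_apply]
    rw [Finset.sum_eq_single a, Finset.sum_eq_single b]
    · simp
    · intro c _ hc
      simp [hc]
    · simp
    · intro c _ hc
      simp [hc]
    · simp
  have hmem : t ∈ Submodule.span k {x | ∃ (a : B) (v : Module.End k (n → k)),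
      (∀ φ ∈ Φ, φ v = 0) ∧ x = a ⊗ₜ v} := by
    apply mem_span_tmul_of_forms
    intro φ hφ
    simpa [t] using hU φ hφ
  rw [← ht]
  generalize t = t' at hmem
  induction hmem using Submodule.span_induction with
  | mem x hx =>
    obtain ⟨a, v, hv, rfl⟩ := hx
    obtain ⟨d, rfl⟩ := (Submodule.mem_span_range_iff_exists_fun k).1 (hz v hv)
    refine ⟨fun l => d l • a, ?_⟩
    rw [TensorProduct.tmul_sum, map_sum]
    refine Finset.sum_congr rfl fun l _ => ?_
    rw [TensorProduct.tmul_smul, TensorProduct.smul_tmul', hF]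
  | zero => exact ⟨0, by simp⟩
  | add x y _ _ hx hy =>
    obtain ⟨c, hc⟩ := hx
    obtain ⟨d, hd⟩ := hy
    exact ⟨c + d, by rw [map_add, hc, hd]; simp [add_smul, Finset.sum_add_distrib]⟩
  | smul r x _ hx =>
    obtain ⟨c, hc⟩ := hx
    exact ⟨r • c, by rw [map_smul, hc]; simp [Finset.smul_sum, smul_assoc]⟩

end MatrixPoints

end CoadjointSlice

namespace CoadjointSlice

open SymmetricAlgebra TensorProduct

/-! ## A generic point of an algebraic group acting on the coadjoint representation -/

theorem map_derivation_mul {k R : Type*} [Field k] [CommRing R] [Algebra k R]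
    (D : Derivation k R R) {l m n : Type*} [Fintype m] (A : Matrix l m R) (B : Matrix m n R) :
    (A * B).map D = A.map D * B + A * B.map D := by
  ext i j
  simp only [Matrix.map_apply, Matrix.mul_apply, Matrix.add_apply, map_sum, Derivation.leibniz,
    smul_eq_mul, ← Finset.sum_add_distrib]
  exact Finset.sum_congr rfl fun x _ => by ring

theorem map_derivation_algebraMap {k R : Type*} [Field k] [CommRing R] [Algebra k R]
    (D : Derivation k R R) {m n : Type*} (A : Matrix m n k) :
    (A.map (algebraMap k R)).map D = 0 := by
  ext i j
  simp

theorem evalEnd_one_eq_zero {k W : Type*} [Field k] [AddCommGroup W] [Module k W]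
    {G : Subgroup (LinearMap.GeneralLinearGroup k W)} {p : EndPoly k W}
    (hp : p ∈ groupIdeal G) : evalEnd 1 p = 0 := by
  have := hp 1 G.one_mem
  simpa using this

section LeftTranslate

variable {k : Type*} [Field k] {n : Type*} [Fintype n] [DecidableEq n]
  {B : Type*} [CommRing B] [Algebra k B]

theorem mul_elementary (i j : n) (u : Module.End k (n → k)) :
    u * elementary k i j = ∑ l, LinearMap.toMatrix' u l i • elementary k l j := by
  apply (LinearMap.toMatrix' (R := k)).injective
  rw [LinearMap.toMatrix'_mul, map_sum]
  simp only [map_smul, elementary, LinearMap.toMatrix'_toLin']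
  ext a b
  rw [Matrix.sum_apply]
  by_cases h : b = j
  · subst h
    simp [Matrix.single_apply]
  · simp [h, Ne.symm h]

theorem matrixPoint_leftTranslate (U : Matrix n n B) (u : Module.End k (n → k))
    (p : EndPoly k (n → k)) :
    matrixPoint U (leftTranslate u p) =
      matrixPoint ((LinearMap.toMatrix' u).map (algebraMap k B) * U) p := by
  refine algHom_congr (φ := (matrixPoint U).comp (leftTranslate u)) (fun φ => ?_) p
  have h1 : leftTranslate u (ι k _ φ) = ι k _ (φ ∘ₗ LinearMap.mulLeft k u) := by
    rw [leftTranslate, lift_ι_apply]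
    rfl
  rw [AlgHom.comp_apply, h1, matrixPoint_ι, matrixPoint_ι]
  simp only [LinearMap.comp_apply, LinearMap.mulLeft_apply, mul_elementary, map_sum, map_smul,
    Matrix.mul_apply, Matrix.map_apply, Finset.sum_smul, Finset.smul_sum]
  rw [Finset.sum_comm]
  conv_rhs => rw [Finset.sum_comm]
  refine Finset.sum_congr rfl fun i _ => ?_
  rw [Finset.sum_comm]
  refine Finset.sum_congr rfl fun j _ => Finset.sum_congr rfl fun l _ => ?_
  simp only [smul_eq_mul, Algebra.smul_def (R := k) (A := B), map_mul]
  ring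

theorem matrixPoint_ι_mul_right (U : Matrix n n B) (u : Module.End k (n → k))
    (φ : Module.Dual k (Module.End k (n → k))) :
    matrixPoint (U * (LinearMap.toMatrix' u).map (algebraMap k B)) (ι k _ φ) =
      matrixPoint U (ι k _ (φ ∘ₗ LinearMap.mulRight k u)) := by
  rw [← matrixPoint_rightTranslate, rightTranslate, lift_ι_apply]
  rfl

theorem matrixPoint_ι_mul_left (U : Matrix n n B) (u : Module.End k (n → k))
    (φ : Module.Dual k (Module.End k (n → k))) :
    matrixPoint ((LinearMap.toMatrix' u).map (algebraMap k B) * U) (ι k _ φ) =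
      matrixPoint U (ι k _ (φ ∘ₗ LinearMap.mulLeft k u)) := by
  rw [← matrixPoint_leftTranslate, leftTranslate, lift_ι_apply]
  rfl

theorem derivation_matrixPoint_ι (D : Derivation k B B) (U : Matrix n n B)
    (φ : Module.Dual k (Module.End k (n → k))) :
    D (matrixPoint U (ι k _ φ)) = matrixPoint (U.map D) (ι k _ φ) := by
  simp

theorem matrixPoint_ι_add (U U' : Matrix n n B) (φ : Module.Dual k (Module.End k (n → k))) :
    matrixPoint (U + U') (ι k _ φ) = matrixPoint U (ι k _ φ) + matrixPoint U' (ι k _ φ) := by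
  simp [Finset.sum_add_distrib]

theorem matrixPoint_ι_neg (U : Matrix n n B) (φ : Module.Dual k (Module.End k (n → k))) :
    matrixPoint (-U) (ι k _ φ) = - matrixPoint U (ι k _ φ) := by
  simp

end LeftTranslate

/-! ### The formal model of pairs (point of the dual space, group element). -/

section Model

variable {k 𝔞 n : Type*} [Field k] [LieRing 𝔞] [LieAlgebra k 𝔞] [Fintype n]

variable (k 𝔞 n) in
/-- The polynomial ring in the coordinates of a point of `𝔞*` and in the entries of two
`n × n` matrices, to be thought of as a group element and its inverse. -/
abbrev GroupModel := SymmetricAlgebra k (𝔞 × Matrix n n k × Matrix n n k)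

/-- The coordinates of the generic point of `𝔞*`. -/
noncomputable def modelPoint : SymmetricAlgebra k 𝔞 →ₐ[k] GroupModel k 𝔞 n :=
  SymmetricAlgebra.lift (ι k _ ∘ₗ LinearMap.inl k 𝔞 (Matrix n n k × Matrix n n k))

variable (k 𝔞 n) in
/-- Specialization of the generic group element to `1`. -/
noncomputable def modelCounit : GroupModel k 𝔞 n →ₐ[k] SymmetricAlgebra k 𝔞 :=
  -- The matrix unit `E_ij` stands for the `(i, j)` entry, and its trace is that entry of the
  -- identity matrix.
  SymmetricAlgebra.lift ((ι k 𝔞).coprod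
    ((Algebra.linearMap k _ ∘ₗ Matrix.traceLinearMap n k k).coprod
      (Algebra.linearMap k _ ∘ₗ Matrix.traceLinearMap n k k)))

@[simp]
theorem modelCounit_modelPoint (f : SymmetricAlgebra k 𝔞) :
    modelCounit k 𝔞 n (modelPoint f) = f := by
  refine algHom_congr (φ := (modelCounit k 𝔞 n).comp modelPoint) (ψ := AlgHom.id k _)
    (fun m => ?_) f
  simp [modelCounit, modelPoint]

variable [DecidableEq n]

variable (k 𝔞 n) in
/-- The generic group element. -/
noncomputable def modelElement : Matrix n n (GroupModel k 𝔞 n) :=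
  Matrix.of fun i j => ι k _ (0, Matrix.single i j 1, 0)

variable (k 𝔞 n) in
/-- The inverse of the generic group element. -/
noncomputable def modelInverse : Matrix n n (GroupModel k 𝔞 n) :=
  Matrix.of fun i j => ι k _ (0, 0, Matrix.single i j 1)

variable (ρ : 𝔞 →ₗ[k] Module.End k (n → k))

/-- A matrix with constant entries. -/
noncomputable def constMatrix (k : Type*) [Field k] (B : Type*) [CommRing B] [Algebra k B]
    {n : Type*} [Fintype n] [DecidableEq n] (u : Module.End k (n → k)) : Matrix n n B :=
  (LinearMap.toMatrix' u).map (algebraMap k B)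

/-- The action of `z ∈ 𝔞` on the model which leaves `g⁻¹·x` invariant, for `x` and `g` the generic
point and the generic group element. -/
noncomputable def modelAction (z : 𝔞) :
    Derivation k (GroupModel k 𝔞 n) (GroupModel k 𝔞 n) :=
  -- The derivative `g ρ(z)` of `g` sends the coordinate `E_ij` to `∑ ρ(z)_lj E_il = E_ij ρ(z)ᵀ`,
  -- whence the transposes; the sign on the second factor is that of `δ(g⁻¹) = -ρ(z) g⁻¹`.
  derivationOfLinear (ι k _ ∘ₗ ((LieAlgebra.ad k 𝔞 z : 𝔞 →ₗ[k] 𝔞).prodMap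
    ((LinearMap.mulRight k (LinearMap.toMatrix' (ρ z)).transpose).prodMap
      (-LinearMap.mulLeft k (LinearMap.toMatrix' (ρ z)).transpose))))

theorem map_modelCounit_modelElement :
    (modelElement k 𝔞 n).map (modelCounit k 𝔞 n) = 1 := by
  ext i j
  by_cases h : i = j
  · subst h
    simp [modelElement, modelCounit]
  · simp [modelElement, modelCounit, h]

theorem map_modelCounit_modelInverse :
    (modelInverse k 𝔞 n).map (modelCounit k 𝔞 n) = 1 := by
  ext i j
  by_cases h : i = j
  · subst h
    simp [modelInverse, modelCounit]
  · simp [modelInverse, modelCounit, h]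

theorem modelAction_modelPoint (z : 𝔞) (f : SymmetricAlgebra k 𝔞) :
    modelAction ρ z (modelPoint f) = modelPoint (symAd z f) := by
  refine map_derivation_eq modelPoint (symAd z) (modelAction ρ z) (fun m => ?_) f
  simp [modelPoint, modelAction]
  rfl

theorem map_modelAction_modelElement (z : 𝔞) :
    (modelElement k 𝔞 n).map (modelAction ρ z) =
      modelElement k 𝔞 n * constMatrix k _ (ρ z) := by
  ext i j
  have h : Matrix.single i j (1 : k) * (LinearMap.toMatrix' (ρ z)).transpose =
      ∑ l, LinearMap.toMatrix' (ρ z) l j • Matrix.single i l (1 : k) := by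
    ext a b
    rw [Matrix.sum_apply]
    by_cases h : a = i
    · subst h
      simp [Matrix.single_apply]
    · simp [h, Ne.symm h]
  have h2 : ((0, ∑ l, LinearMap.toMatrix' (ρ z) l j • Matrix.single i l (1 : k), 0) :
      𝔞 × Matrix n n k × Matrix n n k) =
        ∑ l, LinearMap.toMatrix' (ρ z) l j • (0, Matrix.single i l (1 : k), 0) := by
    ext <;> simp [Prod.fst_sum, Prod.snd_sum]
  rw [Matrix.map_apply, modelElement, Matrix.of_apply, modelAction, derivationOfLinear_ι,
    Matrix.mul_apply]
  simp only [LinearMap.comp_apply, LinearMap.prodMap_apply, map_zero, LinearMap.mulRight_apply, h,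
    h2, map_sum, map_smul, Matrix.of_apply, constMatrix, Matrix.map_apply]
  refine Finset.sum_congr rfl fun l _ => ?_
  rw [Algebra.smul_def, mul_comm]

theorem map_modelAction_modelInverse (z : 𝔞) :
    (modelInverse k 𝔞 n).map (modelAction ρ z) =
      -(constMatrix k _ (ρ z) * modelInverse k 𝔞 n) := by
  ext i j
  have h : -((LinearMap.toMatrix' (ρ z)).transpose * Matrix.single i j (1 : k)) =
      ∑ l, (-LinearMap.toMatrix' (ρ z) i l) • Matrix.single l j (1 : k) := by
    ext a b
    rw [Matrix.sum_apply]
    by_cases h : b = j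
    · subst h
      simp [Matrix.single_apply]
    · simp [h, Ne.symm h]
  have h2 : ((0, 0, ∑ l, (-LinearMap.toMatrix' (ρ z) i l) • Matrix.single l j (1 : k)) :
      𝔞 × Matrix n n k × Matrix n n k) =
        ∑ l, (-LinearMap.toMatrix' (ρ z) i l) • (0, 0, Matrix.single l j (1 : k)) := by
    ext <;> simp [Prod.fst_sum, Prod.snd_sum]
  rw [Matrix.map_apply, modelInverse, Matrix.of_apply, modelAction, derivationOfLinear_ι,
    Matrix.neg_apply, Matrix.mul_apply]
  simp only [LinearMap.comp_apply, LinearMap.prodMap_apply, map_zero, LinearMap.neg_apply,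
    LinearMap.mulLeft_apply, h, h2, map_sum, map_smul, Matrix.of_apply, constMatrix,
    Matrix.map_apply, ← Finset.sum_neg_distrib]
  refine Finset.sum_congr rfl fun l _ => ?_
  rw [neg_smul, Algebra.smul_def]

/-- The ideal of the (formal) graph of the action. -/
noncomputable def modelIdeal : Ideal (GroupModel k 𝔞 n) :=
  maxStable (Set.range (modelAction ρ)) (RingHom.ker (modelCounit k 𝔞 n))

instance [CharZero k] : (modelIdeal ρ).IsPrime :=
  have : (RingHom.ker (modelCounit k 𝔞 n)).IsPrime := RingHom.ker_isPrime _
  maxStable_isPrime _ _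

theorem modelAction_mem {f : GroupModel k 𝔞 n} (hf : f ∈ modelIdeal ρ) (z : 𝔞) :
    modelAction ρ z f ∈ modelIdeal ρ :=
  isStable_maxStable _ _ _ (Set.mem_range_self z) f hf

theorem modelCounit_eq_zero {f : GroupModel k 𝔞 n} (hf : f ∈ modelIdeal ρ) :
    modelCounit k 𝔞 n f = 0 :=
  maxStable_le _ _ hf

/-- The method for proving relations on the model: they need only hold at `g = 1` and be permuted
among themselves, up to the ideal they generate, by the action. -/
theorem subset_modelIdeal {T : Set (GroupModel k 𝔞 n)}
    (h : ∀ z, ∀ t ∈ T, modelAction ρ z t ∈ Ideal.span T)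
    (h' : ∀ t ∈ T, modelCounit k 𝔞 n t = 0) : T ⊆ modelIdeal ρ :=
  subset_maxStable (by rintro _ ⟨z, rfl⟩ t ht; exact h z t ht) h'

theorem modelInverse_mul_modelElement_mem (i j : n) :
    (modelInverse k 𝔞 n * modelElement k 𝔞 n - 1) i j ∈ modelIdeal ρ := by
  set e := modelInverse k 𝔞 n * modelElement k 𝔞 n - 1 with he
  -- The error matrix `e = g'g - 1` evolves by the commutator `[e, ρ(z)]`, hence inside the ideal of
  -- its own entries.
  have hE : ∀ z, e.map (modelAction ρ z) =
      e * constMatrix k _ (ρ z) - constMatrix k _ (ρ z) * e := by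
    intro z
    have h1 : e.map (modelAction ρ z) =
        (modelInverse k 𝔞 n * modelElement k 𝔞 n).map (modelAction ρ z) := by
      ext i j
      by_cases h : i = j
      · subst h
        simp [he]
      · simp [he, h]
    rw [h1, map_derivation_mul, map_modelAction_modelElement, map_modelAction_modelInverse, he]
    noncomm_ring
  refine subset_modelIdeal ρ (T := Set.range fun p : n × n => e p.1 p.2) ?_ ?_ ⟨(i, j), rfl⟩
  · rintro z _ ⟨p, rfl⟩
    have h1 := congrFun (congrFun (hE z) p.1) p.2
    rw [Matrix.map_apply] at h1
    change modelAction ρ z (e p.1 p.2) ∈ _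
    rw [h1, Matrix.sub_apply, Matrix.mul_apply, Matrix.mul_apply]
    refine sub_mem (sum_mem fun l _ => Ideal.mul_mem_right _ _ (Ideal.subset_span ⟨(_, _), rfl⟩))
      (sum_mem fun l _ => Ideal.mul_mem_left _ _ (Ideal.subset_span ⟨(_, _), rfl⟩))
  · rintro _ ⟨p, rfl⟩
    have h1 : e.map (modelCounit k 𝔞 n) = 0 := by
      rw [he, Matrix.map_sub (modelCounit k 𝔞 n) (map_sub _), Matrix.map_mul,
        map_modelCounit_modelElement, map_modelCounit_modelInverse,
        Matrix.map_one _ (map_zero _) (map_one _), mul_one, sub_self]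
    exact congrFun (congrFun h1 p.1) p.2

variable {G : Subgroup (LinearMap.GeneralLinearGroup k (n → k))}

theorem matrixPoint_one (p : EndPoly k (n → k)) {B : Type*} [CommRing B] [Algebra k B] :
    matrixPoint (1 : Matrix n n B) p = algebraMap k B (evalEnd 1 p) := by
  rw [← matrixPoint_toMatrix, LinearMap.toMatrix'_one, Matrix.map_one _ (map_zero _) (map_one _)]

/-- On functions of `g` the action is the left invariant derivation of `ρ(z)`, which preserves the
ideal of `G` since `ρ(z) ∈ Lie G`; and `1 ∈ G`. -/
theorem matrixPoint_modelElement_mem (hG : ∀ x, ρ x ∈ lieOfGroup G) {p : EndPoly k (n → k)}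
    (hp : p ∈ groupIdeal G) : matrixPoint (modelElement k 𝔞 n) p ∈ modelIdeal ρ := by
  refine subset_modelIdeal ρ (T := matrixPoint (modelElement k 𝔞 n) '' groupIdeal G) ?_ ?_
    ⟨p, hp, rfl⟩
  · rintro z _ ⟨q, hq, rfl⟩
    have h1 := map_derivation_eq (matrixPoint (modelElement k 𝔞 n)) (leftInvDerivation (ρ z))
      (modelAction ρ z) (fun φ => by
        rw [derivation_matrixPoint_ι, map_modelAction_modelElement, constMatrix,
          matrixPoint_ι_mul_right, leftInvDerivation, derivationOfLinear_ι]
        rfl) q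
    rw [h1]
    exact Ideal.subset_span ⟨_, leftInvDerivation_mem (hG z) hq, rfl⟩
  · rintro _ ⟨q, hq, rfl⟩
    rw [map_matrixPoint, map_modelCounit_modelElement, matrixPoint_one, evalEnd_one_eq_zero hq,
      map_zero]

theorem matrixPoint_modelInverse_mem (hG : ∀ x, ρ x ∈ lieOfGroup G) {p : EndPoly k (n → k)}
    (hp : p ∈ groupIdeal G) : matrixPoint (modelInverse k 𝔞 n) p ∈ modelIdeal ρ := by
  refine subset_modelIdeal ρ (T := matrixPoint (modelInverse k 𝔞 n) '' groupIdeal G) ?_ ?_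
    ⟨p, hp, rfl⟩
  · rintro z _ ⟨q, hq, rfl⟩
    have h1 := map_derivation_eq (matrixPoint (modelInverse k 𝔞 n)) (-rightInvDerivation (ρ z))
      (modelAction ρ z) (fun φ => by
        rw [derivation_matrixPoint_ι, map_modelAction_modelInverse, constMatrix,
          matrixPoint_ι_neg, matrixPoint_ι_mul_left, Derivation.neg_apply, map_neg,
          rightInvDerivation, derivationOfLinear_ι]
        rfl) q
    rw [h1]
    refine Ideal.subset_span ⟨_, ?_, rfl⟩
    rw [Derivation.neg_apply]
    exact neg_mem (rightInvDerivation_mem (hG z) hq)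
  · rintro _ ⟨q, hq, rfl⟩
    rw [map_matrixPoint, map_modelCounit_modelInverse, matrixPoint_one, evalEnd_one_eq_zero hq,
      map_zero]

/-- The conjugate `g⁻¹ ρ(x) g` by the generic group element. -/
noncomputable def modelConj (x : 𝔞) : Matrix n n (GroupModel k 𝔞 n) :=
  modelInverse k 𝔞 n * constMatrix k _ (ρ x) * modelElement k 𝔞 n

theorem map_modelAction_modelConj (z x : 𝔞) :
    (modelConj ρ x).map (modelAction ρ z) =
      modelConj ρ x * constMatrix k _ (ρ z) + -(constMatrix k _ (ρ z) * modelConj ρ x) := by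
  rw [modelConj, map_derivation_mul, map_derivation_mul, map_modelAction_modelElement,
    map_modelAction_modelInverse]
  have : (constMatrix k (GroupModel k 𝔞 n) (ρ x)).map (modelAction ρ z) = 0 :=
    map_derivation_algebraMap _ _
  rw [this]
  noncomm_ring

theorem map_modelCounit_modelConj (x : 𝔞) :
    (modelConj ρ x).map (modelCounit k 𝔞 n) = constMatrix k _ (ρ x) := by
  rw [modelConj, Matrix.map_mul, Matrix.map_mul, map_modelCounit_modelElement,
    map_modelCounit_modelInverse, one_mul, mul_one]
  ext i j
  simp [constMatrix]

/-- `g⁻¹ρ(x)g` evolves by commutators with `ρ(z)`, which preserve `ρ(𝔞)`. The linear equations of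
`ρ(𝔞)` therefore persist from `g = 1`, where the matrix is `ρ(x)`. -/
theorem matrixPoint_modelConj_mem (hρ : ∀ x y, ρ ⁅x, y⁆ = ρ x * ρ y - ρ y * ρ x) (x : 𝔞)
    {φ : Module.Dual k (Module.End k (n → k))} (hφ : ∀ y, φ (ρ y) = 0) :
    matrixPoint (modelConj ρ x) (ι k _ φ) ∈ modelIdeal ρ := by
  refine subset_modelIdeal ρ (T := {t | ∃ ψ : Module.Dual k (Module.End k (n → k)),
    (∀ y, ψ (ρ y) = 0) ∧ t = matrixPoint (modelConj ρ x) (ι k _ ψ)}) ?_ ?_ ⟨φ, hφ, rfl⟩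
  · rintro z _ ⟨ψ, hψ, rfl⟩
    refine Ideal.subset_span ⟨ψ ∘ₗ LinearMap.mulRight k (ρ z) - ψ ∘ₗ LinearMap.mulLeft k (ρ z),
      fun y => ?_, ?_⟩
    · rw [LinearMap.sub_apply, LinearMap.comp_apply, LinearMap.comp_apply, ← map_sub,
        LinearMap.mulRight_apply, LinearMap.mulLeft_apply, ← hρ, hψ]
    · rw [derivation_matrixPoint_ι, map_modelAction_modelConj, matrixPoint_ι_add,
        matrixPoint_ι_neg, constMatrix, matrixPoint_ι_mul_left, matrixPoint_ι_mul_right, map_sub,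
        map_sub, sub_eq_add_neg]
  · rintro _ ⟨ψ, hψ, rfl⟩
    rw [map_matrixPoint, map_modelCounit_modelConj, constMatrix, matrixPoint_toMatrix, evalEnd_ι,
      hψ, map_zero]

end Model

end CoadjointSlice

namespace CoadjointSlice

open SymmetricAlgebra TensorProduct

/-! ## The generic orbit -/

section Orbit

variable {k 𝔞 n : Type*} [Field k] [LieRing 𝔞] [LieAlgebra k 𝔞] [Fintype n] [DecidableEq n]

/-- The pairing of a matrix over a ring containing `S(𝔞)` with the linear map
`End(kⁿ) → 𝔞 → S(𝔞)`. -/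
noncomputable def vectorPairing {B : Type*} [CommRing B] [Algebra k B]
    (a : SymmetricAlgebra k 𝔞 →ₐ[k] B) (θ : Module.End k (n → k) →ₗ[k] 𝔞) (M : Matrix n n B) : B :=
  ∑ i, ∑ j, M i j * a (ι k 𝔞 (θ (elementary k i j)))

section Pairing

variable {B : Type*} [CommRing B] [Algebra k B] (a : SymmetricAlgebra k 𝔞 →ₐ[k] B)

theorem vectorPairing_eq {κ : Type*} [Fintype κ] (X : Module.Basis κ k 𝔞)
    (θ : Module.End k (n → k) →ₗ[k] 𝔞) (M : Matrix n n B) :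
    vectorPairing a θ M =
      ∑ l, a (ι k 𝔞 (X l)) * matrixPoint M (ι k _ (X.coord l ∘ₗ θ)) := by
  have h : ∀ y : 𝔞, a (ι k 𝔞 y) = ∑ l, X.coord l y • a (ι k 𝔞 (X l)) := by
    intro y
    conv_lhs => rw [← X.sum_repr y, map_sum, map_sum]
    simp only [map_smul, X.coord_apply]
  simp only [vectorPairing, matrixPoint_ι, Finset.mul_sum]
  conv_rhs => rw [Finset.sum_comm]
  refine Finset.sum_congr rfl fun i _ => ?_
  conv_rhs => rw [Finset.sum_comm]
  refine Finset.sum_congr rfl fun j _ => ?_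
  rw [h, Finset.mul_sum]
  refine Finset.sum_congr rfl fun l _ => ?_
  simp only [LinearMap.comp_apply, Algebra.smul_def]
  ring

theorem vectorPairing_add (θ : Module.End k (n → k) →ₗ[k] 𝔞) (M N : Matrix n n B) :
    vectorPairing a θ (M + N) = vectorPairing a θ M + vectorPairing a θ N := by
  simp [vectorPairing, add_mul, Finset.sum_add_distrib]

theorem vectorPairing_neg (θ : Module.End k (n → k) →ₗ[k] 𝔞) (M : Matrix n n B) :
    vectorPairing a θ (-M) = -vectorPairing a θ M := by
  simp [vectorPairing]

theorem vectorPairing_smul (θ : Module.End k (n → k) →ₗ[k] 𝔞) (b : B) (M : Matrix n n B) :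
    vectorPairing a θ (b • M) = b * vectorPairing a θ M := by
  simp [vectorPairing, Finset.mul_sum, mul_assoc]

theorem vectorPairing_sum {κ : Type*} (s : Finset κ) (θ : Module.End k (n → k) →ₗ[k] 𝔞)
    (M : κ → Matrix n n B) :
    vectorPairing a θ (∑ l ∈ s, M l) = ∑ l ∈ s, vectorPairing a θ (M l) := by
  classical
  induction s using Finset.induction_on with
  | empty => simp [vectorPairing]
  | insert l s hl ih => rw [Finset.sum_insert hl, Finset.sum_insert hl, vectorPairing_add, ih]

theorem vectorPairing_add_left (θ θ' : Module.End k (n → k) →ₗ[k] 𝔞) (M : Matrix n n B) :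
    vectorPairing a (θ + θ') M = vectorPairing a θ M + vectorPairing a θ' M := by
  simp [vectorPairing, mul_add, Finset.sum_add_distrib]

theorem vectorPairing_neg_left (θ : Module.End k (n → k) →ₗ[k] 𝔞) (M : Matrix n n B) :
    vectorPairing a (-θ) M = -vectorPairing a θ M := by
  simp [vectorPairing]

theorem vectorPairing_constMatrix (θ : Module.End k (n → k) →ₗ[k] 𝔞) (u : Module.End k (n → k)) :
    vectorPairing a θ (constMatrix k B u) = a (ι k 𝔞 (θ u)) := by
  conv_rhs => rw [← sum_elementary u]
  simp only [map_sum, map_smul, vectorPairing, constMatrix, Matrix.map_apply,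
    Algebra.smul_def (R := k) (A := B)]

theorem vectorPairing_mul_right [FiniteDimensional k 𝔞] (θ : Module.End k (n → k) →ₗ[k] 𝔞)
    (M : Matrix n n B) (u : Module.End k (n → k)) :
    vectorPairing a θ (M * constMatrix k B u) =
      vectorPairing a (θ ∘ₗ LinearMap.mulRight k u) M := by
  rw [vectorPairing_eq a (Module.finBasis k 𝔞), vectorPairing_eq a (Module.finBasis k 𝔞)]
  simp only [constMatrix, matrixPoint_ι_mul_right]
  rfl

theorem vectorPairing_mul_left [FiniteDimensional k 𝔞] (θ : Module.End k (n → k) →ₗ[k] 𝔞)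
    (M : Matrix n n B) (u : Module.End k (n → k)) :
    vectorPairing a θ (constMatrix k B u * M) =
      vectorPairing a (θ ∘ₗ LinearMap.mulLeft k u) M := by
  rw [vectorPairing_eq a (Module.finBasis k 𝔞), vectorPairing_eq a (Module.finBasis k 𝔞)]
  simp only [constMatrix, matrixPoint_ι_mul_left]
  rfl

theorem map_vectorPairing {B' : Type*} [CommRing B'] [Algebra k B'] (f : B →ₐ[k] B')
    (θ : Module.End k (n → k) →ₗ[k] 𝔞) (M : Matrix n n B) :
    f (vectorPairing a θ M) = vectorPairing (f.comp a) θ (M.map f) := by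
  simp [vectorPairing]

/-- The derivative of a generic conjugate along a derivation killing the coordinates on `𝔞*`. -/
theorem derivation_vectorPairing [FiniteDimensional k 𝔞] {ρ : 𝔞 →ₗ[k] Module.End k (n → k)}
    (hρ : ∀ x y, ρ ⁅x, y⁆ = ρ x * ρ y - ρ y * ρ x) {π : Module.End k (n → k) →ₗ[k] 𝔞}
    (hπ : ∀ x, π (ρ x) = x) (δ : Derivation k B B) (hδ : ∀ f, δ (a f) = 0)
    {H H' : Matrix n n B} (hH : H' * H = 1) {κ : Type*} [Fintype κ] {X : κ → 𝔞} {c M : κ → B}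
    (hm : H' * H.map δ = ∑ l, c l • constMatrix k B (ρ (X l))) {x : 𝔞}
    (hx : H' * constMatrix k B (ρ x) * H = ∑ l, M l • constMatrix k B (ρ (X l))) :
    δ (vectorPairing a π (H' * constMatrix k B (ρ x) * H)) =
      ∑ i, ∑ j, M i * a (ι k 𝔞 ⁅X i, X j⁆) * c j := by
  have hH2 : H * H' = 1 := mul_eq_one_comm.1 hH
  -- The derivative of an inverse, from differentiating `H' H = 1`.
  have h1 : H'.map δ = -(H' * H.map δ * H') := by
    have h2 : (H' * H).map δ = 0 := by
      rw [hH]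
      ext i j
      by_cases h : i = j
      · subst h
        simp
      · simp [h]
    rw [map_derivation_mul] at h2
    calc H'.map δ = H'.map δ * (H * H') := by rw [hH2, mul_one]
      _ = H'.map δ * H * H' := by rw [mul_assoc]
      _ = -(H' * H.map δ * H') := by rw [eq_neg_of_add_eq_zero_left h2, neg_mul]
  set N := H' * constMatrix k B (ρ x) * H with hN
  set m := H' * H.map δ with hmdef
  -- The conjugate `N` of a constant matrix satisfies `δ N = [N, m]` with `m` the logarithmic
  -- derivative. Both `N` and `m` are combinations of the `ρ(X_l)`, so only brackets `[X_i, X_j]`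
  -- appear.
  have h3 : N.map δ = N * m + -(m * N) := by
    rw [hN, map_derivation_mul, map_derivation_mul, h1]
    have : (constMatrix k B (ρ x)).map δ = 0 := map_derivation_algebraMap _ _
    rw [this, hmdef]
    calc (-(H' * H.map δ * H') * constMatrix k B (ρ x) + H' * 0) * H +
          H' * constMatrix k B (ρ x) * H.map δ
        = H' * constMatrix k B (ρ x) * 1 * H.map δ -
            (H' * H.map δ) * (H' * constMatrix k B (ρ x) * H) := by noncomm_ring
      _ = _ := by rw [← hH2]; noncomm_ring
  have h4 : δ (vectorPairing a π N) = vectorPairing a π (N.map δ) := by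
    simp [vectorPairing, Derivation.leibniz, hδ, mul_comm]
  have h5 : N.map δ = ∑ i, ∑ j, (M i * c j) • constMatrix k B (ρ ⁅X i, X j⁆) := by
    have h6 : ∀ i j, constMatrix k B (ρ ⁅X i, X j⁆) =
        constMatrix k B (ρ (X i)) * constMatrix k B (ρ (X j)) -
          constMatrix k B (ρ (X j)) * constMatrix k B (ρ (X i)) := by
      intro i j
      rw [hρ, constMatrix, map_sub, Matrix.map_sub _ (map_sub _), LinearMap.toMatrix'_mul,
        LinearMap.toMatrix'_mul, Matrix.map_mul, Matrix.map_mul]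
      rfl
    rw [h3, hx, hm]
    simp only [h6, Finset.sum_mul_sum, smul_sub, Finset.sum_sub_distrib, ← sub_eq_add_neg,
      smul_mul_smul_comm]
    congr 1
    rw [Finset.sum_comm]
    refine Finset.sum_congr rfl fun i _ => Finset.sum_congr rfl fun j _ => ?_
    rw [mul_comm]
  rw [h4, h5, vectorPairing_sum]
  refine Finset.sum_congr rfl fun i _ => ?_
  rw [vectorPairing_sum]
  refine Finset.sum_congr rfl fun j _ => ?_
  rw [vectorPairing_smul, vectorPairing_constMatrix, hπ]
  ring

end Pairing

variable (ρ : 𝔞 →ₗ[k] Module.End k (n → k))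
  (π : Module.End k (n → k) →ₗ[k] 𝔞)

/-- Modulo the ideal the conjugate is a combination of elements of `ρ(𝔞)`, so the pairing depends
only on the restriction of `θ` to `ρ(𝔞)`. This makes the choice of left inverse `π` harmless. -/
theorem vectorPairing_modelConj_mem [FiniteDimensional k 𝔞]
    (hρ : ∀ x y, ρ ⁅x, y⁆ = ρ x * ρ y - ρ y * ρ x)
    {θ : Module.End k (n → k) →ₗ[k] 𝔞} (hθ : ∀ y, θ (ρ y) = 0) (x : 𝔞) :
    vectorPairing modelPoint θ (modelConj ρ x) ∈ modelIdeal ρ := by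
  rw [vectorPairing_eq _ (Module.finBasis k 𝔞)]
  refine sum_mem fun l _ => Ideal.mul_mem_left _ _ (matrixPoint_modelConj_mem ρ hρ x fun y => ?_)
  rw [LinearMap.comp_apply, hθ, map_zero]

/-- The comorphism of the orbit map: the generic point moved by the inverse of the generic group
element. -/
noncomputable def modelOrbit : SymmetricAlgebra k 𝔞 →ₐ[k] GroupModel k 𝔞 n :=
  SymmetricAlgebra.lift
    { toFun := fun x => vectorPairing modelPoint π (modelConj ρ x)
      map_add' := fun x y => by
        rw [← vectorPairing_add]
        congr 1
        simp only [modelConj, constMatrix, map_add]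
        rw [Matrix.map_add _ (map_add _), mul_add, add_mul]
      map_smul' := fun c x => by
        rw [RingHom.id_apply, Algebra.smul_def, ← vectorPairing_smul]
        congr 1
        have : constMatrix k (GroupModel k 𝔞 n) (ρ (c • x)) =
            algebraMap k (GroupModel k 𝔞 n) c • constMatrix k _ (ρ x) := by
          ext i j
          rw [constMatrix, map_smul, map_smul, Matrix.smul_apply, Matrix.map_apply,
            Matrix.smul_apply, smul_eq_mul, smul_eq_mul, map_mul]
          rfl
        rw [modelConj, this, Matrix.mul_smul, Matrix.smul_mul]
        rfl }

theorem modelOrbit_ι (x : 𝔞) :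
    modelOrbit ρ π (ι k 𝔞 x) = vectorPairing modelPoint π (modelConj ρ x) := by
  rw [modelOrbit, lift_ι_apply]
  rfl

variable {ρ π}

theorem modelCounit_modelOrbit (hπ : ∀ x, π (ρ x) = x) (f : SymmetricAlgebra k 𝔞) :
    modelCounit k 𝔞 n (modelOrbit ρ π f) = f := by
  refine algHom_congr (φ := (modelCounit k 𝔞 n).comp (modelOrbit ρ π)) (ψ := AlgHom.id k _)
    (fun x => ?_) f
  rw [AlgHom.comp_apply, modelOrbit_ι, map_vectorPairing, map_modelCounit_modelConj,
    vectorPairing_constMatrix, hπ, AlgHom.comp_apply, modelCounit_modelPoint]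
  rfl

variable [FiniteDimensional k 𝔞]

/-- The orbit map is invariant under the action on the model. -/
theorem modelAction_modelOrbit_mem (hρ : ∀ x y, ρ ⁅x, y⁆ = ρ x * ρ y - ρ y * ρ x)
    (hπ : ∀ x, π (ρ x) = x) (z : 𝔞) (f : SymmetricAlgebra k 𝔞) :
    modelAction ρ z (modelOrbit ρ π f) ∈ modelIdeal ρ := by
  induction f using SymmetricAlgebra.induction with
  | algebraMap r =>
    rw [AlgHom.commutes, Derivation.map_algebraMap]
    exact zero_mem _
  | ι x =>
    rw [modelOrbit_ι]
    have h1 : modelAction ρ z (vectorPairing modelPoint π (modelConj ρ x)) =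
        vectorPairing modelPoint π ((modelConj ρ x).map (modelAction ρ z)) +
          vectorPairing modelPoint ((LieAlgebra.ad k 𝔞 z : 𝔞 →ₗ[k] 𝔞) ∘ₗ π) (modelConj ρ x) := by
      simp only [vectorPairing, map_sum, Derivation.leibniz, modelAction_modelPoint, symAd_ι,
        ← Finset.sum_add_distrib, smul_eq_mul, Matrix.map_apply, LinearMap.comp_apply,
        LieAlgebra.ad_apply]
      refine Finset.sum_congr rfl fun i _ => Finset.sum_congr rfl fun j _ => ?_
      ring
    rw [h1, map_modelAction_modelConj, vectorPairing_add, vectorPairing_neg,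
      vectorPairing_mul_right, vectorPairing_mul_left, ← vectorPairing_neg_left,
      ← vectorPairing_add_left, ← vectorPairing_add_left]
    -- On `ρ(y)` the variation of `g` contributes `[y, z]` and that of the point of `𝔞*` contributes
    -- `[z, y]`; they cancel.
    refine vectorPairing_modelConj_mem ρ hρ (fun y => ?_) x
    have h2 : π (ρ y * ρ z) - π (ρ z * ρ y) = ⁅y, z⁆ := by
      rw [← map_sub, ← hρ, hπ]
    simp only [LinearMap.add_apply, LinearMap.neg_apply, LinearMap.comp_apply,
      LinearMap.mulRight_apply, LinearMap.mulLeft_apply, LieAlgebra.ad_apply, hπ]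
    rw [← sub_eq_add_neg, h2, ← lie_skew, neg_add_cancel]
  | mul a b ha hb =>
    rw [map_mul, Derivation.leibniz]
    exact add_mem (Ideal.mul_mem_left _ _ hb) (Ideal.mul_mem_left _ _ ha)
  | add a b ha hb =>
    rw [map_add, map_add]
    exact add_mem ha hb

end Orbit

end CoadjointSlice

namespace CoadjointSlice

open SymmetricAlgebra

/-! ## Rational invariants and the rank of the commutator matrix -/

section Rosenlicht

variable {k 𝔞 n : Type*} [Field k] [LieRing 𝔞] [LieAlgebra k 𝔞] [Fintype n] [DecidableEq n]
  [FiniteDimensional k 𝔞]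

/-- A linear relation between functions on the generic orbit, with coefficients depending on the
base point only, comes from a linear relation with invariant coefficients. -/
theorem exists_invariant_relation [CharZero k]
    (hSy : poissonSemicentre k 𝔞 = Subalgebra.toSubmodule (invariants k 𝔞))
    {ρ : 𝔞 →ₗ[k] Module.End k (n → k)} {π : Module.End k (n → k) →ₗ[k] 𝔞}
    (hρ : ∀ x y, ρ ⁅x, y⁆ = ρ x * ρ y - ρ y * ρ x) (hπ : ∀ x, π (ρ x) = x)
    {τ : Type*} (t : τ → SymmetricAlgebra k 𝔞) (s : Finset τ) :
    ∀ p : τ → SymmetricAlgebra k 𝔞, (∃ α ∈ s, p α ≠ 0) →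
      ∑ α ∈ s, modelPoint (p α) * modelOrbit ρ π (t α) ∈ modelIdeal ρ →
      ∃ y : τ → SymmetricAlgebra k 𝔞, (∀ α, y α ∈ invariants k 𝔞) ∧ (∃ α ∈ s, y α ≠ 0) ∧
        ∑ α ∈ s, y α * t α = 0 := by
  classical
  induction s using Finset.strongInduction with
  | H s ih =>
  rintro p ⟨α₀, hα₀, hp₀⟩ hrel
  -- As in Artin's lemma on characters: the moved functions are constants for the action, so
  -- differentiating a relation touches only its coefficients, and eliminating the term `α₀`
  -- shortens it. Otherwise every ratio `p α / p α₀` is annihilated by `𝔞`.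
  by_cases hz : ∃ z : 𝔞, ∃ α ∈ s, p α₀ * symAd z (p α) - symAd z (p α₀) * p α ≠ 0
  · obtain ⟨z, α, hα, hne⟩ := hz
    have hα' : α ≠ α₀ := by
      rintro rfl
      exact hne (by ring)
    have hmem : ∑ β ∈ s, modelPoint (p α₀ * symAd z (p β) - symAd z (p α₀) * p β) *
        modelOrbit ρ π (t β) ∈ modelIdeal ρ := by
      have h1 := modelAction_mem ρ hrel z
      have h2 : ∑ β ∈ s, modelPoint (p α₀ * symAd z (p β) - symAd z (p α₀) * p β) *
          modelOrbit ρ π (t β) =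
          modelPoint (p α₀) * modelAction ρ z (∑ β ∈ s, modelPoint (p β) * modelOrbit ρ π (t β)) -
          modelPoint (symAd z (p α₀)) * ∑ β ∈ s, modelPoint (p β) * modelOrbit ρ π (t β) -
          ∑ β ∈ s, modelPoint (p α₀) * modelPoint (p β) *
            modelAction ρ z (modelOrbit ρ π (t β)) := by
        rw [map_sum, Finset.mul_sum, Finset.mul_sum, ← Finset.sum_sub_distrib,
          ← Finset.sum_sub_distrib]
        refine Finset.sum_congr rfl fun β _ => ?_
        rw [Derivation.leibniz, modelAction_modelPoint, map_sub, map_mul, map_mul, smul_eq_mul,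
          smul_eq_mul]
        ring
      rw [h2]
      exact sub_mem (sub_mem (Ideal.mul_mem_left _ _ h1) (Ideal.mul_mem_left _ _ hrel))
        (sum_mem fun β _ => Ideal.mul_mem_left _ _ (modelAction_modelOrbit_mem hρ hπ z _))
    rw [← Finset.add_sum_erase s _ hα₀] at hmem
    have h0 : p α₀ * symAd z (p α₀) - symAd z (p α₀) * p α₀ = 0 := by ring
    rw [h0, map_zero, zero_mul, zero_add] at hmem
    obtain ⟨y, hy, ⟨β, hβ, hyβ⟩, hsum⟩ := ih (s.erase α₀) (Finset.erase_ssubset hα₀) _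
      ⟨α, Finset.mem_erase.2 ⟨hα', hα⟩, hne⟩ hmem
    refine ⟨Function.update y α₀ 0, fun γ => ?_, ⟨β, Finset.mem_of_mem_erase hβ, ?_⟩, ?_⟩
    · by_cases h : γ = α₀
      · rw [h, Function.update_self]
        exact zero_mem _
      · rw [Function.update_of_ne h]
        exact hy γ
    · rwa [Function.update_of_ne (Finset.ne_of_mem_erase hβ)]
    · rw [← Finset.add_sum_erase s _ hα₀, Function.update_self, zero_mul, zero_add, ← hsum]
      refine Finset.sum_congr rfl fun γ hγ => ?_
      rw [Function.update_of_ne (Finset.ne_of_mem_erase hγ)]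
  · push Not at hz
    have hex : ∀ α, ∃ y ∈ invariants k 𝔞, ∃ z ∈ invariants k 𝔞, z ≠ 0 ∧
        (α ∈ s → p α * z = p α₀ * y) := by
      intro α
      by_cases hα : α ∈ s
      · obtain ⟨y, hy, z, hz', hz0, h⟩ := exists_invariants_of_ratio hSy (p := p α) hp₀
          (fun x => by linear_combination hz x α hα)
        exact ⟨y, hy, z, hz', hz0, fun _ => h⟩
      · exact ⟨0, zero_mem _, 1, one_mem _, one_ne_zero, fun h => absurd h hα⟩
    choose y hy z hzY hz0 hyz using hex
    -- Each ratio is `y α / z α` with invariant terms; multiplying by all denominators gives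
    -- invariant coefficients.
    have hw : ∀ α ∈ s, p α * ∏ β ∈ s, z β = p α₀ * (y α * ∏ β ∈ s.erase α, z β) := by
      intro α hα
      rw [← Finset.mul_prod_erase s _ hα, ← mul_assoc, hyz α hα, mul_assoc]
    have hmem : ∑ α ∈ s, modelPoint (y α * ∏ β ∈ s.erase α, z β) * modelOrbit ρ π (t α) ∈
        modelIdeal ρ := by
      have h1 : modelPoint (p α₀) *
          ∑ α ∈ s, modelPoint (y α * ∏ β ∈ s.erase α, z β) * modelOrbit ρ π (t α) =
          modelPoint (∏ β ∈ s, z β) *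
            ∑ α ∈ s, modelPoint (p α) * modelOrbit ρ π (t α) := by
        rw [Finset.mul_sum, Finset.mul_sum]
        refine Finset.sum_congr rfl fun α hα => ?_
        rw [← mul_assoc, ← mul_assoc, ← map_mul, ← map_mul, ← hw α hα, mul_comm (p α)]
      -- The factor `p α₀` cancels because the ideal is prime and meets the functions of the base
      -- point only in zero, as the specialization at `g = 1` shows.
      refine ((inferInstance : (modelIdeal ρ).IsPrime).mem_or_mem
        (h1 ▸ Ideal.mul_mem_left _ _ hrel)).resolve_left fun h => hp₀ ?_
      rw [← modelCounit_modelPoint (n := n) (p α₀), modelCounit_eq_zero ρ h]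
    refine ⟨fun α => y α * ∏ β ∈ s.erase α, z β,
      fun α => mul_mem (hy α) (prod_mem fun β _ => hzY β), ⟨α₀, hα₀, fun h => ?_⟩, ?_⟩
    · have h1 := hw α₀ hα₀
      rw [show y α₀ * ∏ β ∈ s.erase α₀, z β = 0 from h, mul_zero] at h1
      exact mul_ne_zero hp₀ (Finset.prod_ne_zero_iff.2 fun β _ => hz0 β) h1
    -- At `g = 1` the moved point is the base point, so the relation becomes one in `S(𝔞)`.
    · have h1 := modelCounit_eq_zero ρ hmem
      simpa [map_sum, map_mul, modelCounit_modelOrbit hπ] using h1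

variable {L : Type*} [Field L] [Algebra k L] [Algebra (SymmetricAlgebra k 𝔞) L]

/-- A polynomial relation is a linear relation among monomials in the moved functions. It descends
to one among the same monomials in `s` with invariant coefficients, which independence over `Y(𝔞)`
forbids. -/
theorem algebraicIndependent_modelOrbit [CharZero k]
    (hSy : poissonSemicentre k 𝔞 = Subalgebra.toSubmodule (invariants k 𝔞))
    {ρ : 𝔞 →ₗ[k] Module.End k (n → k)} {π : Module.End k (n → k) →ₗ[k] 𝔞}
    (hρ : ∀ x y, ρ ⁅x, y⁆ = ρ x * ρ y - ρ y * ρ x) (hπ : ∀ x, π (ρ x) = x)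
    (κ : GroupModel k 𝔞 n →ₐ[k] L) (hκ : ∀ f, κ f = 0 ↔ f ∈ modelIdeal ρ)
    (hL : ∀ f, algebraMap (SymmetricAlgebra k 𝔞) L f = κ (modelPoint f))
    {ι' : Type*} {s : ι' → SymmetricAlgebra k 𝔞}
    (hs : AlgebraicIndependent (invariants k 𝔞) s) :
    AlgebraicIndependent (SymmetricAlgebra k 𝔞) (fun i => κ (modelOrbit ρ π (s i))) := by
  classical
  rw [algebraicIndependent_iff]
  intro P hP
  by_contra hP0
  have h1 : ∑ m ∈ P.support, modelPoint (P.coeff m) *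
      modelOrbit ρ π (m.prod fun i e => s i ^ e) ∈ modelIdeal ρ := by
    rw [← hκ, ← hP, MvPolynomial.aeval_def, MvPolynomial.eval₂_eq, map_sum]
    refine Finset.sum_congr rfl fun m _ => ?_
    simp only [map_mul, hL, Finsupp.prod, map_prod, map_pow]
  obtain ⟨y, hy, ⟨m, hm, hym⟩, hsum⟩ := exists_invariant_relation hSy hρ hπ _ P.support _
    (by
      obtain ⟨m, hm⟩ := MvPolynomial.ne_zero_iff.1 hP0
      exact ⟨m, MvPolynomial.mem_support_iff.2 hm, hm⟩) h1
  have h2 := (algebraicIndependent_iff.1 hs)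
    (∑ m ∈ P.support, MvPolynomial.monomial m (⟨y m, hy m⟩ : invariants k 𝔞)) (by
      rw [map_sum, ← hsum]
      refine Finset.sum_congr rfl fun m _ => ?_
      rw [MvPolynomial.aeval_monomial]
      rfl)
  have h3 := congrArg (MvPolynomial.coeff m) h2
  rw [MvPolynomial.coeff_sum, Finset.sum_eq_single m (fun m' _ h => by
      rw [MvPolynomial.coeff_monomial, if_neg h]) (fun h => absurd hm h),
    MvPolynomial.coeff_monomial, if_pos rfl, MvPolynomial.coeff_zero] at h3
  exact hym (congrArg Subtype.val h3)

/-- The number of algebraically independent functions over the invariants is at most the rank of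
the commutator matrix. -/
theorem card_le_rank_of_model [CharZero k]
    (hSy : poissonSemicentre k 𝔞 = Subalgebra.toSubmodule (invariants k 𝔞))
    {ρ : 𝔞 →ₗ[k] Module.End k (n → k)} {π : Module.End k (n → k) →ₗ[k] 𝔞}
    (hρ : ∀ x y, ρ ⁅x, y⁆ = ρ x * ρ y - ρ y * ρ x) (hπ : ∀ x, π (ρ x) = x)
    {G : Subgroup (LinearMap.GeneralLinearGroup k (n → k))} (hG : Set.range ρ = lieOfGroup G)
    (κ : GroupModel k 𝔞 n →ₐ[k] L) (hκ : ∀ f, κ f = 0 ↔ f ∈ modelIdeal ρ)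
    (hL : ∀ f, algebraMap (SymmetricAlgebra k 𝔞) L f = κ (modelPoint f))
    {ι' : Type*} [Fintype ι'] {s : ι' → SymmetricAlgebra k 𝔞}
    (hs : AlgebraicIndependent (invariants k 𝔞) s)
    {κ' : Type*} [Fintype κ'] (X : Module.Basis κ' k 𝔞) :
    Fintype.card ι' ≤ (Matrix.of fun i j =>
      algebraMap (SymmetricAlgebra k 𝔞) L (ι k 𝔞 ⁅X i, X j⁆)).rank := by
  classical
  have : CharZero L := charZero_of_injective_algebraMap (algebraMap k L).injective
  have : IsScalarTower k (SymmetricAlgebra k 𝔞) L := IsScalarTower.of_algebraMap_eq fun r => by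
    rw [hL, AlgHom.commutes, AlgHom.commutes]
  -- These derivations kill all functions of the base point, so they move only the group element.
  obtain ⟨δ, hδ⟩ := AlgebraicIndependent.exists_dual_derivations
    (algebraicIndependent_modelOrbit hSy hρ hπ κ hκ hL hs)
  set H := (modelElement k 𝔞 n).map κ with hHdef
  set H' := (modelInverse k 𝔞 n).map κ with hH'def
  have hH : H' * H = 1 := by
    rw [hHdef, hH'def, ← Matrix.map_mul, ← sub_eq_zero]
    ext i j
    have := (hκ _).2 (modelInverse_mul_modelElement_mem ρ i j)
    rw [Matrix.sub_apply, map_sub] at this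
    rw [Matrix.sub_apply, Matrix.map_apply, Matrix.zero_apply, ← this]
    congr 1
    by_cases h : i = j
    · subst h
      simp
    · simp [h]
  have hspan : ∀ y, ρ y ∈ Submodule.span k (Set.range fun l => ρ (X l)) := by
    intro y
    rw [← X.sum_repr y, map_sum]
    refine sum_mem fun l _ => ?_
    rw [map_smul]
    exact Submodule.smul_mem _ _ (Submodule.subset_span ⟨l, rfl⟩)
  have hρG : ∀ x, ρ x ∈ lieOfGroup G := fun x => hG ▸ Set.mem_range_self x
  have hm : ∀ β, ∃ c : κ' → L, H' * H.map (δ β) = ∑ l, c l • constMatrix k L (ρ (X l)) := by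
    intro β
    refine exists_combination_of_forms (tangentForm '' groupIdeal G) _ ?_ _ ?_
    · rintro _ ⟨q, hq, rfl⟩
      refine tangentForm_logDerivative G ((δ β).restrictScalars k) hH (fun p hp => ?_)
        (fun p hp => ?_) hq
      · rw [hHdef, ← map_matrixPoint, hκ]
        exact matrixPoint_modelElement_mem ρ hρG hp
      · rw [hH'def, ← map_matrixPoint, hκ]
        exact matrixPoint_modelInverse_mem ρ hρG hp
    · intro u hu
      have : u ∈ lieOfGroup G := mem_lieOfGroup.2 fun q hq => hu _ ⟨q, hq, rfl⟩
      rw [← hG] at this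
      obtain ⟨y, rfl⟩ := this
      exact hspan y
  have hconj : ∀ x, (modelConj ρ x).map κ = H' * constMatrix k L (ρ x) * H := by
    intro x
    rw [modelConj, Matrix.map_mul, Matrix.map_mul]
    congr 2
    ext i j
    simp [constMatrix]
  have hx : ∀ i, ∃ M : κ' → L, H' * constMatrix k L (ρ (X i)) * H =
      ∑ l, M l • constMatrix k L (ρ (X l)) := by
    intro i
    refine exists_combination_of_forms {φ | ∀ y, φ (ρ y) = 0} _ ?_ _ ?_
    · intro φ hφ
      rw [← matrixPoint_ι, ← hconj, ← map_matrixPoint, hκ]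
      exact matrixPoint_modelConj_mem ρ hρ _ hφ
    · intro u hu
      have : u ∈ LinearMap.range ρ := by
        by_contra hcon
        obtain ⟨φ, hφu, hφ⟩ := Submodule.exists_le_ker_of_notMem hcon
        exact hφu (hu φ fun y => hφ (LinearMap.mem_range_self ρ y))
      obtain ⟨y, rfl⟩ := this
      exact hspan y
  choose c hc using hm
  choose M hM using hx
  set Ω : Matrix κ' κ' L := Matrix.of fun i j =>
    algebraMap (SymmetricAlgebra k 𝔞) L (ι k 𝔞 ⁅X i, X j⁆) with hΩ
  have hD : ∀ β i, δ β (κ (modelOrbit ρ π (ι k 𝔞 (X i)))) =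
      (Matrix.of M * Ω * (Matrix.of c).transpose) i β := by
    intro β i
    rw [modelOrbit_ι, map_vectorPairing, hconj]
    refine (derivation_vectorPairing (κ.comp modelPoint) hρ hπ ((δ β).restrictScalars k)
      (fun f => ?_) hH (hc β) (hM i)).trans ?_
    · change δ β (κ (modelPoint f)) = 0
      rw [← hL, Derivation.map_algebraMap]
    · simp only [Matrix.mul_apply, Matrix.transpose_apply, Matrix.of_apply, Finset.sum_mul, hΩ, hL]
      rw [Finset.sum_comm]
      rfl
  -- A combination of the `δ β` killing the moved coordinates kills every moved function, in
  -- particular all moved `s γ`; duality then gives zero coefficients.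
  have hinj : Function.Injective (Matrix.of M * Ω * (Matrix.of c).transpose).mulVecLin := by
    rw [injective_iff_map_eq_zero]
    intro v hv
    let d : Derivation k L L := ∑ β, v β • (δ β).restrictScalars k
    have hd : ∀ f, d f = ∑ β, v β * δ β f := by
      intro f
      exact (congrFun (map_sum (Derivation.coeFnAddMonoidHom (R := k) (A := L) (M := L)) _ _)
        f).trans (Finset.sum_apply _ _ _)
    have hd0 : ∀ f, d (κ (modelOrbit ρ π f)) = 0 := by
      intro f
      refine leibniz_ext (κ.comp (modelOrbit ρ π))
        (d.toLinearMap ∘ₗ (κ.comp (modelOrbit ρ π)).toLinearMap) 0 ?_ ?_ ?_ f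
      · intro f g
        simp [Derivation.leibniz]
      · simp
      · intro x
        rw [LinearMap.zero_apply, ← X.sum_repr x, map_sum, map_sum]
        refine Finset.sum_eq_zero fun i _ => ?_
        rw [map_smul, map_smul]
        have h1 := congrFun hv i
        simp only [Matrix.mulVecLin_apply, Matrix.mulVec, dotProduct, ← hD] at h1
        have h2 : d (κ (modelOrbit ρ π (ι k 𝔞 (X i)))) = 0 := by
          rw [hd]
          exact (Finset.sum_congr rfl fun β _ => mul_comm _ _).trans h1
        change _ • d (κ (modelOrbit ρ π (ι k 𝔞 (X i)))) = 0
        rw [h2, smul_zero]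
    funext γ
    have := hd0 (s γ)
    rw [hd] at this
    simpa [hδ] using this
  calc Fintype.card ι' = (Matrix.of M * Ω * (Matrix.of c).transpose).rank := by
        rw [Matrix.rank, LinearMap.finrank_range_of_inj hinj, Module.finrank_fintype_fun_eq_card]
    _ ≤ (Matrix.of M * Ω).rank := Matrix.rank_mul_le_left _ _
    _ ≤ Ω.rank := Matrix.rank_mul_le_right _ _

end Rosenlicht

/-! ### The rank bound for an algebraic Lie algebra. -/

section Algebraic

attribute [local instance] LieRing.ofAssociativeRing LieAlgebra.ofAssociativeAlgebra

/-- The number of algebraically independent functions over the invariants of an algebraic Lie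
algebra is at most the generic rank of the commutator matrix. -/
theorem exists_card_le_rank.{u, v, w, x} {k : Type u} {𝔞 : Type v} [Field k]
    [LieRing 𝔞] [LieAlgebra k 𝔞] [FiniteDimensional k 𝔞] [CharZero k] (h𝔞 : IsAlgebraic k 𝔞)
    (hSy : poissonSemicentre k 𝔞 = Subalgebra.toSubmodule (invariants k 𝔞))
    {ι' : Type w} [Fintype ι'] {s : ι' → SymmetricAlgebra k 𝔞}
    (hs : AlgebraicIndependent (invariants k 𝔞) s)
    {κ' : Type x} [Fintype κ'] (X : Module.Basis κ' k 𝔞) :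
    ∃ (L : Type (max u v)) (_ : Field L) (_ : Algebra (SymmetricAlgebra k 𝔞) L),
      Function.Injective (algebraMap (SymmetricAlgebra k 𝔞) L) ∧
      Fintype.card ι' ≤ (Matrix.of fun i j =>
        algebraMap (SymmetricAlgebra k 𝔞) L (ι k 𝔞 ⁅X i, X j⁆)).rank := by
  obtain ⟨N, G, ρ, -, hinj, hG⟩ := h𝔞
  obtain ⟨π, hπ⟩ := LinearMap.exists_leftInverse_of_injective (ρ : 𝔞 →ₗ[k] Module.End k (Fin N → k))
    (LinearMap.ker_eq_bot.2 hinj)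
  let ρ' : 𝔞 →ₗ[k] Module.End k (Fin N → k) := ρ
  let L := FractionRing (GroupModel k 𝔞 (Fin N) ⧸ modelIdeal ρ')
  let κ : GroupModel k 𝔞 (Fin N) →ₐ[k] L :=
    (IsScalarTower.toAlgHom k (GroupModel k 𝔞 (Fin N) ⧸ modelIdeal ρ') L).comp
      (Ideal.Quotient.mkₐ k _)
  have hκ : ∀ f, κ f = 0 ↔ f ∈ modelIdeal ρ' := by
    intro f
    rw [← Ideal.Quotient.eq_zero_iff_mem]
    exact IsFractionRing.to_map_eq_zero_iff (R := GroupModel k 𝔞 (Fin N) ⧸ modelIdeal ρ') (K := L)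
  let _ : Algebra (SymmetricAlgebra k 𝔞) L := (κ.comp modelPoint).toRingHom.toAlgebra
  refine ⟨L, inferInstance, inferInstance, ?_, card_le_rank_of_model hSy (ρ := ρ') ?_
    (fun x => LinearMap.congr_fun hπ x) hG κ hκ (fun _ => rfl) hs X⟩
  · rw [injective_iff_map_eq_zero]
    intro f hf
    have : modelPoint f ∈ modelIdeal ρ' := (hκ _).1 hf
    rw [← modelCounit_modelPoint (n := Fin N) f, modelCounit_eq_zero ρ' this]
  · intro x y
    change ρ ⁅x, y⁆ = _
    rw [LieHom.map_lie, LieRing.of_associative_ring_bracket]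
    rfl

end Algebraic

end CoadjointSlice

namespace CoadjointSlice

open SymmetricAlgebra

/-! ## Determinants, ranks and transcendence degrees -/

section Determinants

variable {k R n : Type*} [Field k] [CommRing R] [Algebra k R] [Fintype n] [DecidableEq n]

/-- Jacobi's formula for a derivation. -/
theorem derivation_det (D : Derivation k R R) (M : Matrix n n R) :
    D M.det = (M.adjugate * M.map D).trace := by
  have h1 : (M.adjugate * M.map D).trace =
      ∑ i, (M.updateCol i fun j => D (M j i)).det := by
    rw [Matrix.trace]
    refine Finset.sum_congr rfl fun i _ => ?_
    rw [← Matrix.cramer_apply, Matrix.cramer_eq_adjugate_mulVec]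
    rfl
  have h2 : ∀ (f : n → R), D (∏ i, f i) = ∑ i, ∏ j, Function.update f i (D (f i)) j := by
    intro f
    have h3 : ∀ s : Finset n, D (∏ i ∈ s, f i) =
        ∑ i ∈ s, ∏ j ∈ s, Function.update f i (D (f i)) j := by
      intro s
      induction s using Finset.induction_on with
      | empty => simp
      | insert a s ha ih =>
        rw [Finset.prod_insert ha, Derivation.leibniz, ih, Finset.sum_insert ha,
          Finset.prod_insert ha, Function.update_self, smul_eq_mul, smul_eq_mul, add_comm,
          Finset.mul_sum]
        congr 1
        · rw [mul_comm]
          congr 1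
          refine Finset.prod_congr rfl fun j hj => ?_
          rw [Function.update_of_ne (by rintro rfl; exact ha hj)]
        · refine Finset.sum_congr rfl fun i hi => ?_
          rw [Finset.prod_insert ha, Function.update_of_ne (by rintro rfl; exact ha hi)]
    exact h3 _
  rw [h1]
  simp only [Matrix.det_apply, map_sum]
  rw [Finset.sum_comm]
  refine Finset.sum_congr rfl fun σ _ => ?_
  rw [← Finset.smul_sum, Units.smul_def, map_zsmul, Units.smul_def, h2]
  congr 1
  refine Finset.sum_congr rfl fun i _ => Finset.prod_congr rfl fun j _ => ?_
  by_cases h : j = i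
  · subst h
    simp
  · simp [h]

/-- Jacobi's formula and `M · adj M = det M`: conjugation under the trace turns each side factor
into its trace times `det M`. -/
theorem derivation_det_of_commutator (D : Derivation k R R) {M N N' : Matrix n n R} {b : R}
    (h : b • M.map D = N * M + M * N') : b * D M.det = (N.trace + N'.trace) * M.det := by
  rw [derivation_det, ← smul_eq_mul, ← Matrix.trace_smul, ← Matrix.mul_smul, h, mul_add,
    Matrix.trace_add, ← mul_assoc, ← mul_assoc, Matrix.trace_mul_comm, ← mul_assoc,
    Matrix.mul_adjugate, Matrix.adjugate_mul]
  simp only [Matrix.smul_mul, one_mul, Matrix.trace_smul, smul_eq_mul]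
  ring

end Determinants

/-! ### Semicontinuity of the rank. -/

section Rank

/-- The rank of a specialization is at most the generic rank. -/
theorem rank_map_le {k S L m n : Type*} [Field k] [CommRing S] [Algebra k S] [Field L]
    [Fintype m] [Fintype n] (φ : S →ₐ[k] k) (ψ : S →+* L) (hψ : Function.Injective ψ)
    (M : Matrix m n S) : (M.map φ).rank ≤ (M.map ψ).rank := by
  classical
  set N := (M.map φ).rank with hN
  let f := (M.map φ).mulVecLin
  obtain ⟨w, hw⟩ : ∃ w : Fin N → LinearMap.range f, LinearIndependent k w :=
    ⟨Module.finBasis k (LinearMap.range f), Module.Basis.linearIndependent _⟩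
  choose q hq using fun i => (w i).2
  have hw' : LinearIndependent k (fun i => (w i : m → k)) := hw.map' _ (Submodule.ker_subtype _)
  obtain ⟨p, hp⟩ := LinearMap.exists_leftInverse_of_injective (Fintype.linearCombination k
    (fun i => (w i : m → k))) (LinearMap.ker_eq_bot.2 hw'.fintypeLinearCombination_injective)
  have hpw : ∀ j, p (w j) = Pi.single j 1 := by
    intro j
    have := LinearMap.congr_fun hp (Pi.single j 1)
    simpa [Fintype.linearCombination_apply_single] using this
  let P : Matrix (Fin N) m k := LinearMap.toMatrix' p
  let Q : Matrix n (Fin N) k := Matrix.of fun i j => q j i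
  -- `Q` selects preimages of a basis of the image and `P` reads coordinates in it. The same
  -- constant matrices applied to `M` give a square matrix whose determinant specializes to `1`,
  -- hence is nonzero generically.
  have hPQ : P * (M.map φ) * Q = 1 := by
    ext i j
    have h1 : (M.map φ * Q).col j = w j := by
      rw [← hq]
      rfl
    have h2 : (P * (M.map φ * Q)) i j = (P.mulVec ((M.map φ * Q).col j)) i := rfl
    rw [Matrix.mul_assoc]
    refine h2.trans ?_
    rw [h1, LinearMap.toMatrix'_mulVec, hpw, Matrix.one_apply, Pi.single_apply]
  let M' : Matrix (Fin N) (Fin N) S := P.map (algebraMap k S) * M * Q.map (algebraMap k S)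
  have hM' : M'.map φ = 1 := by
    rw [← hPQ, Matrix.map_mul, Matrix.map_mul]
    congr 2 <;> ext i j <;> simp
  have hdet : M'.det ≠ 0 := by
    intro h
    have := AlgHom.map_det φ M'
    rw [h, map_zero, AlgHom.mapMatrix_apply, hM', Matrix.det_one] at this
    exact zero_ne_one this
  have hunit : IsUnit (M'.map ψ) := by
    rw [Matrix.isUnit_iff_isUnit_det, isUnit_iff_ne_zero]
    change (ψ.mapMatrix M').det ≠ 0
    rw [← RingHom.map_det]
    exact (map_ne_zero_iff ψ hψ).2 hdet
  calc N = (M'.map ψ).rank := by rw [Matrix.rank_of_isUnit _ hunit, Fintype.card_fin]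
    _ ≤ ((P.map (algebraMap k S) * M).map ψ).rank := by
      rw [Matrix.map_mul]
      exact Matrix.rank_mul_le_left _ _
    _ ≤ (M.map ψ).rank := by
      rw [Matrix.map_mul]
      exact Matrix.rank_mul_le_right _ _

end Rank

/-! ### Transcendence degree over a subalgebra with few generators. -/

section Trdeg

open Cardinal

variable {k A : Type*} [Field k] [CommRing A] [IsDomain A] [Algebra k A]

/-- A subalgebra generated by few elements leaves room for many algebraically independent
elements over it. -/
theorem exists_algebraicIndependent_of_le_adjoin {ι₁ ι₂ : Type*} [Fintype ι₁] [Fintype ι₂]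
    (e : MvPolynomial (ι₁ ⊕ ι₂) k ≃ₐ[k] A) (Y : Subalgebra k A) (f : ι₁ → A)
    (hf : ∀ i, f i ∈ Y) (hY : Y ≤ Algebra.adjoin k (Set.range f)) :
    ∃ s : ι₂ → A, AlgebraicIndependent Y s := by
  have h1 : Algebra.trdeg k Y ≤ Fintype.card ι₁ := by
    let F : MvPolynomial ι₁ k →ₐ[k] Y := MvPolynomial.aeval fun i => ⟨f i, hf i⟩
    have hF : Function.Surjective F := by
      rintro ⟨y, hy⟩
      have h2 := hY hy
      rw [Algebra.adjoin_range_eq_range_aeval] at h2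
      obtain ⟨P, rfl⟩ := h2
      refine ⟨P, Subtype.ext ?_⟩
      change Y.val (F P) = _
      rw [← AlgHom.comp_apply, MvPolynomial.comp_aeval]
      rfl
    have h3 := lift_trdeg_le_of_surjective F hF
    rw [MvPolynomial.trdeg_of_isDomain] at h3
    simpa using h3
  have h2 : Algebra.trdeg k A = Fintype.card ι₁ + Fintype.card ι₂ := by
    have h3 := e.lift_trdeg_eq
    rw [MvPolynomial.trdeg_of_isDomain] at h3
    simp only [Cardinal.mk_fintype, Cardinal.lift_natCast, Fintype.card_sum] at h3
    rw [← Nat.cast_add]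
    exact Cardinal.lift_eq_nat_iff.1 h3.symm
  have h3 := trdeg_add_eq k Y (A := A)
  obtain ⟨s, hs⟩ := exists_isTranscendenceBasis Y A
  -- Additivity of transcendence degrees: the total is `|ι₁| + |ι₂|`, of which `Y` accounts for at
  -- most `|ι₁|`.
  have h4 : (Fintype.card ι₂ : Cardinal) ≤ #s := by
    rw [hs.cardinalMk_eq_trdeg]
    by_contra! hlt
    obtain ⟨a, ha⟩ := Cardinal.lt_aleph0.1 (hlt.trans (Cardinal.natCast_lt_aleph0))
    obtain ⟨b, hb⟩ := Cardinal.lt_aleph0.1 (h1.trans_lt (Cardinal.natCast_lt_aleph0))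
    rw [ha] at hlt h3
    rw [hb] at h1 h3
    rw [h2] at h3
    norm_cast at h1 h3 hlt
    omega
  have h5 : Nonempty (ι₂ ↪ s) := by
    rw [← Cardinal.lift_mk_le', Cardinal.mk_fintype]
    simpa using h4
  obtain ⟨g⟩ := h5
  exact ⟨_, hs.1.comp g g.injective⟩

end Trdeg

end CoadjointSlice

namespace CoadjointSlice

open SymmetricAlgebra

/-! ## Regular elements -/

section Blocks

variable {κ l : Type*} [Fintype κ] [Fintype l]

theorem submatrix_mul_sum {R m n m' n' : Type*} [CommRing R] (M : Matrix m (κ ⊕ l) R)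
    (N : Matrix (κ ⊕ l) n R) (r : m' → m) (c : n' → n) :
    (M * N).submatrix r c = M.submatrix r Sum.inl * N.submatrix Sum.inl c +
      M.submatrix r Sum.inr * N.submatrix Sum.inr c := by
  ext i j
  simp [Matrix.mul_apply, Fintype.sum_sum_type]

variable [DecidableEq κ]

/-- Cramer's rule: multiplying the block equation by the adjugate expresses the upper rows of `N`
through the lower ones, up to the minor. -/
theorem det_smul_submatrix_inl {R n : Type*} [CommRing R] {B : Matrix κ (κ ⊕ l) R}
    {N : Matrix (κ ⊕ l) n R} (h : B * N = 0) :
    (B.submatrix id Sum.inl).det • N.submatrix Sum.inl id =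
      -((B.submatrix id Sum.inl).adjugate * B.submatrix id Sum.inr * N.submatrix Sum.inr id) := by
  have h1 := submatrix_mul_sum B N id id
  rw [h] at h1
  have h2 := congrArg (fun M => (B.submatrix id Sum.inl).adjugate * M) h1
  simp only [Matrix.submatrix_zero, Pi.zero_apply, Matrix.mul_zero, Matrix.mul_add,
    ← Matrix.mul_assoc, Matrix.adjugate_mul, Matrix.smul_mul, Matrix.one_mul] at h2
  exact eq_neg_of_add_eq_zero_left h2.symm

variable [DecidableEq l]

theorem rank_le_rank_submatrix_inr {L n : Type*} [Field L] [Fintype n] {B : Matrix κ (κ ⊕ l) L}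
    {N : Matrix (κ ⊕ l) n L} (h : B * N = 0) (hB : (B.submatrix id Sum.inl).det ≠ 0) :
    N.rank ≤ (N.submatrix Sum.inr id).rank := by
  have h1 : N = (Matrix.fromRows (-((B.submatrix id Sum.inl).det⁻¹ •
      ((B.submatrix id Sum.inl).adjugate * B.submatrix id Sum.inr))) 1) *
        N.submatrix Sum.inr id := by
    rw [Matrix.fromRows_mul, Matrix.one_mul, Matrix.neg_mul, Matrix.smul_mul, ← smul_neg,
      ← det_smul_submatrix_inl h, smul_smul, inv_mul_cancel₀ hB, one_smul]
    ext (i | i) j <;> rfl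
  calc N.rank = _ := congrArg Matrix.rank h1
    _ ≤ _ := Matrix.rank_mul_le_right _ _

/-- The left kernel eliminates the first rows; by skewness the same kernel eliminates the first
columns. -/
theorem rank_le_rank_toBlocks₂₂ {L : Type*} [Field L] {B : Matrix κ (κ ⊕ l) L}
    {Ω : Matrix (κ ⊕ l) (κ ⊕ l) L} (h : B * Ω = 0) (hΩ : Ω.transpose = -Ω)
    (hB : (B.submatrix id Sum.inl).det ≠ 0) : Ω.rank ≤ (Ω.submatrix Sum.inr Sum.inr).rank := by
  have h1 : B * (Ω.submatrix Sum.inr id).transpose = 0 := by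
    have : (Ω.submatrix Sum.inr id).transpose = (-Ω).submatrix id (Sum.inr : l → κ ⊕ l) := by
      rw [← hΩ]
      rfl
    rw [this]
    ext i j
    have := congrFun (congrFun h i) (Sum.inr j)
    simp only [Matrix.mul_apply, Matrix.submatrix_apply, Matrix.neg_apply, mul_neg,
      Finset.sum_neg_distrib, id_eq, Matrix.zero_apply] at this ⊢
    rw [this, neg_zero]
  calc Ω.rank ≤ (Ω.submatrix (Sum.inr : l → κ ⊕ l) id).rank := rank_le_rank_submatrix_inr h hB
    _ = (Ω.submatrix (Sum.inr : l → κ ⊕ l) id).transpose.rank := (Matrix.rank_transpose _).symm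
    _ ≤ ((Ω.submatrix (Sum.inr : l → κ ⊕ l) id).transpose.submatrix Sum.inr id).rank :=
      rank_le_rank_submatrix_inr h1 hB
    _ = (Ω.submatrix Sum.inr Sum.inr).transpose.rank := rfl
    _ = _ := Matrix.rank_transpose _

/-- The logarithmic derivative of a diagonal minor of a skew matrix with a given left kernel. -/
theorem derivation_det_toBlocks₂₂ {k R : Type*} [Field k] [CommRing R] [Algebra k R]
    (D : Derivation k R R) {B : Matrix κ (κ ⊕ l) R} {Ω A : Matrix (κ ⊕ l) (κ ⊕ l) R}
    (h : B * Ω = 0) (hΩ : Ω.transpose = -Ω) (hDΩ : Ω.map D = A * Ω + Ω * A.transpose)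
    (hDB : B.map D = -(B * A)) :
    (B.submatrix id Sum.inl).det * D (Ω.submatrix Sum.inr Sum.inr).det =
      (Ω.submatrix Sum.inr Sum.inr).det *
        (2 * D (B.submatrix id Sum.inl).det + 2 * A.trace * (B.submatrix id Sum.inl).det) := by
  set b := (B.submatrix id Sum.inl).det with hb
  set T := (B.submatrix id Sum.inl).adjugate * B.submatrix id Sum.inr with hT
  set A11 := A.submatrix Sum.inl Sum.inl with hA11
  set A21 := A.submatrix Sum.inr Sum.inl with hA21
  set A22 := A.submatrix Sum.inr Sum.inr with hA22
  set Ω' := Ω.submatrix Sum.inr Sum.inr with hΩ'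
  have hΩ12 : b • Ω.submatrix Sum.inl Sum.inr = -(T * Ω') :=
    congrArg (fun M => M.submatrix id Sum.inr) (det_smul_submatrix_inl h)
  have hΩ't : Ω'.transpose = -Ω' :=
    congrArg (fun M => M.submatrix Sum.inr Sum.inr) hΩ
  have hΩ21 : b • Ω.submatrix Sum.inr Sum.inl = -(Ω' * T.transpose) := by
    have h1 : Ω.submatrix Sum.inr Sum.inl = -(Ω.submatrix Sum.inl Sum.inr).transpose := by
      have : (Ω.submatrix Sum.inl Sum.inr).transpose =
          Ω.transpose.submatrix (Sum.inr : l → κ ⊕ l) (Sum.inl : κ → κ ⊕ l) := rfl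
      rw [this, hΩ]
      ext i j
      simp
    rw [h1, smul_neg, ← Matrix.transpose_smul, hΩ12, Matrix.transpose_neg, Matrix.transpose_mul,
      hΩ't, Matrix.neg_mul, neg_neg]
  -- The off-diagonal blocks of `Ω` are multiples of `Ω'` after scaling by `b`, so the lower block
  -- obeys an equation of the same shape with matrix `b A₂₂ - A₂₁ T`.
  have hN : b • Ω'.map D = (b • A22 - A21 * T) * Ω' + Ω' * (b • A22 - A21 * T).transpose := by
    have h1 : Ω'.map D = A21 * Ω.submatrix Sum.inl Sum.inr + A22 * Ω' +
        (Ω.submatrix Sum.inr Sum.inl * A21.transpose + Ω' * A22.transpose) := by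
      have := congrArg (fun M => M.submatrix (Sum.inr : l → κ ⊕ l) (Sum.inr : l → κ ⊕ l)) hDΩ
      refine Eq.trans this ?_
      change (A * Ω).submatrix Sum.inr Sum.inr + (Ω * A.transpose).submatrix Sum.inr Sum.inr = _
      rw [submatrix_mul_sum, submatrix_mul_sum]
      rfl
    rw [h1, smul_add, smul_add, smul_add, ← Matrix.mul_smul, hΩ12, ← Matrix.smul_mul b
      (Ω.submatrix Sum.inr Sum.inl), hΩ21, Matrix.transpose_sub, Matrix.transpose_smul,
      Matrix.transpose_mul A21 T]
    simp only [Matrix.sub_mul, Matrix.mul_sub, Matrix.smul_mul, Matrix.mul_smul, Matrix.mul_neg,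
      Matrix.neg_mul, Matrix.mul_assoc]
    abel
  -- This expresses the unknown trace of `A₂₁ T` by `D b`; together with `b tr A₂₂` it restores the
  -- full trace of `A`.
  have hDb : D b = -(b * A11.trace) - (A21 * T).trace := by
    have h1 : (B.submatrix id Sum.inl).map D =
        -(B.submatrix id Sum.inl * A11 + B.submatrix id Sum.inr * A21) := by
      have := congrArg (fun M => M.submatrix id (Sum.inl : κ → κ ⊕ l)) hDB
      refine Eq.trans this ?_
      change -((B * A).submatrix id Sum.inl) = _
      rw [submatrix_mul_sum]
    rw [hb, derivation_det, h1, Matrix.mul_neg, Matrix.mul_add, ← Matrix.mul_assoc,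
      ← Matrix.mul_assoc, Matrix.adjugate_mul, Matrix.smul_mul, Matrix.one_mul, Matrix.trace_neg,
      Matrix.trace_add, Matrix.trace_smul, Matrix.trace_mul_comm A21 T, smul_eq_mul, neg_add,
      sub_eq_add_neg]
  have hA : A.trace = A11.trace + A22.trace := by
    simp [Matrix.trace, Fintype.sum_sum_type, hA11, hA22]
  rw [derivation_det_of_commutator D hN, Matrix.trace_transpose, Matrix.trace_sub,
    Matrix.trace_smul, hDb, hA, smul_eq_mul]
  ring

end Blocks

/-! ### Commutator and Jacobian matrices. -/

section Jacobian

variable {k 𝔞 σ : Type*} [Field k] [LieRing 𝔞] [LieAlgebra k 𝔞]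
  (X : Module.Basis σ k 𝔞)

/-- The matrix of commutators of the elements of a basis. -/
noncomputable def commutatorMatrix : Matrix σ σ (SymmetricAlgebra k 𝔞) :=
  Matrix.of fun i j => ι k 𝔞 ⁅X i, X j⁆

/-- The Jacobian matrix of a family of polynomial functions. -/
noncomputable def jacobianMatrix {κ : Type*} (f : κ → SymmetricAlgebra k 𝔞) :
    Matrix κ σ (SymmetricAlgebra k 𝔞) :=
  Matrix.of fun a j => partialDerivative (X.coord j) (f a)

/-- The matrix of `ad x`. -/
noncomputable def adjointMatrix (x : 𝔞) : Matrix σ σ (SymmetricAlgebra k 𝔞) :=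
  Matrix.of fun i j => algebraMap k _ (X.coord j ⁅x, X i⁆)

theorem transpose_commutatorMatrix :
    (commutatorMatrix X).transpose = -commutatorMatrix X := by
  ext i j
  rw [Matrix.transpose_apply, Matrix.neg_apply, commutatorMatrix, Matrix.of_apply, Matrix.of_apply,
    ← lie_skew, map_neg]

variable [Fintype σ]

theorem ι_eq_sum_coord (y : 𝔞) :
    ι k 𝔞 y = ∑ j, algebraMap k (SymmetricAlgebra k 𝔞) (X.coord j y) * ι k 𝔞 (X j) := by
  conv_lhs => rw [← X.sum_repr y, map_sum]
  refine Finset.sum_congr rfl fun j _ => ?_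
  rw [map_smul, Algebra.smul_def, X.coord_apply]

theorem map_symAd_commutatorMatrix (x : 𝔞) :
    (commutatorMatrix X).map (symAd x) = adjointMatrix X x * commutatorMatrix X +
      commutatorMatrix X * (adjointMatrix X x).transpose := by
  ext i j
  have h1 : ∀ y z : 𝔞, ι k 𝔞 ⁅y, z⁆ =
      ∑ l, algebraMap k (SymmetricAlgebra k 𝔞) (X.coord l y) * ι k 𝔞 ⁅X l, z⁆ := by
    intro y z
    conv_lhs => rw [← X.sum_repr y, sum_lie, map_sum]
    refine Finset.sum_congr rfl fun l _ => ?_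
    rw [smul_lie, map_smul, Algebra.smul_def, X.coord_apply]
  have h2 : ∀ y z : 𝔞, ι k 𝔞 ⁅y, z⁆ =
      ∑ l, ι k 𝔞 ⁅y, X l⁆ * algebraMap k (SymmetricAlgebra k 𝔞) (X.coord l z) := by
    intro y z
    conv_lhs => rw [← X.sum_repr z, lie_sum, map_sum]
    refine Finset.sum_congr rfl fun l _ => ?_
    rw [lie_smul, map_smul, Algebra.smul_def, X.coord_apply, mul_comm]
  rw [Matrix.map_apply, commutatorMatrix, Matrix.of_apply, symAd_ι, leibniz_lie, map_add,
    Matrix.add_apply, Matrix.mul_apply, Matrix.mul_apply, h1, h2 (X i)]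
  rfl

theorem derivation_eq_sum_partialDerivative
    (D : Derivation k (SymmetricAlgebra k 𝔞) (SymmetricAlgebra k 𝔞)) (f : SymmetricAlgebra k 𝔞) :
    D f = ∑ j, D (ι k 𝔞 (X j)) * partialDerivative (X.coord j) f := by
  have h : ∀ g, (∑ j, D (ι k 𝔞 (X j)) • partialDerivative (X.coord j)) g =
      ∑ j, D (ι k 𝔞 (X j)) * partialDerivative (X.coord j) g := fun g =>
    (congrFun (map_sum (Derivation.coeFnAddMonoidHom (R := k) (A := SymmetricAlgebra k 𝔞)
      (M := SymmetricAlgebra k 𝔞)) _ _) g).trans (Finset.sum_apply _ _ _)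
  rw [← h]
  congr 1
  refine derivation_ext fun m => ?_
  rw [h, ι_eq_sum_coord X m, map_sum]
  refine Finset.sum_congr rfl fun j _ => ?_
  rw [← ι_eq_sum_coord X m, Derivation.leibniz, Derivation.map_algebraMap, smul_zero, add_zero,
    partialDerivative_ι, smul_eq_mul, mul_comm]

/-- By the chain rule, the product entries are, up to sign, the derivatives of the `f a` along the
basis of `𝔞`. -/
theorem jacobianMatrix_mul_commutatorMatrix {κ : Type*} {f : κ → SymmetricAlgebra k 𝔞}
    (hf : ∀ a, ∀ x : 𝔞, symAd x (f a) = 0) : jacobianMatrix X f * commutatorMatrix X = 0 := by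
  ext a i
  have h1 := derivation_eq_sum_partialDerivative X (symAd (X i)) (f a)
  rw [hf] at h1
  rw [Matrix.mul_apply, Matrix.zero_apply, ← neg_zero, h1, ← Finset.sum_neg_distrib]
  refine Finset.sum_congr rfl fun j _ => ?_
  rw [jacobianMatrix, commutatorMatrix, Matrix.of_apply, Matrix.of_apply, symAd_ι, ← lie_skew,
    map_neg, mul_neg, mul_comm]

/-- As `f` is annihilated, only the commutator of the constant and adjoint vector fields survives;
it is a constant field with coefficients from `ad x`. -/
theorem map_symAd_jacobianMatrix {κ : Type*} {f : κ → SymmetricAlgebra k 𝔞}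
    (hf : ∀ a, ∀ x : 𝔞, symAd x (f a) = 0) (x : 𝔞) :
    (jacobianMatrix X f).map (symAd x) = -(jacobianMatrix X f * adjointMatrix X x) := by
  ext a j
  rw [Matrix.map_apply, jacobianMatrix, Matrix.of_apply, symAd_partialDerivative, hf, map_zero,
    zero_add, Matrix.neg_apply, Matrix.mul_apply, derivation_eq_sum_partialDerivative X,
    ← Finset.sum_neg_distrib]
  refine Finset.sum_congr rfl fun i _ => ?_
  rw [partialDerivative_ι, infinitesimalAction_apply, map_neg, neg_mul, mul_comm]
  rfl

/-- Rank–nullity: the commutator matrix evaluated at `ζ` is the matrix of `x ↦ x·ζ` in the basis and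
its dual basis. -/
theorem finrank_stabilizer_add_rank [DecidableEq σ] (ζ : Module.Dual k 𝔞) :
    Module.finrank k (stabilizer ζ) + ((commutatorMatrix X).map (evalAt ζ)).rank =
      Fintype.card σ := by
  have : FiniteDimensional k 𝔞 := .of_basis X
  have h1 : (commutatorMatrix X).map (evalAt ζ) =
      LinearMap.toMatrix X X.dualBasis (infinitesimalAction ζ) := by
    ext i j
    rw [LinearMap.toMatrix_apply, Module.Basis.dualBasis_repr, infinitesimalAction_apply,
      Matrix.map_apply, commutatorMatrix, Matrix.of_apply, evalAt_ι, ← lie_skew, map_neg]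
  rw [h1, Matrix.rank_eq_finrank_range_toLin _ X.dualBasis X, Matrix.toLin_toMatrix, add_comm,
    ← Module.finrank_eq_card_basis X]
  exact LinearMap.finrank_range_add_finrank_ker _

end Jacobian

section Adapted

variable {k M : Type*} [Field k] [AddCommGroup M] [Module k M] [FiniteDimensional k M]

/-- A basis adapted to a subspace of the dual space. -/
theorem exists_basis_adapted (V : Submodule k (Module.Dual k M)) :
    ∃ (m : ℕ) (X : Module.Basis (Fin (Module.finrank k V) ⊕ Fin m) k M),
      (∀ i, X.coord (Sum.inl i) ∈ V) ∧ ∀ v ∈ V, ∀ j, v (X (Sum.inr j)) = 0 := by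
  obtain ⟨C, hC⟩ := V.exists_isCompl
  have : Module.Free k V := Module.Free.of_divisionRing k V
  have : Module.Free k C := Module.Free.of_divisionRing k C
  let B := ((Module.finBasis k V).prod (Module.finBasis k C)).map
    (Submodule.prodEquivOfIsCompl V C hC)
  -- The basis of `M` whose dual basis is `B`, where `B` begins with a basis of `V`.
  let X := B.dualBasis.map (Module.evalEquiv k M).symm
  have hX : ∀ (v : Module.Dual k M) i, v (X i) = B.repr v i := by
    intro v i
    have : v (X i) = Module.evalEquiv k M (X i) v := by simp
    rw [this, Module.Basis.map_apply, LinearEquiv.apply_symm_apply, Module.Basis.dualBasis_apply]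
  have hcoord : ∀ i, X.coord i = B i := by
    intro i
    refine X.ext fun j => ?_
    rw [X.coord_apply, X.repr_self, hX, B.repr_self, Finsupp.single_apply, Finsupp.single_apply]
    simp only [eq_comm]
  refine ⟨_, X, fun i => ?_, fun v hv j => ?_⟩
  · rw [hcoord]
    simp [B]
  · rw [hX]
    have : v = Submodule.prodEquivOfIsCompl V C hC (⟨v, hv⟩, 0) := by simp
    rw [this, Module.Basis.map_repr, LinearEquiv.trans_apply, LinearEquiv.symm_apply_apply,
      Module.Basis.prod_repr_inr, map_zero, Finsupp.zero_apply]

end Adapted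

end CoadjointSlice

namespace CoadjointSlice

open SymmetricAlgebra

/-! ## Weierstrass sections contain regular elements -/

section Regular

variable {k 𝔞 : Type*} [Field k] [LieRing 𝔞] [LieAlgebra k 𝔞]

theorem det_ne_zero_of_le_rank {L n : Type*} [Field L] [Fintype n] [DecidableEq n]
    {M : Matrix n n L} (h : Fintype.card n ≤ M.rank) : M.det ≠ 0 := by
  rw [← isUnit_iff_ne_zero, ← Matrix.isUnit_iff_isUnit_det, ← Matrix.mulVec_surjective_iff_isUnit]
  refine LinearMap.range_eq_top.1 (Submodule.eq_top_of_finrank_eq (S := LinearMap.range M.mulVecLin)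
    (le_antisymm (Submodule.finrank_le _) ?_))
  rw [Module.finrank_fintype_fun_eq_card]
  exact h

/-- The invariants are generated by those which extend coordinates on a Weierstrass section. -/
theorem IsWeierstrassSection.invariants_le_adjoin {η : Module.Dual k 𝔞}
    {V : Submodule k (Module.Dual k 𝔞)} (hφ : IsWeierstrassSection η V) {κ l : Type*}
    (X : Module.Basis (κ ⊕ l) k 𝔞) (hX : ∀ v ∈ V, ∀ j, v (X (Sum.inr j)) = 0)
    {f : κ → SymmetricAlgebra k 𝔞} (hfY : ∀ i, f i ∈ invariants k 𝔞)
    (hf : ∀ i, ∀ s ∈ linearSubvariety η V, evalAt s (f i) = evalAt s (ι k 𝔞 (X (Sum.inl i)))) :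
    invariants k 𝔞 ≤ Algebra.adjoin k (Set.range f) := by
  -- `θ` replaces coordinates varying on the section by their invariant lifts and the others by
  -- their constant values at `η`. It preserves restrictions to the section, so it fixes invariants
  -- by injectivity of restriction.
  let θ : SymmetricAlgebra k 𝔞 →ₐ[k] SymmetricAlgebra k 𝔞 := SymmetricAlgebra.lift
    (X.constr k (Sum.elim f fun j => algebraMap k _ (η (X (Sum.inr j)))))
  have hadj : ∀ g, θ g ∈ Algebra.adjoin k (Set.range f) := by
    intro g
    induction g using SymmetricAlgebra.induction with
    | algebraMap r =>
      rw [AlgHom.commutes]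
      exact Subalgebra.algebraMap_mem _ r
    | ι x =>
      rw [lift_ι_apply, X.constr_apply]
      refine sum_mem fun i _ => Subalgebra.smul_mem _ ?_ _
      rcases i with i | j
      · exact Algebra.subset_adjoin ⟨i, rfl⟩
      · exact Subalgebra.algebraMap_mem _ _
    | mul a b ha hb => rw [map_mul]; exact mul_mem ha hb
    | add a b ha hb => rw [map_add]; exact add_mem ha hb
  have hY : Algebra.adjoin k (Set.range f) ≤ invariants k 𝔞 := by
    rw [Algebra.adjoin_le_iff]
    rintro _ ⟨i, rfl⟩
    exact hfY i
  have heval : ∀ s ∈ linearSubvariety η V, ∀ g, evalAt s (θ g) = evalAt s g := by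
    intro s hs g
    refine algHom_congr (φ := (evalAt s).comp θ) (ψ := evalAt s) (fun x => ?_) g
    have h1 : ((evalAt s).comp θ).toLinearMap ∘ₗ ι k 𝔞 = (evalAt s).toLinearMap ∘ₗ ι k 𝔞 := by
      refine X.ext fun i => ?_
      change evalAt s (θ (ι k 𝔞 (X i))) = evalAt s (ι k 𝔞 (X i))
      rw [lift_ι_apply, X.constr_basis]
      rcases i with i | j
      · exact hf i s hs
      · obtain ⟨v, hv, rfl⟩ := hs
        rw [Sum.elim_inr, AlgHom.commutes, evalAt_ι, LinearMap.add_apply, hX v hv, add_zero]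
        rfl
    exact LinearMap.congr_fun h1 x
  intro y hy
  have h1 : y - θ y = 0 := hφ.eq_zero (sub_mem hy (hY (hadj y))) fun s hs => by
    rw [map_sub, heval s hs, sub_self]
  rw [sub_eq_zero.1 h1]
  exact hadj y

variable [IsAlgClosed k] [CharZero k] [FiniteDimensional k 𝔞]

/-- A Weierstrass section contains a point whose stabilizer has the dimension of the section, and
no stabilizer is smaller. -/
theorem IsWeierstrassSection.exists_finrank_stabilizer (h𝔞 : IsAlgebraic k 𝔞)
    (hSy : poissonSemicentre k 𝔞 = Subalgebra.toSubmodule (invariants k 𝔞))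
    {η : Module.Dual k 𝔞} {V : Submodule k (Module.Dual k 𝔞)} (hφ : IsWeierstrassSection η V) :
    ∃ s ∈ linearSubvariety η V, Module.finrank k (stabilizer s) ≤ Module.finrank k V ∧
      ∀ ζ : Module.Dual k 𝔞, Module.finrank k V ≤ Module.finrank k (stabilizer ζ) := by
  obtain ⟨m, X, hXV, hXV'⟩ := exists_basis_adapted V
  choose f hfY hf using fun i => hφ.exists_invariant (ι k 𝔞 (X (Sum.inl i)))
  have hD : ∀ a, ∀ x : 𝔞, symAd x (f a) = 0 := fun a x => symAd_eq_zero (hfY a) x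
  obtain ⟨t, ht⟩ := exists_algebraicIndependent_of_le_adjoin
    (SymmetricAlgebra.equivMvPolynomial X).symm (invariants k 𝔞) f hfY
    (hφ.invariants_le_adjoin X hXV' hfY hf)
  obtain ⟨L, _, _, hinj, hrank⟩ := exists_card_le_rank h𝔞 hSy ht X
  set Ω := commutatorMatrix X with hΩ
  set B := jacobianMatrix X f with hB
  set b := (B.submatrix id Sum.inl).det with hb
  set q := (Ω.submatrix Sum.inr Sum.inr).det with hq
  have hBΩ : B * Ω = 0 := jacobianMatrix_mul_commutatorMatrix X hD
  have hΩt : Ω.transpose = -Ω := transpose_commutatorMatrix X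
  -- Each `f i` equals a coordinate along the section, so its derivatives in the directions of `V`
  -- form the identity matrix.
  have hbs : ∀ s ∈ linearSubvariety η V, evalAt s b = 1 := by
    intro s hs
    rw [hb, AlgHom.map_det]
    have h1 : (evalAt s).mapMatrix (B.submatrix id Sum.inl) = 1 := by
      ext i j
      change evalAt s (partialDerivative (X.coord (Sum.inl j)) (f i)) = _
      have h2 : evalAt s (partialDerivative (X.coord (Sum.inl j))
          (f i - ι k 𝔞 (X (Sum.inl i)))) = 0 := by
        apply evalAt_partialDerivative_eq_zero
        intro c
        rw [map_sub, sub_eq_zero]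
        exact hf i _ (add_mem_linearSubvariety hs (V.smul_mem c (hXV j)))
      rw [map_sub, map_sub, partialDerivative_ι, AlgHom.commutes, sub_eq_zero] at h2
      rw [h2, X.coord_apply, X.repr_self, Matrix.one_apply, Finsupp.single_apply]
      simp
    rw [h1, Matrix.det_one]
  have hη : η ∈ linearSubvariety η V := ⟨0, V.zero_mem, (add_zero η).symm⟩
  have hb0 : b ≠ 0 := by
    intro h
    have := hbs η hη
    rw [h, map_zero] at this
    exact zero_ne_one this
  set ψ := algebraMap (SymmetricAlgebra k 𝔞) L with hψ
  have hle : (Ω.map ψ).rank ≤ ((Ω.map ψ).submatrix Sum.inr Sum.inr).rank := by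
    refine rank_le_rank_toBlocks₂₂ (B := B.map ψ) ?_ ?_ ?_
    · rw [← Matrix.map_mul, hBΩ, Matrix.map_zero _ (map_zero ψ)]
    · rw [← Matrix.transpose_map, hΩt]
      ext i j
      simp
    · change (ψ.mapMatrix (B.submatrix id Sum.inl)).det ≠ 0
      rw [← RingHom.map_det]
      exact (map_ne_zero_iff ψ hinj).2 hb0
  have hq0 : q ≠ 0 := by
    rw [← map_ne_zero_iff ψ hinj, hq, RingHom.map_det]
    exact det_ne_zero_of_le_rank (hrank.trans hle)
  have hgen : (Ω.map ψ).rank ≤ m :=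
    hle.trans ((Matrix.rank_le_card_height _).trans (Fintype.card_fin m).le)
  have hcard : Fintype.card (Fin (Module.finrank k V) ⊕ Fin m) = Module.finrank k V + m := by
    simp
  -- The fraction `q / b²` in lowest terms is `g / h`.
  obtain ⟨g, h, c, hgh, hcg, hch⟩ := UniqueFactorizationMonoid.exists_reduced_factors q hq0 (b ^ 2)
  have hc0 : c ≠ 0 := by rintro rfl; rw [zero_mul] at hcg; exact hq0 hcg.symm
  have hg0 : g ≠ 0 := by rintro rfl; rw [mul_zero] at hcg; exact hq0 hcg.symm
  have hg : g ∈ invariants k 𝔞 := by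
    refine mem_invariants_of_dvd hSy hg0 fun x => ?_
    have h1 : b * symAd x q = q * (2 * symAd x b + 2 * (adjointMatrix X x).trace * b) :=
      derivation_det_toBlocks₂₂ (symAd x) hBΩ hΩt (map_symAd_commutatorMatrix X x)
        (map_symAd_jacobianMatrix X hD x)
    -- This is the logarithmic derivative of `q / b²`, namely `2 tr (ad x)`. After cancelling `c²`
    -- it forces `g ∣ h · symAd x g`, and coprimality removes `h`.
    have h2 : b ^ 2 * symAd x q =
        q * symAd x (b ^ 2) + 2 * (adjointMatrix X x).trace * q * b ^ 2 := by
      rw [pow_two, Derivation.leibniz, smul_eq_mul]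
      linear_combination b * h1
    rw [← hcg, ← hch, Derivation.leibniz, Derivation.leibniz] at h2
    simp only [smul_eq_mul] at h2
    refine hgh.dvd_of_dvd_mul_left ⟨symAd x h + 2 * (adjointMatrix X x).trace * h, ?_⟩
    apply mul_left_cancel₀ (mul_ne_zero hc0 hc0)
    linear_combination h2
  obtain ⟨s, hs, hgs⟩ : ∃ s ∈ linearSubvariety η V, evalAt s g ≠ 0 := by
    by_contra! hcon
    exact hg0 (hφ.eq_zero hg hcon)
  -- Since `c h = b²` equals `1` at `s`, the common factor `c` does not vanish there.
  have hqs : evalAt s q ≠ 0 := by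
    rw [← hcg, map_mul]
    refine mul_ne_zero (fun h0 => ?_) hgs
    have := congrArg (evalAt s) hch
    rw [map_mul, map_pow, hbs s hs, h0, zero_mul, one_pow] at this
    exact zero_ne_one this
  refine ⟨s, hs, ?_, fun ζ => ?_⟩
  · have h1 := finrank_stabilizer_add_rank X s
    have h2 : m ≤ ((commutatorMatrix X).map (evalAt s)).rank := by
      rw [hq, AlgHom.map_det] at hqs
      have h3 := Matrix.rank_of_isUnit _
        ((Matrix.isUnit_iff_isUnit_det _).2 (isUnit_iff_ne_zero.2 hqs))
      rw [Fintype.card_fin] at h3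
      exact h3.symm.le.trans
        (Matrix.rank_submatrix_le ((commutatorMatrix X).map (evalAt s)) Sum.inr Sum.inr)
    rw [hcard] at h1
    omega
  · have h1 := finrank_stabilizer_add_rank X ζ
    have h2 := rank_map_le (evalAt ζ) ψ hinj (commutatorMatrix X)
    rw [hcard] at h1
    have h3 : ((commutatorMatrix X).map (evalAt ζ)).rank ≤ m := h2.trans hgen
    omega

end Regular

/-! ## Density -/

section Density

variable {k 𝔞 : Type*} [Field k] [LieRing 𝔞] [LieAlgebra k 𝔞]

/-- The span of the derivatives of order `n` of the elements of `N`. -/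
noncomputable def derivativeSpan (N : Submodule k (SymmetricAlgebra k 𝔞)) :
    ℕ → Submodule k (SymmetricAlgebra k 𝔞)
  | 0 => N
  | n + 1 => Submodule.span k
      {f | ∃ (v : Module.Dual k 𝔞), ∃ g ∈ derivativeSpan N n, f = partialDerivative v g}

theorem partialDerivative_mem_derivativeSpan (N : Submodule k (SymmetricAlgebra k 𝔞)) {n : ℕ}
    {g : SymmetricAlgebra k 𝔞} (hg : g ∈ derivativeSpan N n) (v : Module.Dual k 𝔞) :
    partialDerivative v g ∈ derivativeSpan N (n + 1) :=
  Submodule.subset_span ⟨v, g, hg, rfl⟩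

/-- The commutator of an adjoint and a constant vector field is constant, so moving `symAd x` past a
derivative preserves the order. -/
theorem symAd_mem_derivativeSpan {N : Submodule k (SymmetricAlgebra k 𝔞)}
    (hN : ∀ x : 𝔞, ∀ f ∈ N, symAd x f ∈ N) (n : ℕ) (x : 𝔞) :
    ∀ f ∈ derivativeSpan N n, symAd x f ∈ derivativeSpan N n := by
  induction n with
  | zero => exact hN x
  | succ n ih =>
    intro f hf
    induction hf using Submodule.span_induction with
    | mem f hf =>
      obtain ⟨v, g, hg, rfl⟩ := hf
      rw [symAd_partialDerivative]
      exact add_mem (partialDerivative_mem_derivativeSpan N (ih g hg) v)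
        (partialDerivative_mem_derivativeSpan N hg _)
    | zero => simp
    | add f g _ _ hf hg => rw [map_add]; exact add_mem hf hg
    | smul c f _ hf => rw [Derivation.map_smul]; exact Submodule.smul_mem _ c hf

theorem partialDerivative_comm (v w : Module.Dual k 𝔞) (f : SymmetricAlgebra k 𝔞) :
    partialDerivative v (partialDerivative w f) = partialDerivative w (partialDerivative v f) := by
  have : ⁅partialDerivative v, partialDerivative w⁆ = 0 := derivation_ext fun m => by
    simp [Derivation.commutator_apply]
  rw [← sub_eq_zero, ← Derivation.commutator_apply, this, Derivation.zero_apply]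

/-- A family of functions stable under `𝔞` and vanishing on an affine subspace meeting an orbit
with complementary tangent spaces is zero. -/
theorem eq_zero_of_sup_eq_top [CharZero k] [FiniteDimensional k 𝔞]
    {V : Submodule k (Module.Dual k 𝔞)} {s : Module.Dual k 𝔞}
    (hs : infinitesimalOrbit s ⊔ V = ⊤) {N : Submodule k (SymmetricAlgebra k 𝔞)}
    (hN : ∀ x : 𝔞, ∀ f ∈ N, symAd x f ∈ N) (hNV : ∀ f ∈ N, ∀ v ∈ V, evalAt (s + v) f = 0)
    {f : SymmetricAlgebra k 𝔞} (hf : f ∈ N) : f = 0 := by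
  let word : List (Module.Dual k 𝔞) → Module.End k (SymmetricAlgebra k 𝔞) := fun l =>
    l.foldr (fun v u => (partialDerivative v).toLinearMap ∘ₗ u) LinearMap.id
  have hcons : ∀ v l g, word (v :: l) g = partialDerivative v (word l g) := fun _ _ _ => rfl
  have hcomm : ∀ l v g, word l (partialDerivative v g) = partialDerivative v (word l g) := by
    intro l v g
    induction l with
    | nil => rfl
    | cons w l ih => rw [hcons, hcons, ih, partialDerivative_comm]
  have hmem : ∀ (l : List (Module.Dual k 𝔞)) n, ∀ g ∈ derivativeSpan N n,
      word l g ∈ derivativeSpan N (n + l.length) := by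
    intro l n g hg
    induction l with
    | nil => exact hg
    | cons w l ih => exact partialDerivative_mem_derivativeSpan N ih w
  have hV : ∀ l : List (Module.Dual k 𝔞), (∀ w ∈ l, w ∈ V) → ∀ g,
      (∀ v ∈ V, evalAt (s + v) g = 0) → ∀ v ∈ V, evalAt (s + v) (word l g) = 0 := by
    intro l hl g hg
    induction l with
    | nil => exact hg
    | cons w l ih =>
      intro v hv
      rw [hcons]
      apply evalAt_partialDerivative_eq_zero
      intro c
      rw [add_assoc]
      exact ih (fun u hu => hl u (List.mem_cons_of_mem _ hu)) _
        (add_mem hv (V.smul_mem c (hl w List.mem_cons_self)))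
  -- Induction on the order of the derivatives: the Taylor coefficients at `s` of all elements of
  -- `N` vanish.
  have main : ∀ n, ∀ g ∈ derivativeSpan N n, evalAt s g = 0 := by
    intro n
    induction n with
    | zero =>
      intro g hg
      have := hNV g hg 0 V.zero_mem
      rwa [add_zero] at this
    | succ n ihn =>
      -- Among `n + 1` directions, `i` are arbitrary and those in `l` lie in `V`. Lowering `i` moves
      -- one direction at a time into `V`; at `i = 0` all derivatives are along the section, where
      -- `N` vanishes.
      have key : ∀ i, ∀ l : List (Module.Dual k 𝔞), i + l.length = n + 1 → (∀ w ∈ l, w ∈ V) →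
          ∀ g ∈ derivativeSpan N i, evalAt s (word l g) = 0 := by
        intro i
        induction i with
        | zero =>
          intro l _ hl g hg
          have := hV l hl g (hNV g hg) 0 V.zero_mem
          rwa [add_zero] at this
        | succ i ihi =>
          intro l hlen hl g hg
          induction hg using Submodule.span_induction with
          | mem g hg =>
            obtain ⟨v, g, hg, rfl⟩ := hg
            -- Split the direction as `x·s + w`. At `s` the derivative along `x·s` is `-symAd x`
            -- applied to a derivative of order `n`, which vanishes by induction because order-`n`
            -- derivatives are stable under `𝔞`.
            obtain ⟨_, ⟨x, rfl⟩, w, hw, rfl⟩ := Submodule.mem_sup.1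
              (hs ▸ Submodule.mem_top : v ∈ infinitesimalOrbit s ⊔ V)
            rw [hcomm, partialDerivative_add, Derivation.add_apply, map_add]
            have h1 : word l g ∈ derivativeSpan N n := by
              have := hmem l i g hg
              rwa [show i + l.length = n by omega] at this
            have h2 := ihn _ (symAd_mem_derivativeSpan hN n x _ h1)
            rw [evalAt_symAd, neg_eq_zero] at h2
            rw [h2, zero_add]
            exact ihi (w :: l) (by rw [List.length_cons]; omega)
              (by
                intro u hu
                rcases List.mem_cons.1 hu with rfl | hu
                · exact hw
                · exact hl u hu) g hg
          | zero => rw [map_zero, map_zero]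
          | add g g' _ _ hg hg' => rw [map_add, map_add, hg, hg', add_zero]
          | smul c g _ hg => rw [map_smul, map_smul, hg, smul_zero]
      intro g hg
      exact key (n + 1) [] rfl (by simp) g hg
  refine eq_zero_of_iterate_partialDerivative s fun v n => main n _ ?_
  induction n with
  | zero => exact hf
  | succ n ih =>
    rw [Function.iterate_succ_apply']
    exact partialDerivative_mem_derivativeSpan N ih v

variable [IsAlgClosed k] [CharZero k] [FiniteDimensional k 𝔞]

theorem zariskiClosure_saturation_eq_univ {η : Module.Dual k 𝔞}
    {V : Submodule k (Module.Dual k 𝔞)} {s : Module.Dual k 𝔞} (hs : s ∈ linearSubvariety η V)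
    (hsV : infinitesimalOrbit s ⊔ V = ⊤) :
    zariskiClosure (saturation (linearSubvariety η V)) = Set.univ := by
  refine Set.eq_univ_of_forall fun ξ f hf => ?_
  let N : Submodule k (SymmetricAlgebra k 𝔞) :=
    { carrier := {g | ∀ ζ ∈ saturation (linearSubvariety η V), evalAt ζ g = 0}
      zero_mem' := fun ζ _ => map_zero _
      add_mem' := fun hg hg' ζ hζ => by rw [map_add, hg ζ hζ, hg' ζ hζ, add_zero]
      smul_mem' := fun c g hg ζ hζ => by rw [map_smul, hg ζ hζ, smul_zero] }
  have : f = 0 := eq_zero_of_sup_eq_top hsV (N := N)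
    (fun x g hg => evalAt_symAd_saturation hg x)
    (fun g hg v hv => hg _ (subset_saturation _ (add_mem_linearSubvariety hs hv))) hf
  rw [this, map_zero]

end Density

end CoadjointSlice

theorem mainTheorem6 {k 𝔞 : Type*} [Field k] [IsAlgClosed k] [CharZero k]
    [LieRing 𝔞] [LieAlgebra k 𝔞] [FiniteDimensional k 𝔞]
    (h𝔞 : CoadjointSlice.IsAlgebraic k 𝔞)
    (hSy : CoadjointSlice.poissonSemicentre k 𝔞 =
      Subalgebra.toSubmodule (CoadjointSlice.invariants k 𝔞))
    (η : Module.Dual k 𝔞) (V : Submodule k (Module.Dual k 𝔞))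
    (hφ : CoadjointSlice.IsWeierstrassSection η V) :
    CoadjointSlice.zariskiClosure
        (CoadjointSlice.saturation (CoadjointSlice.linearSubvariety η V)) = Set.univ ∧
    (∃ ξ ∈ CoadjointSlice.linearSubvariety η V, CoadjointSlice.IsRegular ξ) ∧
    (∀ ξ : Module.Dual k 𝔞,
      (CoadjointSlice.coadjointOrbit ξ ∩ CoadjointSlice.linearSubvariety η V).Subsingleton) ∧
    (∀ s ∈ CoadjointSlice.linearSubvariety η V, CoadjointSlice.IsTransversalAt V s) ∧
    CoadjointSlice.IsAffineSlice η V := by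
  obtain ⟨s, hs, hsle, hle⟩ := hφ.exists_finrank_stabilizer h𝔞 hSy
  have htop : CoadjointSlice.infinitesimalOrbit s ⊔ V = ⊤ := by
    -- The dimension of `𝔞·s` is `dim 𝔞 - dim 𝔞^s ≥ dim 𝔞 - dim V`, so the direct sum with `V` fills
    -- `𝔞*`.
    refine Submodule.eq_top_of_disjoint _ _ ?_ (hφ.isTransversalAt hs)
    have h1 : Module.finrank k (CoadjointSlice.infinitesimalOrbit s) +
        Module.finrank k (CoadjointSlice.stabilizer s) = Module.finrank k 𝔞 :=
      LinearMap.finrank_range_add_finrank_ker _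
    rw [Subspace.dual_finrank_eq]
    omega
  have hdense := CoadjointSlice.zariskiClosure_saturation_eq_univ hs htop
  refine ⟨hdense, ⟨s, hs, fun ζ => hsle.trans (hle ζ)⟩, hφ.subsingleton_inter,
    fun t ht => hφ.isTransversalAt ht, hdense, ?_⟩
  rintro _ ⟨t, ht, a, ha, rfl⟩
  refine ⟨t, (hφ.subsingleton_inter _).eq_singleton_of_mem ⟨⟨a⁻¹, inv_mem ha, ?_⟩, ht⟩,
    hφ.isTransversalAt ht⟩
  rw [← CoadjointSlice.coadjoint_mul, inv_mul_cancel, CoadjointSlice.coadjoint_one]
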